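/- **Notation.** Let $\mathcal H^n$ be the $n$-dimensional Hausdorff measure on $\mathbb R^{n+1}$ (normalized to agree with Lebesgue measure on $n$-planes), $\omega_n$ the volume of the unit ball of $\mathbb R^n$, and $\|A\|$ the operator norm. Identify a subspace $S\in\mathbf G(n+1,n)$ with the orthogonal projection onto it. Let $T=\{x_{n+1}=0\}$, and let $T^\perp$ be its orthogonal complement. Let $\Omega\in C^2(\mathbb R^{n+1})$ be a weight function: $0<\Omega\le 1$, and $|\nabla\Omega|\le c\,\Omega$, $\|\nabla^2\Omega\|\le c\,\Omega$ for some constant $c$. $\mathcal{OP}^N_\Omega$ is the set of all $\mathcal E=\{E_i\}_{i=1}^N$ such that the $E_i\subset\mathbb R^{n+1}$ are open and mutually disjoint, $\int_{\mathbb R^{n+1}\setminus\bigcup_iE_i}\Omega\,d\mathcal H^n<\infty$, and $\Gamma:=\bigcup_i\partial E_i$ is countably $n$-rectifiable (covered, up to an $\mathcal H^n$-null set, by countably many Lipschitz images of $\mathbb R^n$). Let $\partial\mathcal E$ be the unit density varifold of $\Gamma$, that is, the measure on $\mathbb R^{n+1}\times\mathbf G(n+1,n)$ with $\partial\mathcal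 E(\phi)=\int_\Gamma\phi(x,\mathrm{Tan}^n(\Gamma,x))\,d\mathcal H^n(x)$, where $\mathrm{Tan}^n(\Gamma,x)$ is the approximate tangent space, and let $\|\partial\mathcal E\|$ be its weight measure on $\mathbb R^{n+1}$. The density is $\theta^n(\mu,y)=\lim_{r\to0+}\mu(\{x:|x-y|\le r\})/(\omega_nr^n)$. A Lipschitz map $f:\mathbb R^{n+1}\to\mathbb R^{n+1}$ is $\mathcal E$-admissible if the sets $\tilde E_i:=\mathrm{int}\,f(E_i)$ are mutually disjoint, $\mathbb R^{n+1}\setminus\bigcup_i\tilde E_i\subset f(\Gamma)$, and $\sup_x|f(x)-x|<\infty$; then $f_\star\mathcal E:=\{\tilde E_i\}_{i=1}^N$. For $j\in\mathbb N$ let $\mathcal A_j$ be the set of $\phi\in C^2(\mathbb R^{n+1};[0,\infty))$ with $\phi\le\Omega$, $|\nabla\phi|\le j\phi$ and $\|\nabla^2\phi\|\le j\phi$. For a compact set $C$ let $\mathbf E(\mathcal E,C,j)$ be the set of $\mathcal E$-admissible $f$ with $|f(x)-x|\le j^{-2}$ for all $x$; $\mathcal L^{n+1}(\tilde E_i\triangle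 E_i)\le j^{-1}$ for all $i$; $\int\phi\,d\|\partial f_\star\mathcal E\|\le\int\phi\,d\|\partial\mathcal E\|$ for all $\phi\in\mathcal A_j$; and $\{x:f(x)\ne x\}\cup\{f(x):f(x)\ne x\}\subset C$. Put $$\Delta_j\|\partial\mathcal E\|(C):=\inf_{f\in\mathbf E(\mathcal E,C,j)}\big(\|\partial f_\star\mathcal E\|(C)-\|\partial\mathcal E\|(C)\big).$$ For a finite set $Y\subset T^\perp$ and $r_1,r_2>0$ let $$E(r_1,r_2):=\{x\in\mathbb R^{n+1}:|T(x)|\le r_1,\ \mathrm{dist}(T^\perp(x),Y)\le r_2\},$$ which is empty if $Y=\emptyset$. **Lemma.** Given $n,\nu\in\mathbb N$, $\alpha\in(0,1)$ and $\zeta\in(0,1)$, there exist $\gamma\in(0,1)$ and $j_0\in\mathbb N$, depending only on $n,\nu,\alpha,\zeta$, with the following property. Let $\Omega$ be a weight function as above, and assume: 1. $\mathcal E=\{E_i\}_{i=1}^N\in\mathcal{OP}^N_\Omega$ for some $N$, $j\in\mathbb N$ with $j\ge j_0$, $R\in(0,\tfrac12j^{-2})$ and $\rho\in(0,\tfrac12j^{-2})$;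 2. $\rho\ge\alpha R$; 3. $Y\subset T^\perp$ has no more than $\nu$ elements, $\mathrm{diam}\,Y<j^{-2}$, and $\theta^n(\|\partial\mathcal E\|,y)=1$ for all $y\in Y$; and, writing $E^*(r):=E(r,(1+R^{-1}r)\rho)$, 4. $\int_{E^*(r)\times\mathbf G(n+1,n)}\|S-T\|\,d(\partial\mathcal E)(x,S)\le\gamma\,\|\partial\mathcal E\|(E^*(r))$ for all $r\in(0,R)$; 5. $\Delta_j\|\partial\mathcal E\|(E^*(r))\ge-\gamma\,\|\partial\mathcal E\|(E^*(r))$ for all $r\in(0,R)$. Then $$\|\partial\mathcal E\|(E(R,2\rho))\ge(\#Y-\zeta)\,\omega_nR^n.$$ -/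

import Mathlib

open MeasureTheory Set Filter Topology Module

namespace OpenPartition

noncomputable section

/-- The ambient Euclidean space `ℝⁿ⁺¹`. -/
abbrev Euc (n : ℕ) : Type := EuclideanSpace ℝ (Fin (n + 1))

/-- The volume `ω_n` of the unit ball of `ℝⁿ`. -/
def unitBallVolume (n : ℕ) : ℝ :=
  (volume : Measure (EuclideanSpace ℝ (Fin n))).real (Metric.ball 0 1)

/-! ### Grassmannian, rectifiable sets and varifolds -/

/-- The Grassmannian `G(n+1,n)` of `n`-dimensional linear subspaces of `ℝⁿ⁺¹`. -/
def Grass (n : ℕ) : Type := {S : Submodule ℝ (Euc n) // finrank ℝ S = n}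

/-- The orthogonal projection of `ℝⁿ⁺¹` onto `S ∈ G(n+1,n)`. -/
def Grass.proj {n : ℕ} (S : Grass n) : Euc n →L[ℝ] Euc n := S.1.starProjection

/-- A subspace is identified with its orthogonal projection: the Grassmannian carries the topology
induced by the operator norm. -/
instance Grass.instTopologicalSpace (n : ℕ) : TopologicalSpace (Grass n) :=
  TopologicalSpace.induced Grass.proj inferInstance

/-- The Borel `σ`-algebra of the Grassmannian. -/
instance Grass.instMeasurableSpace (n : ℕ) : MeasurableSpace (Grass n) :=
  borel (Grass n)

instance Grass.instBorelSpace (n : ℕ) : BorelSpace (Grass n) := ⟨rfl⟩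

/-- The linear functional `x ↦ x_{n+1}`. -/
def lastCoord (n : ℕ) : Euc n →ₗ[ℝ] ℝ := (EuclideanSpace.proj (𝕜 := ℝ) (Fin.last n)).toLinearMap

theorem finrank_ker_lastCoord (n : ℕ) : finrank ℝ (LinearMap.ker (lastCoord n)) = n := by
  have hs : LinearMap.range (lastCoord n) = ⊤ := by
    rw [LinearMap.range_eq_top]
    intro c
    exact ⟨EuclideanSpace.single (Fin.last n) c, by simp [lastCoord]⟩
  have h := LinearMap.finrank_range_add_finrank_ker (lastCoord n)
  rw [hs, finrank_top, finrank_self, finrank_euclideanSpace, Fintype.card_fin] at h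
  omega

/-- The hyperplane `T = {x_{n+1} = 0}`. -/
def horizontal (n : ℕ) : Grass n := ⟨LinearMap.ker (lastCoord n), finrank_ker_lastCoord n⟩

/-- `Γ` is countably `n`-rectifiable: up to an `ℋⁿ`-null set it is covered by countably many
Lipschitz images of `ℝⁿ`. -/
def IsCountablyRectifiable {n : ℕ} (Γ : Set (Euc n)) : Prop :=
  ∃ g : ℕ → EuclideanSpace ℝ (Fin n) → Euc n,
    (∀ k, ∃ K, LipschitzWith K (g k)) ∧ μHE[n] (Γ \ ⋃ k, range (g k)) = 0

/-- `P` is the approximate tangent space of `Γ` at `x`: the blow-ups of `ℋⁿ⌊Γ` at `x` converge to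
`ℋⁿ⌊P` in duality with compactly supported continuous functions. -/
def IsApproxTangent {n : ℕ} (Γ : Set (Euc n)) (x : Euc n) (P : Grass n) : Prop :=
  ∀ φ : Euc n → ℝ, Continuous φ → HasCompactSupport φ →
    Tendsto (fun r : ℝ => (r ^ n)⁻¹ * ∫ y in Γ, φ (r⁻¹ • (y - x)) ∂μHE[n]) (𝓝[>] 0)
      (𝓝 (∫ y in (P.1 : Set (Euc n)), φ y ∂μHE[n]))

open Classical in
/-- `Tanⁿ(Γ, x)`, with an arbitrary value where there is no approximate tangent space. -/
def approxTangent {n : ℕ} (Γ : Set (Euc n)) (x : Euc n) : Grass n :=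
  if h : ∃ P : Grass n, IsApproxTangent Γ x P then h.choose else horizontal n

/-- An `n`-varifold of `ℝⁿ⁺¹` is a measure on `ℝⁿ⁺¹ × G(n+1,n)`. -/
abbrev Varifold (n : ℕ) : Type := Measure (Euc n × Grass n)

/-- The varifold `|Γ|`: the image of `ℋⁿ⌊Γ` under `x ↦ (x, Tanⁿ(Γ, x))`, so that
`|Γ|(φ) = ∫_Γ φ(x, Tanⁿ(Γ, x)) dℋⁿ(x)`. -/
def setVarifold {n : ℕ} (Γ : Set (Euc n)) : Varifold n :=
  (μHE[n].restrict Γ).map fun x => (x, approxTangent Γ x)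

/-- The weight measure `‖V‖` of a varifold. -/
def weight {n : ℕ} (V : Varifold n) : Measure (Euc n) := V.map Prod.fst

/-- The `n`-dimensional density of `μ` at `x` exists and equals `θ`. -/
def HasDensity {n : ℕ} (μ : Measure (Euc n)) (x : Euc n) (θ : ℝ) : Prop :=
  Tendsto (fun r : ℝ => μ.real (Metric.closedBall x r) / (unitBallVolume n * r ^ n))
    (𝓝[>] 0) (𝓝 θ)

/-! ### Open partitions and their deformations -/

/-- The weight functions: `Ω ∈ C²`, `0 < Ω ≤ 1`, `|∇Ω| ≤ c Ω` and `‖∇²Ω‖ ≤ c Ω`. -/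
def IsWeightFunction {n : ℕ} (Ω : Euc n → ℝ) : Prop :=
  ContDiff ℝ 2 Ω ∧ (∀ x, 0 < Ω x ∧ Ω x ≤ 1) ∧
    ∃ c : ℝ, ∀ x, ‖fderiv ℝ Ω x‖ ≤ c * Ω x ∧ ‖fderiv ℝ (fderiv ℝ Ω) x‖ ≤ c * Ω x

/-- `⋃ i, ∂E_i`. -/
def bdry {n N : ℕ} (E : Fin N → Set (Euc n)) : Set (Euc n) := ⋃ i, frontier (E i)

/-- `E` is an `Ω`-finite open partition of `N` elements. -/
structure IsOpenPartition {n N : ℕ} (Ω : Euc n → ℝ) (E : Fin N → Set (Euc n)) : Prop where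
  isOpen : ∀ i, IsOpen (E i)
  disjoint : Pairwise fun i k => Disjoint (E i) (E k)
  finite : ∫⁻ x in (⋃ i, E i)ᶜ, ENNReal.ofReal (Ω x) ∂μHE[n] < ⊤
  rectifiable : IsCountablyRectifiable (bdry E)

/-- The unit density varifold `∂E = |⋃ i, ∂E_i|`. -/
def bdryVarifold {n N : ℕ} (E : Fin N → Set (Euc n)) : Varifold n := setVarifold (bdry E)

/-- The boundary mass measure `‖∂E‖`. -/
def bdryMass {n N : ℕ} (E : Fin N → Set (Euc n)) : Measure (Euc n) := weight (bdryVarifold E)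

/-- The push-forward `f_⋆ E`, whose members are `int (f (E_i))`. -/
def pushforward {n N : ℕ} (f : Euc n → Euc n) (E : Fin N → Set (Euc n)) :
    Fin N → Set (Euc n) :=
  fun i => interior (f '' E i)

/-- `f` is `E`-admissible. -/
structure IsAdmissible {n N : ℕ} (E : Fin N → Set (Euc n)) (f : Euc n → Euc n) : Prop where
  lipschitz : ∃ K, LipschitzWith K f
  disjoint : Pairwise fun i k => Disjoint (pushforward f E i) (pushforward f E k)
  compl_subset : (⋃ i, pushforward f E i)ᶜ ⊆ f '' bdry E
  bounded : ∃ M : ℝ, ∀ x, ‖f x - x‖ ≤ M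

/-- The class `𝒜_j` of test functions. -/
def testFunctions {n : ℕ} (Ω : Euc n → ℝ) (j : ℕ) : Set (Euc n → ℝ) :=
  {φ | ContDiff ℝ 2 φ ∧ ∀ x, 0 ≤ φ x ∧ φ x ≤ Ω x ∧ ‖fderiv ℝ φ x‖ ≤ j * φ x ∧
    ‖fderiv ℝ (fderiv ℝ φ) x‖ ≤ j * φ x}

/-- The class `𝐄(E, j)` of area reducing Lipschitz deformations. -/
structure IsDeformation {n N : ℕ} (Ω : Euc n → ℝ) (E : Fin N → Set (Euc n)) (j : ℕ)
    (f : Euc n → Euc n) : Prop where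
  admissible : IsAdmissible E f
  dist_le : ∀ x, ‖f x - x‖ ≤ 1 / (j : ℝ) ^ 2
  volume_le : ∀ i, volume (symmDiff (pushforward f E i) (E i)) ≤ ENNReal.ofReal (1 / j)
  mass_le : ∀ φ ∈ testFunctions Ω j,
    ∫⁻ x, ENNReal.ofReal (φ x) ∂bdryMass (pushforward f E) ≤
      ∫⁻ x, ENNReal.ofReal (φ x) ∂bdryMass E

/-- The class `𝐄(E, C, j)` of deformations that are localized in `C`. -/
def localDeformations {n N : ℕ} (Ω : Euc n → ℝ) (E : Fin N → Set (Euc n)) (C : Set (Euc n))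
    (j : ℕ) : Set (Euc n → Euc n) :=
  {f | IsDeformation Ω E j f ∧ {x | f x ≠ x} ∪ f '' {x | f x ≠ x} ⊆ C}

/-- `Δ_j ‖∂E‖(C)`, the infimum of `‖∂ f_⋆ E‖(C) - ‖∂E‖(C)` over `f ∈ 𝐄(E, C, j)`, for compact `C`.
-/
def massReduction {n N : ℕ} (Ω : Euc n → ℝ) (E : Fin N → Set (Euc n)) (j : ℕ)
    (C : Set (Euc n)) : ℝ :=
  sInf ((fun f => (bdryMass (pushforward f E)).real C - (bdryMass E).real C) ''
    localDeformations Ω E C j)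

/-- `E(r₁, r₂) = {x : |T(x)| ≤ r₁, dist(T^⊥(x), Y) ≤ r₂}`. The distance to the empty set is `∞`. -/
def cylinder {n : ℕ} (Y : Set (Euc n)) (r₁ r₂ : ℝ) : Set (Euc n) :=
  {x | ‖(horizontal n).proj x‖ ≤ r₁ ∧
    Metric.infEDist ((horizontal n).1ᗮ.starProjection x) Y ≤ ENNReal.ofReal r₂}

end

end OpenPartition

namespace OpenPartition

open scoped NNReal ENNReal RealInnerProductSpace

/-! ### Hausdorff measure of images under maps with directional Lipschitz bounds. -/

section Hausdorff

variable {X Y : Type*} [MetricSpace X] [MetricSpace Y]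
  [MeasurableSpace X] [BorelSpace X] [MeasurableSpace Y] [BorelSpace Y]

/-! Let `#Y = k + 1` and compare the mass of `E*(r)` with `ω_n r ^ n`. Density one at the points of
`Y` makes the quotient at least `k + 1 - ζ` for small `r`; if the conclusion failed, it would be
smaller for some `r` just below `R`. Descending from there by factors `1 - δ` one meets a scale `r`
at which the quotient is below `k + 1 - ζ`, while at `(1 - δ) r` it is not
(`exists_scale_crossing`). At this scale the mass of `E*(r)` is almost `(k + 1 - ζ) ω_n r ^ n`, and
the layer between the two cylinders has mass of order `δ`. The contradiction comes from a
deformation inside `E*(r)` which leaves hardly more than `k` sheets (`massReduction_lt`).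

The deformation is `expansion`. Fix a centre `a` in the horizontal disc and a small `σ`. The part of
`Γ` over the disc shrunk towards `a` by the factor `σ` is stretched horizontally by `σ⁻¹` over the
whole disc; everything else is pushed along the rays from `a` into the vertical wall. Across the
layer the factor is interpolated in the height from `σ` to `1`, so that nothing moves outside the
cylinder.

The area of the image is estimated in `exists_expansion_measure_le`. On average there are fewer than
`k + 1 - ζ` sheets over the disc and their number is an integer, so a definite proportion of the
points `a` has at most `k` sheets above it. By Lebesgue differentiation the stretched core then has
area about `k ω_n r ^ n` for small `σ`. The push into the wall collapses the radial direction, so a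
nearly horizontal piece loses almost all its area: what remains is bounded by the tilt times `(r /
|T x - a|) ^ (n - 1)`. This kernel is integrable in `a` over an `n`-dimensional disc, and the
kernels that belong to the core have integrals in `a` bounded independently of `σ`. Hence Fubini,
the small tilt and the small mass of the layer give a centre with small total error, although `σ` is
not bounded below.

With `η = (1 - ζ) / 8` the old area is at least `(k + 7η) ω_n r ^ n` and the new one at most `(k +
2η) ω_n r ^ n`. This beats the permitted reduction. It also gives the inequality for every `φ ∈
𝒜_j`, since such a `φ` varies on the cylinder at most by the factor `exp (4 / j)`
(`mem_localDeformations`). The expansion is admissible because its fibres are points or segments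
(`IsOpenPartition.isAdmissible`).

All area estimates rest on `exists_partition_almost_flat`: up to a null set `Γ` splits into pieces
whose secants are almost parallel to the approximate tangent spaces. This needs Sard's lemma for
Lipschitz maps and the fact that almost everywhere the range of the derivative of a parametrization
is the approximate tangent space. -/

theorem euclideanHausdorffMeasure_image_le {d : ℕ} {K : ℝ≥0} {f : X → Y} {A : Set X}
    (hf : LipschitzOnWith K f A) : μHE[d] (f '' A) ≤ (K : ℝ≥0∞) ^ d * μHE[d] A := by
  simp_rw [Measure.euclideanHausdorffMeasure_def, Measure.smul_apply, ENNReal.smul_def, smul_eq_mul]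
  have h := hf.hausdorffMeasure_image_le (d := (d : ℝ)) (by positivity)
  rw [ENNReal.rpow_natCast] at h
  calc _ ≤ _ * ((K : ℝ≥0∞) ^ d * μH[d] A) := by gcongr
    _ = _ := by ring

/-- If `f` is `C`-Lipschitz with respect to the pseudo-distance induced by `h` on `A`, then the
measure of `f '' A` is at most `C ^ d` times that of `h '' A`. -/
theorem euclideanHausdorffMeasure_image_le_image {X Y Z : Type*} [MetricSpace Y] [MetricSpace Z]
    [MeasurableSpace Y] [BorelSpace Y] [MeasurableSpace Z] [BorelSpace Z] {d : ℕ} {C : ℝ} (hC : 0 ≤ C) {f : X → Y}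
    {h : X → Z} {A : Set X}
    (hf : ∀ x ∈ A, ∀ y ∈ A, dist (f x) (f y) ≤ C * dist (h x) (h y)) :
    μHE[d] (f '' A) ≤ ENNReal.ofReal (C ^ d) * μHE[d] (h '' A) := by
  rcases A.eq_empty_or_nonempty with rfl | ⟨x₀, hx₀⟩
  · simp
  have : Nonempty X := ⟨x₀⟩
  -- Points of `A` with the same `h` have the same `f`, so `f` factors through `h`, and any right
  -- inverse of `h` on `A` serves.
  have key : LipschitzOnWith C.toNNReal (f ∘ Function.invFunOn h A) (h '' A) := by
    refine LipschitzOnWith.of_dist_le_mul fun p hp q hq => ?_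
    have hp' := Function.invFunOn_mem hp
    have hq' := Function.invFunOn_mem hq
    have := hf _ hp' _ hq'
    rwa [Function.invFunOn_eq hp, Function.invFunOn_eq hq, ← Real.coe_toNNReal C hC] at this
  have heq : (f ∘ Function.invFunOn h A) '' (h '' A) = f '' A := by
    rw [← image_comp]
    refine image_congr fun x hx => ?_
    have hx' : h x ∈ h '' A := mem_image_of_mem h hx
    have := hf _ (Function.invFunOn_mem hx') _ hx
    rw [Function.invFunOn_eq hx', dist_self, mul_zero] at this
    exact dist_le_zero.1 this
  have := euclideanHausdorffMeasure_image_le (d := d) key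
  rwa [heq, ← ENNReal.ofReal, ← ENNReal.ofReal_pow hC] at this

theorem euclideanHausdorffMeasure_image_le_of_dist_le {d : ℕ} {C : ℝ} (hC : 0 ≤ C) {f : X → Y}
    {A : Set X} (hf : ∀ x ∈ A, ∀ y ∈ A, dist (f x) (f y) ≤ C * dist x y) :
    μHE[d] (f '' A) ≤ ENNReal.ofReal (C ^ d) * μHE[d] A := by
  simpa using euclideanHausdorffMeasure_image_le_image (h := id) hC hf

/-- A map which expands by at most `κ` and, in the direction of a unit vector `h`, by at most `τ`,
as seen through a short map to an `n`-dimensional space, increases the `n`-dimensional measure at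
most by the factor `2 ^ n * κ ^ (n - 1) * τ`. -/
theorem euclideanHausdorffMeasure_image_le_of_stretch {V : Type*} [NormedAddCommGroup V]
    [InnerProductSpace ℝ V] [FiniteDimensional ℝ V] [MeasurableSpace V] [BorelSpace V]
    {m : ℕ} (hV : finrank ℝ V = m + 1) {p : X → V} {f : X → Y} {A : Set X} {h : V} (hh : ‖h‖ = 1)
    {κ τ : ℝ} (hκ : 0 < κ) (hτ : 0 ≤ τ)
    (hp : ∀ x ∈ A, ∀ y ∈ A, dist (p x) (p y) ≤ dist x y)
    (hf : ∀ x ∈ A, ∀ y ∈ A, dist (f x) (f y) ≤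
      κ * ‖(p x - p y) - ⟪h, p x - p y⟫ • h‖ + τ * |⟪h, p x - p y⟫|) :
    μHE[m + 1] (f '' A) ≤ ENNReal.ofReal (2 ^ (m + 1) * κ ^ m * τ) * μHE[m + 1] A := by
  have hhh : ⟪h, h⟫ = 1 := by rw [real_inner_self_eq_norm_sq, hh]; norm_num
  -- `D` multiplies `h` by `τ` and its complement by `κ`. The map `f` is 2-Lipschitz relative to `D
  -- ∘ p`, and the linear `D` scales volume exactly by `κ ^ m * τ`. The `2` compares the sum of the
  -- two components with the Euclidean norm.
  let φ : Dual ℝ V := ((τ / κ - 1) : ℝ) • (innerₛₗ ℝ h)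
  let D : V →ₗ[ℝ] V := κ • LinearMap.transvection φ h
  have hD : ∀ q, D q = κ • (q - ⟪h, q⟫ • h) + (τ * ⟪h, q⟫) • h := by
    intro q
    simp only [D, φ, LinearMap.smul_apply, LinearMap.transvection.apply, innerₛₗ_apply_apply]
    simp only [smul_eq_mul, smul_add, smul_sub, smul_smul]
    rw [show κ * ((τ / κ - 1) * ⟪h, q⟫) = τ * ⟪h, q⟫ - κ * ⟪h, q⟫ by field_simp, sub_smul]
    abel
  have hdet : LinearMap.det D = κ ^ m * τ := by
    simp only [D, LinearMap.det_smul, LinearMap.transvection.det, hV, φ, LinearMap.smul_apply,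
      innerₛₗ_apply_apply, hhh]
    simp only [smul_eq_mul]
    field_simp
    ring
  have hnorm : ∀ q, κ * ‖q - ⟪h, q⟫ • h‖ + τ * |⟪h, q⟫| ≤ 2 * ‖D q‖ := by
    intro q
    have horth : ⟪h, q - ⟪h, q⟫ • h⟫ = 0 := by
      rw [inner_sub_right, inner_smul_right, hhh]; ring
    have hinner : ⟪h, D q⟫ = τ * ⟪h, q⟫ := by
      rw [hD, inner_add_right, inner_smul_right, inner_smul_right, horth, hhh]; ring
    have h1 : τ * |⟪h, q⟫| ≤ ‖D q‖ := by
      have := abs_real_inner_le_norm h (D q)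
      rw [hinner, hh, one_mul, abs_mul, abs_of_nonneg hτ] at this
      exact this
    have h2 : κ * ‖q - ⟪h, q⟫ • h‖ ≤ ‖D q‖ := by
      have hsq : ‖D q‖ * ‖D q‖ = ‖κ • (q - ⟪h, q⟫ • h)‖ * ‖κ • (q - ⟪h, q⟫ • h)‖
          + ‖(τ * ⟪h, q⟫) • h‖ * ‖(τ * ⟪h, q⟫) • h‖ := by
        rw [hD]
        apply norm_add_sq_eq_norm_sq_add_norm_sq_real
        rw [inner_smul_left, inner_smul_right, real_inner_comm h, horth]
        simp
      have h3 : ‖κ • (q - ⟪h, q⟫ • h)‖ = κ * ‖q - ⟪h, q⟫ • h‖ := by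
        rw [norm_smul, Real.norm_of_nonneg hκ.le]
      rw [← h3]
      exact abs_le_of_sq_le_sq' (by nlinarith [mul_self_nonneg ‖(τ * ⟪h, q⟫) • h‖])
        (norm_nonneg _) |>.2
    linarith
  have step : μHE[m + 1] (f '' A) ≤
      ENNReal.ofReal (2 ^ (m + 1)) * μHE[m + 1] ((fun x => D (p x)) '' A) := by
    refine euclideanHausdorffMeasure_image_le_image zero_le_two fun x hx y hy => ?_
    rw [dist_eq_norm (D _), ← map_sub]
    exact (hf x hx y hy).trans (hnorm _)
  have hvol : (μHE[m + 1] : Measure V) = volume := by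
    rw [← hV]; exact InnerProductSpace.euclideanHausdorffMeasure_eq_volume
  have hpA : μHE[m + 1] (p '' A) ≤ μHE[m + 1] A := by
    simpa using euclideanHausdorffMeasure_image_le_of_dist_le (d := m + 1) (f := p) (A := A)
      (C := 1) zero_le_one (by simpa using hp)
  have himg : (fun x => D (p x)) '' A = D '' (p '' A) := (image_image _ _ _).symm
  calc _ ≤ _ := step
    _ = ENNReal.ofReal (2 ^ (m + 1)) * (ENNReal.ofReal (κ ^ m * τ) * μHE[m + 1] (p '' A)) := by
        rw [himg, hvol, Measure.addHaar_image_linearMap, hdet, abs_of_nonneg (by positivity)]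
    _ ≤ ENNReal.ofReal (2 ^ (m + 1)) * (ENNReal.ofReal (κ ^ m * τ) * μHE[m + 1] A) := by
        gcongr
    _ = _ := by
        rw [← mul_assoc, ← ENNReal.ofReal_mul (by positivity), mul_assoc]

end Hausdorff

/-! ### Sard's lemma and linear approximation of Lipschitz maps. -/

section Lipschitz

variable {V F : Type*} [NormedAddCommGroup V] [InnerProductSpace ℝ V] [FiniteDimensional ℝ V]
  [MeasurableSpace V] [BorelSpace V] [NormedAddCommGroup F] [InnerProductSpace ℝ F]
  [FiniteDimensional ℝ F] [MeasurableSpace F] [BorelSpace F]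

theorem euclideanHausdorffMeasure_eq_volume_of_finrank {n : ℕ} (hV : finrank ℝ V = n) :
    (μHE[n] : Measure V) = volume := by
  rw [← hV]; exact InnerProductSpace.euclideanHausdorffMeasure_eq_volume

theorem euclideanHausdorffMeasure_image_null {F : Type*} [NormedAddCommGroup F] [MeasurableSpace F]
    [BorelSpace F] {n : ℕ} (hV : finrank ℝ V = n) {g : V → F} {K : ℝ≥0}
    (hg : LipschitzWith K g) {N : Set V} (hN : volume N = 0) : μHE[n] (g '' N) = 0 := by
  have h := euclideanHausdorffMeasure_image_le (d := n) (hg.lipschitzOnWith (s := N))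
  rw [euclideanHausdorffMeasure_eq_volume_of_finrank hV, hN, mul_zero] at h
  exact le_antisymm h zero_le

/-- **Sard's lemma** for Lipschitz maps: the set of critical values is null. -/
theorem euclideanHausdorffMeasure_image_critical {m : ℕ} (hV : finrank ℝ V = m + 1)
    {g : V → F} {K : ℝ≥0} (hg : LipschitzWith K g) :
    μHE[m + 1] (g '' {a | DifferentiableAt ℝ g a ∧ ¬ Function.Injective (fderiv ℝ g a)}) = 0 := by
  set N := {a | DifferentiableAt ℝ g a ∧ ¬ Function.Injective (fderiv ℝ g a)} with hN
  have hbdd : ∀ k : ℕ, μHE[m + 1] (g '' (N ∩ Metric.closedBall 0 k)) = 0 := by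
    intro k
    set s := N ∩ Metric.closedBall 0 (k : ℝ) with hs
    rcases s.eq_empty_or_nonempty with he | hne
    · rw [he]; simp
    -- On a small piece `g` is stretched by at most `δ` in a kernel direction of a derivative and by
    -- at most `K + δ` in the others. Summing over the pieces and letting `δ → 0` gives measure
    -- zero; the intersection with a ball keeps the volume finite.
    have key : ∀ δ : ℝ, 0 < δ → μHE[m + 1] (g '' s) ≤
        ENNReal.ofReal (2 ^ (m + 1) * (K + δ) ^ m * δ) * volume (Metric.closedBall (0 : V) k) := by
      intro δ hδ
      obtain ⟨t, A, htd, htm, hst, happ, hA⟩ :=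
        exists_partition_approximatesLinearOn_of_hasFDerivWithinAt g s (fderiv ℝ g)
          (fun x hx => hx.1.1.hasFDerivAt.hasFDerivWithinAt) (fun _ => δ.toNNReal)
          (fun _ => by simpa using hδ)
      have hpiece : ∀ i, μHE[m + 1] (g '' (s ∩ t i)) ≤
          ENNReal.ofReal (2 ^ (m + 1) * (K + δ) ^ m * δ) * volume (s ∩ t i) := by
        intro i
        obtain ⟨y, hy, hAy⟩ := hA hne i
        have hAK : ‖A i‖ ≤ K := by
          rw [hAy]; exact norm_fderiv_le_of_lipschitz ℝ hg
        obtain ⟨v, hv, hv0⟩ : ∃ v, A i v = 0 ∧ v ≠ 0 := by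
          have := hy.1.2
          rw [← hAy] at this
          rw [injective_iff_map_eq_zero] at this
          push Not at this
          exact this
        set h := (‖v‖⁻¹ : ℝ) • v with hh
        have hnorm : ‖h‖ = 1 := norm_smul_inv_norm (𝕜 := ℝ) hv0
        have hAh : A i h = 0 := by rw [hh, map_smul, hv, smul_zero]
        rw [← euclideanHausdorffMeasure_eq_volume_of_finrank hV]
        refine euclideanHausdorffMeasure_image_le_of_stretch hV (p := id) hnorm (by positivity)
          hδ.le (fun _ _ _ _ => le_rfl) fun x hx y hy => ?_
        have h1 := happ i x hx y hy
        rw [Real.coe_toNNReal _ hδ.le] at h1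
        simp only [id]
        set q := x - y
        have h2 : A i q = A i (q - ⟪h, q⟫ • h) := by
          rw [map_sub (A i) q, map_smul, hAh, smul_zero, sub_zero]
        have h3 : ‖q‖ ≤ ‖q - ⟪h, q⟫ • h‖ + |⟪h, q⟫| := by
          calc ‖q‖ = ‖(q - ⟪h, q⟫ • h) + ⟪h, q⟫ • h‖ := by rw [sub_add_cancel]
            _ ≤ _ := norm_add_le _ _
            _ = _ := by rw [norm_smul, hnorm, mul_one, Real.norm_eq_abs]
        have h4 : ‖A i q‖ ≤ K * ‖q - ⟪h, q⟫ • h‖ := by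
          rw [h2]; exact (A i).le_of_opNorm_le hAK _
        rw [dist_eq_norm]
        calc ‖g x - g y‖ = ‖(g x - g y - A i q) + A i q‖ := by rw [sub_add_cancel]
          _ ≤ ‖g x - g y - A i q‖ + ‖A i q‖ := norm_add_le _ _
          _ ≤ δ * ‖q‖ + K * ‖q - ⟪h, q⟫ • h‖ := add_le_add h1 h4
          _ ≤ _ := by nlinarith
      calc μHE[m + 1] (g '' s) ≤ μHE[m + 1] (⋃ i, g '' (s ∩ t i)) := by
            refine measure_mono ?_
            rw [← image_iUnion, ← inter_iUnion]
            exact image_mono (subset_inter Subset.rfl hst)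
        _ ≤ ∑' i, μHE[m + 1] (g '' (s ∩ t i)) := measure_iUnion_le _
        _ ≤ ∑' i, ENNReal.ofReal (2 ^ (m + 1) * (K + δ) ^ m * δ) * volume (s ∩ t i) :=
            ENNReal.tsum_le_tsum hpiece
        _ = ENNReal.ofReal (2 ^ (m + 1) * (K + δ) ^ m * δ) * ∑' i, (volume.restrict s) (t i) := by
            rw [ENNReal.tsum_mul_left]
            simp_rw [Measure.restrict_apply (htm _), inter_comm]
        _ ≤ _ := by
            rw [← measure_iUnion htd htm]
            refine mul_le_mul_right ((measure_mono (subset_univ _)).trans ?_) _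
            rw [Measure.restrict_apply_univ]
            exact measure_mono inter_subset_right
    have hlim : Tendsto (fun δ : ℝ => ENNReal.ofReal (2 ^ (m + 1) * (K + δ) ^ m * δ) *
        volume (Metric.closedBall (0 : V) k)) (𝓝[>] 0) (𝓝 (ENNReal.ofReal
          (2 ^ (m + 1) * (K + 0) ^ m * 0) * volume (Metric.closedBall (0 : V) k))) := by
      refine ENNReal.Tendsto.mul_const ?_
        (Or.inr (isCompact_closedBall _ _).measure_lt_top.ne)
      refine (ENNReal.tendsto_ofReal ?_)
      have : Continuous fun δ : ℝ => 2 ^ (m + 1) * (K + δ) ^ m * δ := by fun_prop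
      exact (this.tendsto 0).mono_left nhdsWithin_le_nhds
    have := ge_of_tendsto hlim (by
      filter_upwards [self_mem_nhdsWithin] with δ (hδ : 0 < δ) using key δ hδ)
    simpa using this
  have hcover : g '' N ⊆ ⋃ k : ℕ, g '' (N ∩ Metric.closedBall 0 k) := by
    rw [← image_iUnion, ← inter_iUnion, Metric.iUnion_closedBall_nat, inter_univ]
  exact measure_mono_null hcover (measure_iUnion_null hbdd)

/-- A set on which `g` is differentiable with injective derivative is covered by countably many
measurable pieces on each of which `g` is close to any of its derivatives. -/
theorem exists_countable_cover_approximates_fderiv {g : V → F} {D : Set V} (hDm : MeasurableSet D)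
    (hD : ∀ a ∈ D, DifferentiableAt ℝ g a) (hinj : ∀ a ∈ D, Function.Injective (fderiv ℝ g a))
    {η : ℝ} (hη : 0 < η) :
    ∃ t : ℕ → Set V, (∀ i, MeasurableSet (t i)) ∧ (∀ i, t i ⊆ D) ∧ D ⊆ ⋃ i, t i ∧
      ∀ i, ∀ a ∈ t i, ∀ b ∈ t i, ∀ c ∈ t i,
        ‖g a - g b - fderiv ℝ g c (a - b)‖ ≤ η * ‖fderiv ℝ g c (a - b)‖ := by
  have hc : ∀ L : V →L[ℝ] F, ∃ c : ℝ, 0 < c ∧ (Function.Injective L → ∀ v, c * ‖v‖ ≤ ‖L v‖) := by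
    intro L
    by_cases hL : Function.Injective L
    · obtain ⟨K, hK, h⟩ := L.injective_iff_antilipschitz.1 hL
      refine ⟨(K : ℝ)⁻¹, by positivity, fun _ v => ?_⟩
      have := h.le_mul_dist v 0
      rw [ContinuousLinearMap.coe_coe, map_zero, dist_zero_right, dist_zero_right] at this
      rwa [inv_mul_le_iff₀ (by exact_mod_cast hK)]
    · exact ⟨1, one_pos, fun h => absurd h hL⟩
  choose c hcpos hcL using hc
  -- The tolerance is a fraction of the lower bound `c L`, which turns an absolute error into one
  -- relative to `‖L v‖`. Grouping points by nearby derivatives, countably many groups sufficing,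
  -- makes the bound hold with the derivative at every point of a piece.
  let ρ : (V →L[ℝ] F) → ℝ := fun L => c L * (η / (4 * (1 + η)))
  have hρ : ∀ L, 0 < ρ L := fun L => mul_pos (hcpos L) (by positivity)
  obtain ⟨S, hSI, hSc, hS⟩ := TopologicalSpace.countable_cover_nhdsWithin
    (s := {L : V →L[ℝ] F | Function.Injective L}) (f := fun L => Metric.ball L (ρ L))
    (fun L _ => mem_nhdsWithin_of_mem_nhds (Metric.ball_mem_nhds L (hρ L)))
  have hex : ∀ L : V →L[ℝ] F, ∃ t : ℕ → Set V, (∀ i, MeasurableSet (t i)) ∧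
      (D ∩ fderiv ℝ g ⁻¹' Metric.ball L (ρ L)) ⊆ ⋃ i, t i ∧
      (∀ i, t i ⊆ D ∩ fderiv ℝ g ⁻¹' Metric.ball L (ρ L)) ∧
      ∀ i, ∃ A, ‖A - L‖ ≤ ρ L ∧ ∀ a ∈ t i, ∀ b ∈ t i, ‖g a - g b - A (a - b)‖ ≤ ρ L * ‖a - b‖ := by
    intro L
    set s := D ∩ fderiv ℝ g ⁻¹' Metric.ball L (ρ L) with hs
    have hsm : MeasurableSet s := hDm.inter (measurable_fderiv ℝ g Metric.isOpen_ball.measurableSet)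
    rcases s.eq_empty_or_nonempty with he | hne
    · refine ⟨fun _ => ∅, fun _ => MeasurableSet.empty, by simp [he], by simp, fun i =>
        ⟨L, by simpa using (hρ L).le, by simp⟩⟩
    obtain ⟨t, A, -, htm, hst, happ, hA⟩ :=
      exists_partition_approximatesLinearOn_of_hasFDerivWithinAt g s (fderiv ℝ g)
        (fun x hx => (hD x hx.1).hasFDerivAt.hasFDerivWithinAt) (fun _ => (ρ L).toNNReal)
        (fun _ => by simpa using hρ L)
    refine ⟨fun i => s ∩ t i, fun i => hsm.inter (htm i), ?_, fun i => inter_subset_left, fun i => ?_⟩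
    · rw [← inter_iUnion]; exact subset_inter Subset.rfl hst
    · obtain ⟨y, hy, hAy⟩ := hA hne i
      refine ⟨A i, ?_, fun a ha b hb => ?_⟩
      · have := hy.2
        rw [mem_preimage, mem_ball_iff_norm, ← hAy] at this
        exact this.le
      · have := happ i a ha b hb
        rwa [Real.coe_toNNReal _ (hρ L).le] at this
  choose t htm hcov htD happ using hex
  rcases S.eq_empty_or_nonempty with he | hne
  · refine ⟨fun _ => ∅, fun _ => MeasurableSet.empty, by simp, fun a ha => ?_, by simp⟩
    have := hS (hinj a ha)
    simp [he] at this
  obtain ⟨e, he⟩ := hSc.exists_eq_range hne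
  refine ⟨fun k => t (e k.unpair.1) k.unpair.2, fun k => htm _ _,
    fun k => (htD _ _).trans inter_subset_left, fun a ha => ?_, fun k a ha b hb x hx => ?_⟩
  · obtain ⟨L, hL, haL⟩ := mem_iUnion₂.1 (hS (hinj a ha))
    rw [he] at hL
    obtain ⟨k, rfl⟩ := hL
    obtain ⟨i, hi⟩ := mem_iUnion.1 (hcov (e k) ⟨ha, haL⟩)
    refine mem_iUnion.2 ⟨Nat.pair k i, ?_⟩
    simpa using hi
  · set L := e k.unpair.1
    have hLinj : Function.Injective L := hSI (by rw [he]; exact mem_range_self _)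
    obtain ⟨A, hAL, hA⟩ := happ L k.unpair.2
    have h1 := hA a ha b hb
    have h2 : ‖fderiv ℝ g x - L‖ ≤ ρ L := by
      have := (htD L _ hx).2
      rw [mem_preimage, mem_ball_iff_norm] at this
      exact this.le
    set v := a - b
    have h3 : ‖(A - L) v‖ ≤ ρ L * ‖v‖ := (A - L).le_of_opNorm_le hAL v
    have h4 : ‖(fderiv ℝ g x - L) v‖ ≤ ρ L * ‖v‖ := (fderiv ℝ g x - L).le_of_opNorm_le h2 v
    have h5 := hcL L hLinj v
    have h6 : ‖L v‖ ≤ ‖fderiv ℝ g x v‖ + ρ L * ‖v‖ := by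
      calc ‖L v‖ = ‖fderiv ℝ g x v - (fderiv ℝ g x - L) v‖ := by simp
        _ ≤ _ := norm_sub_le _ _
        _ ≤ _ := by gcongr
    have h7 : ‖g a - g b - fderiv ℝ g x v‖ ≤ 3 * (ρ L * ‖v‖) := by
      calc ‖g a - g b - fderiv ℝ g x v‖
          = ‖(g a - g b - A v) + (A - L) v - (fderiv ℝ g x - L) v‖ := by
            congr 1; simp only [sub_apply]; abel
        _ ≤ ‖g a - g b - A v‖ + ‖(A - L) v‖ + ‖(fderiv ℝ g x - L) v‖ :=
            (norm_sub_le _ _).trans (add_le_add_left (norm_add_le _ _) _)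
        _ ≤ _ := by linarith
    have h8 : ρ L * (4 * (1 + η)) = c L * η := by
      simp only [ρ]; field_simp
    have h9 : 3 * ρ L + η * ρ L ≤ η * c L := by nlinarith [hρ L, mul_pos hη (hρ L)]
    have h10 := mul_le_mul_of_nonneg_right h9 (norm_nonneg v)
    nlinarith
end Lipschitz

/-! ### Blow-ups of almost linear images. -/

section BlowUp

variable {V F : Type*} [NormedAddCommGroup V] [InnerProductSpace ℝ V] [FiniteDimensional ℝ V]
  [MeasurableSpace V] [BorelSpace V] [NormedAddCommGroup F] [InnerProductSpace ℝ F]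
  [FiniteDimensional ℝ F] [MeasurableSpace F] [BorelSpace F]

theorem restrict_range_eq_map {n : ℕ} (hV : finrank ℝ V = n) (L : V →L[ℝ] F) :
    (μHE[n] : Measure F).restrict (range L) =
      (ENNReal.ofReal (L : V →ₗ[ℝ] F).normDet • (volume : Measure V)).map L := by
  ext B hB
  rw [Measure.map_apply L.continuous.measurable hB, Measure.restrict_apply hB, Measure.smul_apply,
    smul_eq_mul, ← image_preimage_eq_inter_range, ← hV]
  exact LinearMap.euclideanHausdorffMeasure_image_eq_normDet_mul_volume (L : V →ₗ[ℝ] F) _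

/-- `g` and its linear approximation `L` have comparable images. -/
theorem restrict_image_le_map {n : ℕ} (hV : finrank ℝ V = n) {g : V → F} (hg : Continuous g)
    (L : V →L[ℝ] F) {A : Set V} {η : ℝ} (hη : 0 < η)
    (happ : ∀ b ∈ A, ∀ c ∈ A, ‖g b - g c - L (b - c)‖ ≤ η * ‖L (b - c)‖) :
    (μHE[n] : Measure F).restrict (g '' A) ≤ ENNReal.ofReal ((1 + η) ^ n) •
      (ENNReal.ofReal (L : V →ₗ[ℝ] F).normDet • (volume : Measure V).restrict A).map g := by
  refine Measure.le_iff.2 fun B hB => ?_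
  rw [Measure.restrict_apply hB, Measure.smul_apply, Measure.map_apply hg.measurable hB,
    Measure.smul_apply, smul_eq_mul, smul_eq_mul, Measure.restrict_apply (hg.measurable hB),
    ← hV, ← LinearMap.euclideanHausdorffMeasure_image_eq_normDet_mul_volume (L : V →ₗ[ℝ] F),
    inter_comm B, ← image_inter_preimage, inter_comm A]
  refine euclideanHausdorffMeasure_image_le_image (by positivity) fun b hb c hc => ?_
  have h := happ b hb.2 c hc.2
  rw [dist_eq_norm, dist_eq_norm, ContinuousLinearMap.coe_coe, ← map_sub]
  calc ‖g b - g c‖ = ‖(g b - g c - L (b - c)) + L (b - c)‖ := by rw [sub_add_cancel]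
    _ ≤ _ := norm_add_le _ _
    _ ≤ _ := by linarith

theorem map_le_restrict_image {n : ℕ} (hV : finrank ℝ V = n) {g : V → F} (hg : Continuous g)
    (L : V →L[ℝ] F) {A : Set V} {η : ℝ} (hη1 : η < 1)
    (happ : ∀ b ∈ A, ∀ c ∈ A, ‖g b - g c - L (b - c)‖ ≤ η * ‖L (b - c)‖) :
    (ENNReal.ofReal (L : V →ₗ[ℝ] F).normDet • (volume : Measure V).restrict A).map g ≤
      ENNReal.ofReal (((1 - η)⁻¹) ^ n) • (μHE[n] : Measure F).restrict (g '' A) := by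
  refine Measure.le_iff.2 fun B hB => ?_
  rw [Measure.smul_apply, Measure.restrict_apply hB, Measure.map_apply hg.measurable hB,
    Measure.smul_apply, smul_eq_mul, smul_eq_mul, Measure.restrict_apply (hg.measurable hB),
    ← hV, ← LinearMap.euclideanHausdorffMeasure_image_eq_normDet_mul_volume (L : V →ₗ[ℝ] F),
    inter_comm B, ← image_inter_preimage, inter_comm A]
  have h1 : 0 < 1 - η := by linarith
  refine euclideanHausdorffMeasure_image_le_image (by positivity) fun b hb c hc => ?_
  have h := happ b hb.2 c hc.2
  rw [dist_eq_norm, dist_eq_norm, ContinuousLinearMap.coe_coe, ← map_sub,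
    inv_mul_eq_div, le_div_iff₀ h1]
  have : ‖L (b - c)‖ ≤ ‖g b - g c‖ + ‖g b - g c - L (b - c)‖ := by
    calc ‖L (b - c)‖ = ‖(g b - g c) - (g b - g c - L (b - c))‖ := by rw [sub_sub_cancel]
      _ ≤ _ := norm_sub_le _ _
  linarith

set_option maxHeartbeats 1000000 in
/-- Blow-ups of a set which is, up to small measure, the image of a map close to the linear map `L`
converge to the range of `L`. -/
theorem tendsto_blowUp {n : ℕ} (hV : finrank ℝ V = n) {Γ : Set F} (hΓ : MeasurableSet Γ)
    [IsLocallyFiniteMeasure ((μHE[n] : Measure F).restrict Γ)] {g : V → F} (hg : Continuous g)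
    {a : V} {L : V →L[ℝ] F} (hL : Function.Injective L)
    (H : ∀ η > 0, ∃ A : Set V, MeasurableSet A ∧ MeasurableSet (g '' A) ∧ a ∈ A ∧ g '' A ⊆ Γ ∧
      (∀ b ∈ A, ∀ c ∈ A, ‖g b - g c - L (b - c)‖ ≤ η * ‖L (b - c)‖) ∧
      (∀ e > 0, ∀ᶠ s in 𝓝[>] (0 : ℝ),
        volume.real (Metric.closedBall a s \ A) ≤ e * s ^ n) ∧
      (∀ e > 0, ∀ᶠ s in 𝓝[>] (0 : ℝ), ((μHE[n] : Measure F).restrict Γ).real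
        (Metric.closedBall (g a) s \ g '' A) ≤ e * s ^ n))
    {φ : F → ℝ} (hφ : Continuous φ) (hφc : HasCompactSupport φ) (hφ0 : ∀ x, 0 ≤ φ x) :
    Tendsto (fun r : ℝ => (r ^ n)⁻¹ * ∫ y in Γ, φ (r⁻¹ • (y - g a)) ∂μHE[n]) (𝓝[>] 0)
      (𝓝 (∫ y in range L, φ y ∂μHE[n])) := by
  set J := (L : V →ₗ[ℝ] F).normDet with hJ
  have hJ0 : 0 ≤ J := LinearMap.normDet_nonneg _
  obtain ⟨M, hM⟩ := hφc.exists_bound_of_continuous hφ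
  have hM0 : 0 ≤ M := (norm_nonneg _).trans (hM 0)
  have hφM : ∀ x, φ x ≤ M := fun x => (le_abs_self _).trans (hM x)
  obtain ⟨Q, hQ0, hQ⟩ : ∃ Q : ℝ, 0 < Q ∧ ∀ x, Q < ‖x‖ → φ x = 0 := by
    obtain ⟨Q, hQ⟩ := hφc.isCompact.isBounded.subset_closedBall 0
    refine ⟨max Q 1, by positivity, fun x hx => ?_⟩
    by_contra hne
    have := hQ (subset_tsupport φ (Function.mem_support.2 hne))
    rw [mem_closedBall_zero_iff] at this
    exact absurd (this.trans (le_max_left Q 1)) (not_le.2 hx)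
  obtain ⟨c, hc0, hc⟩ : ∃ c : ℝ, 0 < c ∧ ∀ v, c * ‖v‖ ≤ ‖L v‖ := by
    obtain ⟨K, hK, h⟩ := L.injective_iff_antilipschitz.1 hL
    refine ⟨(K : ℝ)⁻¹, by positivity, fun v => ?_⟩
    have := h.le_mul_dist v 0
    rw [ContinuousLinearMap.coe_coe, map_zero, dist_zero_right, dist_zero_right] at this
    rwa [inv_mul_le_iff₀ (by exact_mod_cast hK)]
  set Q' := 2 * Q / c with hQ'
  have hQ'0 : 0 < Q' := by positivity
  set v₁ := (volume : Measure V).real (Metric.closedBall 0 1) with hv₁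
  have hball : ∀ s : ℝ, 0 ≤ s → (volume : Measure V).real (Metric.closedBall a s) = s ^ n * v₁ := by
    intro s hs
    rw [hv₁, Measure.addHaar_real_closedBall' _ _ hs, hV]
  -- the limit as an integral over `V`
  have hI : ∫ y in range L, φ y ∂μHE[n] = J * ∫ u, φ (L u) := by
    rw [restrict_range_eq_map hV, integral_map L.continuous.aemeasurable
      hφ.aestronglyMeasurable, integral_smul_measure, ENNReal.toReal_ofReal hJ0, smul_eq_mul]
  have hscale : ∀ r : ℝ, 0 < r → ∫ b, φ (r⁻¹ • L (b - a)) = r ^ n * ∫ u, φ (L u) := by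
    intro r hr
    have h1 := integral_sub_right_eq_self (μ := (volume : Measure V))
      (fun b => φ (r⁻¹ • L b)) a
    have h2 := Measure.integral_comp_inv_smul_of_nonneg (volume : Measure V)
      (fun u => φ (L u)) hr.le
    simp only [map_smul] at h2
    rw [h1, h2, hV, smul_eq_mul]
  rw [hI, Metric.tendsto_nhds]
  intro E hE
  -- choice of the accuracy
  set B := M + J * Q' ^ n * v₁ * M + J * (Q' ^ n * v₁ + M * Q' ^ n) + M * Q ^ n + 1 with hB
  have hv0 : 0 ≤ v₁ := measureReal_nonneg
  have hB0 : 0 < B := by positivity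
  set e := E / (2 * B) with he
  have he0 : 0 < e := by positivity
  have huc : UniformContinuous φ := hφc.uniformContinuous_of_continuous hφ
  obtain ⟨δ, hδ, hδφ⟩ := Metric.uniformContinuous_iff.1 huc e he0
  obtain ⟨η, hη0, hη1, hη2, hη3, hη4⟩ : ∃ η : ℝ, 0 < η ∧ η < 1 / 2 ∧ (1 + η) ^ n ≤ 1 + e ∧
      1 - e ≤ (1 - η) ^ n ∧ η * (‖L‖ * Q') < δ := by
    have c1 : ∀ᶠ η in 𝓝[>] (0 : ℝ), (1 + η) ^ n < 1 + e := by
      have : Tendsto (fun η : ℝ => (1 + η) ^ n) (𝓝[>] 0) (𝓝 ((1 + 0) ^ n)) :=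
        ((by fun_prop : Continuous fun η : ℝ => (1 + η) ^ n).tendsto 0).mono_left nhdsWithin_le_nhds
      exact this.eventually_lt_const (by simp [he0])
    have c2 : ∀ᶠ η in 𝓝[>] (0 : ℝ), 1 - e < (1 - η) ^ n := by
      have : Tendsto (fun η : ℝ => (1 - η) ^ n) (𝓝[>] 0) (𝓝 ((1 - 0) ^ n)) :=
        ((by fun_prop : Continuous fun η : ℝ => (1 - η) ^ n).tendsto 0).mono_left nhdsWithin_le_nhds
      exact this.eventually_const_lt (by simp [he0])
    have c3 : ∀ᶠ η in 𝓝[>] (0 : ℝ), η * (‖L‖ * Q') < δ := by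
      have : Tendsto (fun η : ℝ => η * (‖L‖ * Q')) (𝓝[>] 0) (𝓝 (0 * (‖L‖ * Q'))) :=
        ((by fun_prop : Continuous fun η : ℝ => η * (‖L‖ * Q')).tendsto 0).mono_left
          nhdsWithin_le_nhds
      exact this.eventually_lt_const (by simpa using hδ)
    have c4 : ∀ᶠ η in 𝓝[>] (0 : ℝ), η < 1 / 2 :=
      eventually_nhdsWithin_of_eventually_nhds (eventually_lt_nhds (by norm_num))
    obtain ⟨η, h1, h2, h3, h4, h5⟩ := (c1.and (c2.and (c3.and (c4.and
      (self_mem_nhdsWithin (s := Ioi (0 : ℝ))))))).exists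
    exact ⟨η, h5, h4, h1.le, h2.le, h3⟩
  obtain ⟨A, hAm, hgAm, haA, hgA, happ, hvol, hmu⟩ := H η hη0
  have hscaleQ : ∀ {q : ℝ}, 0 < q → Tendsto (fun r : ℝ => q * r) (𝓝[>] 0) (𝓝[>] 0) := by
    intro q hq
    refine tendsto_nhdsWithin_of_tendsto_nhds_of_eventually_within _ ?_ ?_
    · have : Tendsto (fun r : ℝ => q * r) (𝓝[>] 0) (𝓝 (q * 0)) :=
        ((by fun_prop : Continuous fun r : ℝ => q * r).tendsto 0).mono_left nhdsWithin_le_nhds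
      simpa using this
    · filter_upwards [self_mem_nhdsWithin] with r (hr : 0 < r) using mul_pos hq hr
  filter_upwards [(hscaleQ hQ'0).eventually (hvol e he0), (hscaleQ hQ0).eventually (hmu e he0),
    self_mem_nhdsWithin] with r hr1 hr2 (hr : 0 < r)
  set ψ : F → ℝ := fun y => φ (r⁻¹ • (y - g a)) with hψ
  have hψc : Continuous ψ := by fun_prop
  have hψ0 : ∀ y, 0 ≤ ψ y := fun y => hφ0 _
  have hψM : ∀ y, ‖ψ y‖ ≤ M := fun y => hM _
  have hψsupp : ∀ y, y ∉ Metric.closedBall (g a) (Q * r) → ψ y = 0 := by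
    intro y hy
    apply hQ
    rw [mem_closedBall_iff_norm, not_le] at hy
    rw [norm_smul, norm_inv, Real.norm_of_nonneg hr.le, inv_mul_eq_div, lt_div_iff₀ hr]
    exact hy
  have hψcs : HasCompactSupport ψ :=
    HasCompactSupport.intro (isCompact_closedBall (g a) (Q * r)) hψsupp
  have hint : IntegrableOn ψ Γ μHE[n] := hψc.integrable_of_hasCompactSupport hψcs
  -- The integral over `Γ` is compared with `X` over `g '' A` by the density of `g '' A`, then `X`
  -- with its pull-back `Z` since `g` almost has the Jacobian of `L`, then `Z` with its
  -- linearization by the uniform continuity of `φ` and the density of `A`.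
  set X := ∫ y in g '' A, ψ y ∂μHE[n] with hX
  have e1 : |∫ y in Γ, ψ y ∂μHE[n] - X| ≤ M * (e * (Q * r) ^ n) := by
    have hsplit : ∫ y in Γ, ψ y ∂μHE[n] - X = ∫ y in Γ \ g '' A, ψ y ∂μHE[n] := by
      rw [setIntegral_sdiff hgAm hint hgA]
    have hsub : ∫ y in Γ \ g '' A, ψ y ∂μHE[n] =
        ∫ y in (Metric.closedBall (g a) (Q * r) \ g '' A) ∩ Γ, ψ y ∂μHE[n] := by
      have : (Metric.closedBall (g a) (Q * r) \ g '' A) ∩ Γ ⊆ Γ \ g '' A := fun y hy =>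
        ⟨hy.2, hy.1.2⟩
      refine setIntegral_eq_of_subset_of_forall_sdiff_eq_zero (hΓ.diff hgAm) this fun y hy => ?_
      apply hψsupp
      intro hyb
      exact hy.2 ⟨⟨hyb, hy.1.2⟩, hy.1.1⟩
    rw [hsplit, hsub, ← Real.norm_eq_abs]
    have hm : MeasurableSet (Metric.closedBall (g a) (Q * r) \ g '' A) :=
      Metric.isClosed_closedBall.measurableSet.diff hgAm
    rw [measureReal_restrict_apply hm] at hr2
    have hfin : μHE[n] ((Metric.closedBall (g a) (Q * r) \ g '' A) ∩ Γ) < ⊤ := by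
      rw [← Measure.restrict_apply hm]
      exact (measure_mono sdiff_subset).trans_lt (isCompact_closedBall (g a) (Q * r)).measure_lt_top
    refine (norm_setIntegral_le_of_norm_le_const hfin (fun y _ => hψM y)).trans ?_
    gcongr
  set Z := J * ∫ b in A, ψ (g b) with hZ
  set ν := (ENNReal.ofReal J • (volume : Measure V).restrict A).map g with hν
  have hZν : Z = ∫ y, ψ y ∂ν := by
    rw [hν, integral_map hg.aemeasurable hψc.aestronglyMeasurable, integral_smul_measure,
      ENNReal.toReal_ofReal hJ0, smul_eq_mul]
  have hintX : IntegrableOn ψ (g '' A) μHE[n] := hint.mono_set hgA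
  have hνle := map_le_restrict_image hV hg L (by linarith : η < 1) happ
  have hleν := restrict_image_le_map hV hg L hη0 happ
  have hintν : Integrable ψ ν :=
    (hintX.smul_measure (c := ENNReal.ofReal (((1 - η)⁻¹) ^ n)) ENNReal.ofReal_ne_top).mono_measure
      hνle
  have hη5 : 0 < 1 - η := by linarith
  have hZX : (1 - η) ^ n * Z ≤ X := by
    have := integral_mono_measure hνle (ae_of_all _ hψ0)
      (hintX.smul_measure (c := ENNReal.ofReal (((1 - η)⁻¹) ^ n)) ENNReal.ofReal_ne_top)
    rw [integral_smul_measure, ENNReal.toReal_ofReal (by positivity), smul_eq_mul, ← hZν,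
      inv_pow, inv_mul_eq_div, le_div_iff₀ (by positivity), mul_comm] at this
    exact this
  have hXZ : X ≤ (1 + η) ^ n * Z := by
    have := integral_mono_measure hleν (ae_of_all _ hψ0)
      (hintν.smul_measure (c := ENNReal.ofReal ((1 + η) ^ n)) ENNReal.ofReal_ne_top)
    rwa [integral_smul_measure, ENNReal.toReal_ofReal (by positivity), smul_eq_mul, ← hZν] at this
  have hfarA : ∀ b ∈ A, b ∉ Metric.closedBall a (Q' * r) → ψ (g b) = 0 := by
    intro b hb hbn
    apply hψsupp
    intro hmem
    apply hbn
    rw [mem_closedBall_iff_norm] at hmem ⊢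
    have h1 := happ b hb a haA
    have h2 : ‖L (b - a)‖ ≤ ‖g b - g a‖ + ‖g b - g a - L (b - a)‖ := by
      calc ‖L (b - a)‖ = ‖(g b - g a) - (g b - g a - L (b - a))‖ := by rw [sub_sub_cancel]
        _ ≤ _ := norm_sub_le _ _
    have h3 := hc (b - a)
    rw [hQ', div_mul_eq_mul_div, le_div_iff₀ hc0]
    nlinarith [norm_nonneg (L (b - a))]
  have hfarL : ∀ b, b ∉ Metric.closedBall a (Q' * r) → φ (r⁻¹ • L (b - a)) = 0 := by
    intro b hbn
    apply hQ
    rw [mem_closedBall_iff_norm, not_le, hQ', div_mul_eq_mul_div, div_lt_iff₀ hc0] at hbn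
    have h3 := hc (b - a)
    rw [norm_smul, norm_inv, Real.norm_of_nonneg hr.le, inv_mul_eq_div, lt_div_iff₀ hr]
    nlinarith [mul_pos hQ0 hr]
  set K := Metric.closedBall a (Q' * r) with hK
  have hKvol : volume.real K = (Q' * r) ^ n * v₁ := hball _ (by positivity)
  have hKfin : volume K < ⊤ := (isCompact_closedBall _ _).measure_lt_top
  have hKm : MeasurableSet K := Metric.isClosed_closedBall.measurableSet
  have hsetA : ∫ b in A, ψ (g b) = ∫ b in K ∩ A, ψ (g b) := by
    exact setIntegral_eq_of_subset_of_forall_sdiff_eq_zero hAm inter_subset_right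
      fun b hb => hfarA b hb.1 fun h => hb.2 ⟨h, hb.1⟩
  have hKA : volume.real (K ∩ A) ≤ (Q' * r) ^ n * v₁ := by
    rw [← hKvol]; exact measureReal_mono inter_subset_left hKfin.ne
  have hKAfin : volume (K ∩ A) < ⊤ := (measure_mono inter_subset_left).trans_lt hKfin
  have hZle : |Z| ≤ J * (M * ((Q' * r) ^ n * v₁)) := by
    rw [hZ, abs_mul, abs_of_nonneg hJ0, hsetA, ← Real.norm_eq_abs]
    gcongr
    refine (norm_setIntegral_le_of_norm_le_const hKAfin (fun y _ => hψM _)).trans ?_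
    gcongr
  have hZ0 : 0 ≤ Z := mul_nonneg hJ0 (integral_nonneg fun b => hψ0 _)
  have e2 : |X - Z| ≤ e * (J * (M * ((Q' * r) ^ n * v₁))) := by
    have hZ' := (le_abs_self Z).trans hZle
    have : |X - Z| ≤ e * Z := by
      have q1 := mul_le_mul_of_nonneg_right hη2 hZ0
      have q2 := mul_le_mul_of_nonneg_right hη3 hZ0
      rw [abs_le]; constructor <;> linarith
    exact this.trans (by gcongr)
  have hLc : Continuous fun b => φ (r⁻¹ • L (b - a)) := by fun_prop
  have hLint : IntegrableOn (fun b => φ (r⁻¹ • L (b - a))) K :=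
    hLc.continuousOn.integrableOn_compact (isCompact_closedBall _ _)
  have hgint : IntegrableOn (fun b => ψ (g b)) K :=
    (hψc.comp hg).continuousOn.integrableOn_compact (isCompact_closedBall _ _)
  have hZ' : r ^ n * ∫ u, φ (L u) = ∫ b in K, φ (r⁻¹ • L (b - a)) := by
    rw [← hscale r hr]
    symm
    exact setIntegral_eq_integral_of_forall_compl_eq_zero fun b hb => hfarL b hb
  have e3 : |(∫ b in A, ψ (g b)) - r ^ n * ∫ u, φ (L u)| ≤
      e * ((Q' * r) ^ n * v₁) + M * (e * (Q' * r) ^ n) := by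
    have hsplit : ∫ b in K, φ (r⁻¹ • L (b - a)) =
        (∫ b in K ∩ A, φ (r⁻¹ • L (b - a))) + ∫ b in K \ A, φ (r⁻¹ • L (b - a)) :=
      (integral_inter_add_sdiff hAm hLint).symm
    rw [hsetA, hZ', hsplit, ← sub_sub, ← integral_sub (hgint.mono_set inter_subset_left)
      (hLint.mono_set inter_subset_left)]
    have t1 : ‖∫ b in K ∩ A, (ψ (g b) - φ (r⁻¹ • L (b - a)))‖ ≤ e * ((Q' * r) ^ n * v₁) := by
      refine (norm_setIntegral_le_of_norm_le_const hKAfin (C := e) fun b hb => ?_).trans (by gcongr)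
      refine (dist_eq_norm (ψ (g b)) _ ▸ (hδφ ?_).le)
      rw [dist_eq_norm, ← smul_sub, norm_smul, norm_inv, Real.norm_of_nonneg hr.le, inv_mul_eq_div,
        div_lt_iff₀ hr]
      have h1 := happ b hb.2 a haA
      have h2 : ‖L (b - a)‖ ≤ ‖L‖ * (Q' * r) :=
        (L.le_opNorm _).trans (by gcongr; exact mem_closedBall_iff_norm.1 hb.1)
      calc _ ≤ _ := h1
        _ ≤ η * (‖L‖ * (Q' * r)) := by gcongr
        _ = η * (‖L‖ * Q') * r := by ring
        _ < δ * r := by gcongr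
    have t2 : ‖∫ b in K \ A, φ (r⁻¹ • L (b - a))‖ ≤ M * (e * (Q' * r) ^ n) := by
      refine (norm_setIntegral_le_of_norm_le_const
        ((measure_mono sdiff_subset).trans_lt hKfin) (fun b _ => hM _)).trans ?_
      gcongr
    rw [← Real.norm_eq_abs]
    exact (norm_sub_le _ _).trans (add_le_add t1 t2)
  have hrn : 0 < r ^ n := by positivity
  rw [Real.dist_eq]
  have hfin : |∫ y in Γ, ψ y ∂μHE[n] - J * (r ^ n * ∫ u, φ (L u))| ≤ e * B * r ^ n := by
    have hZd : |Z - J * (r ^ n * ∫ u, φ (L u))| ≤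
        J * (e * ((Q' * r) ^ n * v₁) + M * (e * (Q' * r) ^ n)) := by
      rw [hZ, ← mul_sub, abs_mul, abs_of_nonneg hJ0]
      gcongr
    have htri : |∫ y in Γ, ψ y ∂μHE[n] - J * (r ^ n * ∫ u, φ (L u))| ≤
        |∫ y in Γ, ψ y ∂μHE[n] - X| + |X - Z| + |Z - J * (r ^ n * ∫ u, φ (L u))| := by
      have := abs_add_three (∫ y in Γ, ψ y ∂μHE[n] - X) (X - Z) (Z - J * (r ^ n * ∫ u, φ (L u)))
      simpa using this
    refine htri.trans ((add_le_add_three e1 e2 hZd).trans ?_)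
    have : e * B * r ^ n = M * (e * (Q * r) ^ n) + e * (J * (M * ((Q' * r) ^ n * v₁))) +
        J * (e * ((Q' * r) ^ n * v₁) + M * (e * (Q' * r) ^ n)) + e * (M + 1) * r ^ n := by
      rw [hB, mul_pow, mul_pow]; ring
    rw [this]
    have : 0 ≤ e * (M + 1) * r ^ n := by positivity
    linarith
  have heq : (r ^ n)⁻¹ * ∫ y in Γ, φ (r⁻¹ • (y - g a)) ∂μHE[n] - J * ∫ u, φ (L u) =
      (r ^ n)⁻¹ * (∫ y in Γ, ψ y ∂μHE[n] - J * (r ^ n * ∫ u, φ (L u))) := by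
    rw [mul_sub, ← mul_assoc, ← mul_assoc, mul_comm _ J, mul_assoc J, inv_mul_cancel₀ hrn.ne',
      mul_one]
  rw [heq, abs_mul, abs_of_pos (by positivity), inv_mul_eq_div, div_lt_iff₀ hrn]
  refine hfin.trans_lt ?_
  gcongr
  rw [he, div_mul_eq_mul_div, div_lt_iff₀ (by positivity)]
  nlinarith [mul_pos hE hB0]

end BlowUp

/-! ### Approximate tangent spaces and almost flat pieces of rectifiable sets. -/

section Tangent

/-- Distinct planes have equal dimension, so `P` contains a vector outside the closed set `Q`; a
bump there has a positive integral over `P` and a vanishing one over `Q`. -/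
theorem IsApproxTangent.unique {n : ℕ} {Γ : Set (Euc n)} {x : Euc n} {P Q : Grass n}
    (hP : IsApproxTangent Γ x P) (hQ : IsApproxTangent Γ x Q) : P = Q := by
  by_contra hne
  have hsub : ¬ P.1 ≤ Q.1 := fun hle =>
    hne (Subtype.ext (Submodule.eq_of_le_of_finrank_eq hle (P.2.trans Q.2.symm)))
  obtain ⟨v, hvP, hvQ⟩ := SetLike.not_le_iff_exists.1 hsub
  have hQc : IsClosed (Q.1 : Set (Euc n)) := Q.1.closed_of_finiteDimensional
  obtain ⟨ε, hε, hεQ⟩ := Metric.isOpen_iff.1 hQc.isOpen_compl v hvQ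
  let φ : Euc n → ℝ := fun y => max 0 (ε / 2 - dist y v)
  have hφ : Continuous φ := by fun_prop
  have hφc : HasCompactSupport φ := by
    refine HasCompactSupport.intro (isCompact_closedBall v (ε / 2)) fun y hy => ?_
    rw [Metric.mem_closedBall, not_le] at hy
    exact max_eq_left (by linarith)
  have heq := tendsto_nhds_unique (hP φ hφ hφc) (hQ φ hφ hφc)
  have h0 : ∫ y in (Q.1 : Set (Euc n)), φ y ∂μHE[n] = 0 := by
    refine setIntegral_eq_zero_of_forall_eq_zero fun y hy => max_eq_left ?_
    by_contra hlt
    exact hεQ (Metric.mem_ball.2 (by linarith : dist y v < ε)) hy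
  have hpos : 0 < ∫ y in (P.1 : Set (Euc n)), φ y ∂μHE[n] := by
    have hr : (P.1 : Set (Euc n)) = range P.1.subtypeL := by simp
    have hnd : ((P.1.subtypeL : P.1 →L[ℝ] Euc n) : P.1 →ₗ[ℝ] Euc n).normDet = 1 :=
      P.1.subtypeₗᵢ.normDet_eq_one
    rw [hr, restrict_range_eq_map P.2, hnd, integral_map (by fun_prop) hφ.aestronglyMeasurable,
      ENNReal.ofReal_one, one_smul]
    refine Continuous.integral_pos_of_hasCompactSupport_nonneg_nonzero (x := ⟨v, hvP⟩)
      (by fun_prop) ?_ (fun y => le_max_left _ _) ?_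
    · exact hφc.comp_isClosedEmbedding (P.1.closed_of_finiteDimensional.isClosedEmbedding_subtypeVal)
    · simp only [φ, Submodule.subtypeL_apply, dist_self]
      exact (lt_max_of_lt_right (by linarith)).ne'
  rw [heq, h0] at hpos
  exact lt_irrefl _ hpos

theorem IsApproxTangent.approxTangent_eq {n : ℕ} {Γ : Set (Euc n)} {x : Euc n} {P : Grass n}
    (hP : IsApproxTangent Γ x P) : approxTangent Γ x = P := by
  have h : ∃ P : Grass n, IsApproxTangent Γ x P := ⟨P, hP⟩
  rw [approxTangent, dif_pos h]
  exact h.choose_spec.unique hP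

/-- Blow-ups are controlled through inequalities between measures, which can be tested only against
nonnegative functions. Positive and negative parts give the general case. -/
theorem isApproxTangent_of_nonneg {n : ℕ} {Γ : Set (Euc n)} {x : Euc n} {P : Grass n}
    [IsLocallyFiniteMeasure ((μHE[n] : Measure (Euc n)).restrict Γ)]
    (hP : ∀ φ : Euc n → ℝ, Continuous φ → HasCompactSupport φ → (∀ y, 0 ≤ φ y) →
      Tendsto (fun r : ℝ => (r ^ n)⁻¹ * ∫ y in Γ, φ (r⁻¹ • (y - x)) ∂μHE[n]) (𝓝[>] 0)
        (𝓝 (∫ y in (P.1 : Set (Euc n)), φ y ∂μHE[n]))) : IsApproxTangent Γ x P := by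
  intro φ hφ hφc
  have hr : (P.1 : Set (Euc n)) = range P.1.subtypeL := by simp
  have hloc : IsLocallyFiniteMeasure ((μHE[n] : Measure (Euc n)).restrict (P.1 : Set (Euc n))) := by
    have hnd : ((P.1.subtypeL : P.1 →L[ℝ] Euc n) : P.1 →ₗ[ℝ] Euc n).normDet = 1 :=
      P.1.subtypeₗᵢ.normDet_eq_one
    rw [hr, restrict_range_eq_map P.2, hnd, ENNReal.ofReal_one, one_smul]
    refine ⟨fun y => ⟨Metric.ball y 1, Metric.ball_mem_nhds y one_pos, ?_⟩⟩
    rw [Measure.map_apply (by fun_prop) Metric.isOpen_ball.measurableSet]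
    refine (measure_mono ?_).trans_lt
      (Metric.isBounded_closedBall (x := (0 : P.1)) (r := ‖y‖ + 1)).measure_lt_top
    intro p hp
    rw [mem_preimage, mem_ball_iff_norm] at hp
    rw [mem_closedBall_zero_iff]
    have : ‖(p : Euc n)‖ ≤ ‖(p : Euc n) - y‖ + ‖y‖ := by
      simpa using norm_add_le ((p : Euc n) - y) y
    change ‖(p : Euc n) - y‖ < 1 at hp
    change ‖(p : Euc n)‖ ≤ _
    linarith
  let φp : Euc n → ℝ := fun y => max (φ y) 0
  let φm : Euc n → ℝ := fun y => max (-φ y) 0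
  have hsplit : ∀ y, φ y = φp y - φm y := fun y => by
    simp only [φp, φm]
    rcases le_total 0 (φ y) with h | h
    · rw [max_eq_left h, max_eq_right (by linarith)]; ring
    · rw [max_eq_right h, max_eq_left (by linarith)]; ring
  have hpc : Continuous φp := by fun_prop
  have hmc : Continuous φm := by fun_prop
  have hps : HasCompactSupport φp := hφc.comp_left (g := fun t : ℝ => max t 0) (by simp)
  have hms : HasCompactSupport φm := hφc.comp_left (g := fun t : ℝ => max (-t) 0) (by simp)
  have h1 := (hP φp hpc hps fun y => le_max_right _ _).sub (hP φm hmc hms fun y => le_max_right _ _)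
  have hlim : ∫ y in (P.1 : Set (Euc n)), φ y ∂μHE[n] =
      ∫ y in (P.1 : Set (Euc n)), φp y ∂μHE[n] - ∫ y in (P.1 : Set (Euc n)), φm y ∂μHE[n] := by
    rw [← integral_sub (hpc.integrable_of_hasCompactSupport hps)
      (hmc.integrable_of_hasCompactSupport hms)]
    exact integral_congr_ae (ae_of_all _ hsplit)
  rw [hlim]
  refine h1.congr' ?_
  filter_upwards [self_mem_nhdsWithin] with r (hr : 0 < r)
  have hcomp : ∀ ψ : Euc n → ℝ, Continuous ψ → HasCompactSupport ψ →
      IntegrableOn (fun y => ψ (r⁻¹ • (y - x))) Γ μHE[n] := by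
    intro ψ hψ hψc
    refine Continuous.integrable_of_hasCompactSupport (by fun_prop) ?_
    exact hψc.comp_homeomorph
      ((Homeomorph.subRight x).trans (Homeomorph.smulOfNeZero r⁻¹ (inv_ne_zero hr.ne')))
  rw [← mul_sub, ← integral_sub (hcomp _ hpc hps) (hcomp _ hmc hms)]
  congr 1
  exact integral_congr_ae (ae_of_all _ fun y => (hsplit _).symm)

/-- If `A` has density one at `x` and the balls have at most Euclidean volume growth along `A`, then
the complement of `A` is negligible at `x`. -/
theorem eventually_measureReal_diff_le {F : Type*} [NormedAddCommGroup F] [NormedSpace ℝ F]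
    [FiniteDimensional ℝ F] [MeasurableSpace F] [BorelSpace F] {μ : Measure F}
    [IsLocallyFiniteMeasure μ] {A : Set F} (hA : MeasurableSet A) {x : F} {n : ℕ} {C : ℝ}
    (hC : ∀ᶠ s in 𝓝[>] (0 : ℝ), μ.real (A ∩ Metric.closedBall x s) ≤ C * s ^ n)
    (hd : Tendsto (fun s => μ (A ∩ Metric.closedBall x s) / μ (Metric.closedBall x s))
      (𝓝[>] 0) (𝓝 1)) {e : ℝ} (he : 0 < e) :
    ∀ᶠ s in 𝓝[>] (0 : ℝ), μ.real (Metric.closedBall x s \ A) ≤ e * s ^ n := by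
  -- The bound `1 / 2` turns the growth bound along `A` into one, twice as large, for the whole
  -- ball; the other term then makes the complement small.
  set e' := min (1 / 2) (e / (2 * (|C| + 1))) with he'
  have he'0 : 0 < e' := by positivity
  have hlt : ENNReal.ofReal (1 - e') < 1 := by
    rw [ENNReal.ofReal_lt_one]; linarith
  filter_upwards [hC, hd.eventually_const_lt hlt, self_mem_nhdsWithin] with s hs1 hs2 (hs : 0 < s)
  have hfin : μ (Metric.closedBall x s) ≠ ⊤ := (isCompact_closedBall x s).measure_lt_top.ne
  have h1 : (1 - e') * μ.real (Metric.closedBall x s) ≤ μ.real (A ∩ Metric.closedBall x s) := by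
    have := ENNReal.mul_le_of_le_div hs2.le
    have := ENNReal.toReal_mono
      ((measure_mono inter_subset_right).trans_lt (lt_top_iff_ne_top.2 hfin)).ne this
    rwa [ENNReal.toReal_mul, ENNReal.toReal_ofReal] at this
    have := min_le_left (1 / 2) (e / (2 * (|C| + 1)))
    linarith
  have h2 : μ.real (Metric.closedBall x s \ A) =
      μ.real (Metric.closedBall x s) - μ.real (A ∩ Metric.closedBall x s) := by
    rw [inter_comm, ← measureReal_inter_add_sdiff hA hfin]; ring
  have h3 : e' ≤ 1 / 2 := min_le_left _ _
  have h4 : e' * (2 * (|C| + 1)) ≤ e := by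
    have := min_le_right (1 / 2) (e / (2 * (|C| + 1)))
    rwa [← he', le_div_iff₀ (by positivity)] at this
  have h5 : C * s ^ n ≤ (|C| + 1) * s ^ n := by
    gcongr; linarith [le_abs_self C]
  have h6 : 0 ≤ μ.real (Metric.closedBall x s) := measureReal_nonneg
  have h7 : 0 ≤ (|C| + 1) * s ^ n := by positivity
  set m := μ.real (Metric.closedBall x s)
  have h8 : m ≤ 2 * ((|C| + 1) * s ^ n) := by nlinarith
  calc _ = _ := h2
    _ ≤ e' * m := by linarith
    _ ≤ e' * (2 * ((|C| + 1) * s ^ n)) := by gcongr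
    _ = (e' * (2 * (|C| + 1))) * s ^ n := by ring
    _ ≤ e * s ^ n := by gcongr

theorem finrank_range_of_injective {n : ℕ} {L : EuclideanSpace ℝ (Fin n) →L[ℝ] Euc n}
    (hL : Function.Injective L) : finrank ℝ (LinearMap.range L.toLinearMap) = n := by
  rw [LinearMap.finrank_range_of_inj hL, finrank_euclideanSpace, Fintype.card_fin]

/-- Outside of a null set, the range of the derivative of a Lipschitz parametrization is the
approximate tangent space. -/
theorem exists_null_isApproxTangent {n : ℕ} {Γ : Set (Euc n)} (hΓ : MeasurableSet Γ)
    [IsLocallyFiniteMeasure ((μHE[n] : Measure (Euc n)).restrict Γ)]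
    {g : EuclideanSpace ℝ (Fin n) → Euc n} {K : ℝ≥0} (hg : LipschitzWith K g)
    {D : Set (EuclideanSpace ℝ (Fin n))} (hDm : MeasurableSet D)
    (hD : ∀ a ∈ D, DifferentiableAt ℝ g a) (hinj : ∀ a ∈ D, Function.Injective (fderiv ℝ g a))
    (hDΓ : g '' D ⊆ Γ) :
    ∃ Z : Set (Euc n), μHE[n] Z = 0 ∧ ∀ a (ha : a ∈ D), g a ∉ Z →
      IsApproxTangent Γ (g a)
        ⟨LinearMap.range (fderiv ℝ g a).toLinearMap, finrank_range_of_injective (hinj a ha)⟩ := by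
  have hV : finrank ℝ (EuclideanSpace ℝ (Fin n)) = n := by simp
  set μ := (μHE[n] : Measure (Euc n)).restrict Γ with hμ
  have hη : ∀ k : ℕ, (0 : ℝ) < 1 / (k + 2) := fun k => by positivity
  have hη1 : ∀ k : ℕ, (1 : ℝ) / (k + 2) < 1 := fun k => by
    rw [div_lt_one (by positivity)]; linarith [(Nat.cast_nonneg k : (0 : ℝ) ≤ k)]
  choose t htm htD hcov happ using fun k : ℕ =>
    exists_countable_cover_approximates_fderiv hDm hD hinj (hη k)
  have hinjOn : ∀ k i, InjOn g (t k i) := by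
    intro k i b hb c hc hbc
    have h := happ k i b hb c hc b hb
    rw [hbc, sub_self, zero_sub, norm_neg] at h
    have h0 : ‖fderiv ℝ g b (b - c)‖ = 0 := by
      nlinarith [hη1 k, norm_nonneg (fderiv ℝ g b (b - c))]
    have := hinj b (htD k i hb) ((norm_eq_zero.1 h0).trans (map_zero (fderiv ℝ g b)).symm)
    exact sub_eq_zero.1 this
  have himgm : ∀ k i, MeasurableSet (g '' t k i) := fun k i =>
    (htm k i).image_of_continuousOn_injOn hg.continuous.continuousOn (hinjOn k i)
  -- Outside these sets `a` is a density point of its piece and `g a` one of the image within `Γ`,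
  -- as `tendsto_blowUp` requires. The accuracies `1 / (k + 2)` are countably many, so one null set
  -- serves every `η`.
  let Z₁ : ℕ → ℕ → Set (EuclideanSpace ℝ (Fin n)) := fun k i => {a | ¬ (a ∈ t k i →
    Tendsto (fun s => volume (t k i ∩ Metric.closedBall a s) / volume (Metric.closedBall a s))
      (𝓝[>] 0) (𝓝 1))}
  let Z₂ : ℕ → ℕ → Set (Euc n) := fun k i => {x | ¬ (x ∈ g '' t k i →
    Tendsto (fun s => μ (g '' t k i ∩ Metric.closedBall x s) / μ (Metric.closedBall x s))
      (𝓝[>] 0) (𝓝 1))}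
  have hZ₁ : ∀ k i, volume (Z₁ k i) = 0 := fun k i =>
    (ae_restrict_iff' (htm k i)).1 (Besicovitch.ae_tendsto_measure_inter_div volume (t k i))
  have hZ₂ : ∀ k i, μHE[n] (Z₂ k i) = 0 := by
    intro k i
    have h1 := Besicovitch.ae_tendsto_measure_inter_div μ (g '' t k i)
    rw [hμ, Measure.restrict_restrict (himgm k i),
      inter_eq_left.2 ((image_mono (htD k i)).trans hDΓ), ae_restrict_iff' (himgm k i)] at h1
    exact h1
  refine ⟨⋃ k, ⋃ i, (g '' Z₁ k i ∪ Z₂ k i), ?_, ?_⟩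
  · refine measure_iUnion_null fun k => measure_iUnion_null fun i => measure_union_null ?_ (hZ₂ k i)
    exact euclideanHausdorffMeasure_image_null hV hg (hZ₁ k i)
  intro a ha haZ
  simp only [mem_iUnion, mem_union, not_exists, not_or] at haZ
  refine isApproxTangent_of_nonneg fun φ hφ hφc hφ0 => ?_
  have hrange : ((LinearMap.range (fderiv ℝ g a).toLinearMap : Submodule ℝ (Euc n)) :
      Set (Euc n)) = range (fderiv ℝ g a) := LinearMap.coe_range _
  change Tendsto _ _ (𝓝 (∫ y in ((LinearMap.range (fderiv ℝ g a).toLinearMap :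
    Submodule ℝ (Euc n)) : Set (Euc n)), φ y ∂μHE[n]))
  rw [hrange]
  refine tendsto_blowUp hV hΓ hg.continuous (hinj a ha) (fun η hη0 => ?_) hφ hφc hφ0
  obtain ⟨k, hk⟩ := exists_nat_one_div_lt hη0
  obtain ⟨i, hi⟩ := mem_iUnion.1 (hcov k ha)
  have hkη : (1 : ℝ) / (k + 2) ≤ η :=
    (one_div_le_one_div_of_le (by positivity) (by linarith)).trans hk.le
  have happ' : ∀ b ∈ t k i, ∀ c ∈ t k i, ‖g b - g c - fderiv ℝ g a (b - c)‖ ≤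
      1 / (k + 2) * ‖fderiv ℝ g a (b - c)‖ := fun b hb c hc => happ k i b hb c hc a hi
  obtain ⟨hz1, hz2⟩ := haZ k i
  have hd1 : Tendsto (fun s => volume (t k i ∩ Metric.closedBall a s) /
      volume (Metric.closedBall a s)) (𝓝[>] 0) (𝓝 1) := by
    by_contra hcon
    exact hz1 ⟨a, fun h => hcon (h hi), rfl⟩
  have hd2 : Tendsto (fun s => μ (g '' t k i ∩ Metric.closedBall (g a) s) /
      μ (Metric.closedBall (g a) s)) (𝓝[>] 0) (𝓝 1) := by
    by_contra hcon
    exact hz2 fun h => hcon (h ⟨a, hi, rfl⟩)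
  set v₁ := (volume : Measure (EuclideanSpace ℝ (Fin n))).real (Metric.closedBall 0 1) with hv₁
  have hball : ∀ s : ℝ, 0 ≤ s →
      (volume : Measure (EuclideanSpace ℝ (Fin n))).real (Metric.closedBall a s) = s ^ n * v₁ := by
    intro s hs
    rw [hv₁, Measure.addHaar_real_closedBall' _ _ hs, hV]
  obtain ⟨c, hc0, hc⟩ : ∃ c : ℝ, 0 < c ∧ ∀ v, c * ‖v‖ ≤ ‖fderiv ℝ g a v‖ := by
    obtain ⟨K, hK, h⟩ := (fderiv ℝ g a).injective_iff_antilipschitz.1 (hinj a ha)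
    refine ⟨(K : ℝ)⁻¹, by positivity, fun v => ?_⟩
    have := h.le_mul_dist v 0
    rw [ContinuousLinearMap.coe_coe, map_zero, dist_zero_right, dist_zero_right] at this
    rwa [inv_mul_le_iff₀ (by exact_mod_cast hK)]
  refine ⟨t k i, htm k i, himgm k i, hi, (image_mono (htD k i)).trans hDΓ,
    fun b hb c hc => (happ' b hb c hc).trans (by gcongr), fun e he => ?_, fun e he => ?_⟩
  · refine eventually_measureReal_diff_le (C := v₁) (htm k i) ?_ hd1 he
    filter_upwards [self_mem_nhdsWithin] with s (hs : 0 < s)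
    rw [mul_comm, ← hball s hs.le]
    exact measureReal_mono inter_subset_right (isCompact_closedBall _ _).measure_lt_top.ne
  · refine eventually_measureReal_diff_le (C := K ^ n * ((2 / c) ^ n * v₁)) (himgm k i) ?_ hd2 he
    filter_upwards [self_mem_nhdsWithin] with s (hs : 0 < s)
    have hsub : g '' t k i ∩ Metric.closedBall (g a) s ⊆
        g '' (Metric.closedBall a (2 / c * s)) := by
      rintro _ ⟨⟨b, hb, rfl⟩, hbs⟩
      refine ⟨b, ?_, rfl⟩
      rw [mem_closedBall_iff_norm] at hbs ⊢
      have h1 := happ' b hb a hi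
      have h2 : ‖fderiv ℝ g a (b - a)‖ ≤ ‖g b - g a‖ + ‖g b - g a - fderiv ℝ g a (b - a)‖ := by
        calc _ = ‖(g b - g a) - (g b - g a - fderiv ℝ g a (b - a))‖ := by rw [sub_sub_cancel]
          _ ≤ _ := norm_sub_le _ _
      have h3 := hc (b - a)
      have h4 : (1 : ℝ) / (k + 2) ≤ 1 / 2 :=
        one_div_le_one_div_of_le (by norm_num) (by linarith [(Nat.cast_nonneg k : (0 : ℝ) ≤ k)])
      have h5 := mul_le_mul_of_nonneg_right h4 (norm_nonneg (fderiv ℝ g a (b - a)))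
      rw [div_mul_eq_mul_div, le_div_iff₀ hc0]
      linarith
    have hle : μ (g '' t k i ∩ Metric.closedBall (g a) s) ≤
        (K : ℝ≥0∞) ^ n * volume (Metric.closedBall a (2 / c * s)) := by
      refine (measure_mono hsub).trans ((Measure.restrict_apply_le _ _).trans ?_)
      rw [← euclideanHausdorffMeasure_eq_volume_of_finrank hV]
      exact euclideanHausdorffMeasure_image_le hg.lipschitzOnWith
    have hfin : (K : ℝ≥0∞) ^ n * volume (Metric.closedBall a (2 / c * s)) ≠ ⊤ :=
      ENNReal.mul_ne_top (by finiteness) (isCompact_closedBall _ _).measure_lt_top.ne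
    have := ENNReal.toReal_mono hfin hle
    rw [ENNReal.toReal_mul] at this
    refine this.trans (le_of_eq ?_)
    change _ * (volume : Measure (EuclideanSpace ℝ (Fin n))).real _ = _
    rw [hball _ (by positivity)]
    simp only [ENNReal.toReal_pow, ENNReal.coe_toReal]
    ring

/-- A rectifiable set splits, up to a null set, into countably many small pieces whose secants are
almost parallel to all the approximate tangent spaces at points of the piece. -/
theorem exists_partition_almost_flat {m : ℕ} {Γ : Set (Euc (m + 1))} (hΓ : MeasurableSet Γ)
    [IsLocallyFiniteMeasure ((μHE[m + 1] : Measure (Euc (m + 1))).restrict Γ)]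
    (hrect : IsCountablyRectifiable Γ) {ε d : ℝ} (hε : 0 < ε) (hd : 0 < d) :
    ∃ B : ℕ → Set (Euc (m + 1)), (∀ i, MeasurableSet (B i)) ∧ Pairwise (Function.onFun Disjoint B) ∧
      (∀ i, B i ⊆ Γ) ∧ μHE[m + 1] (Γ \ ⋃ i, B i) = 0 ∧
      (∀ i, ∀ x ∈ B i, ∀ y ∈ B i, ‖x - y‖ ≤ d) ∧
      ∀ i, ∀ x ∈ B i, ∀ y ∈ B i, ∀ w ∈ B i,
        ‖(x - y) - (approxTangent Γ w).proj (x - y)‖ ≤ ε * ‖x - y‖ := by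
  have hV : finrank ℝ (EuclideanSpace ℝ (Fin (m + 1))) = m + 1 := by simp
  obtain ⟨g, hg, hcovg⟩ := hrect
  choose K hK using hg
  let D : ℕ → Set (EuclideanSpace ℝ (Fin (m + 1))) := fun k =>
    {a | DifferentiableAt ℝ (g k) a} ∩ (fderiv ℝ (g k)) ⁻¹' {L | Function.Injective L} ∩ g k ⁻¹' Γ
  have hDm : ∀ k, MeasurableSet (D k) := fun k =>
    ((measurableSet_of_differentiableAt ℝ (g k)).inter
      (measurable_fderiv ℝ (g k) ContinuousLinearMap.isOpen_injective.measurableSet)).inter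
      ((hK k).continuous.measurable hΓ)
  have hDd : ∀ k, ∀ a ∈ D k, DifferentiableAt ℝ (g k) a := fun k a ha => ha.1.1
  have hDi : ∀ k, ∀ a ∈ D k, Function.Injective (fderiv ℝ (g k) a) := fun k a ha => ha.1.2
  have hDΓ : ∀ k, g k '' D k ⊆ Γ := by
    rintro k _ ⟨a, ha, rfl⟩; exact ha.2
  choose Z hZ0 hZ using fun k => exists_null_isApproxTangent hΓ (hK k) (hDm k) (hDd k) (hDi k) (hDΓ k)
  set Z' := toMeasurable μHE[m + 1] (⋃ k, Z k) with hZ'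
  have hZ'0 : μHE[m + 1] Z' = 0 := by
    rw [hZ', measure_toMeasurable]; exact measure_iUnion_null hZ0
  -- The bound `1 / 2` gives `‖L (a - b)‖ ≤ 2 ‖g a - g b‖`; `ε / 2` makes up for this factor two.
  set η := min (ε / 2) (1 / 2) with hη
  have hη0 : 0 < η := by positivity
  choose t htm htD hcov happ using fun k : ℕ =>
    exists_countable_cover_approximates_fderiv (hDm k) (hDd k) (hDi k) hη0
  have hη1 : η ≤ 1 / 2 := min_le_right _ _
  have hη2 : η ≤ ε / 2 := min_le_left _ _
  have hlow : ∀ k i, ∀ a ∈ t k i, ∀ b ∈ t k i, ∀ c ∈ t k i,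
      ‖fderiv ℝ (g k) c (a - b)‖ ≤ 2 * ‖g k a - g k b‖ := by
    intro k i a ha b hb c hc
    have h1 := happ k i a ha b hb c hc
    have h2 : ‖fderiv ℝ (g k) c (a - b)‖ ≤
        ‖g k a - g k b‖ + ‖g k a - g k b - fderiv ℝ (g k) c (a - b)‖ := by
      calc _ = ‖(g k a - g k b) - (g k a - g k b - fderiv ℝ (g k) c (a - b))‖ := by
            rw [sub_sub_cancel]
        _ ≤ _ := norm_sub_le _ _
    have h3 := mul_le_mul_of_nonneg_right hη1 (norm_nonneg (fderiv ℝ (g k) c (a - b)))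
    linarith
  have hinjOn : ∀ k i, InjOn (g k) (t k i) := by
    intro k i b hb c hc hbc
    have h := hlow k i b hb c hc b hb
    rw [hbc, sub_self, norm_zero, mul_zero, norm_le_zero_iff] at h
    exact sub_eq_zero.1 (hDi k b (htD k i hb) (h.trans (map_zero (fderiv ℝ (g k) b)).symm))
  have himgm : ∀ k i, MeasurableSet (g k '' t k i) := fun k i =>
    (htm k i).image_of_continuousOn_injOn (hK k).continuous.continuousOn (hinjOn k i)
  let q := TopologicalSpace.denseSeq (Euc (m + 1))
  let e : ℕ ≃ ℕ × ℕ × ℕ := (Denumerable.eqv (ℕ × ℕ × ℕ)).symm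
  let G : ℕ → Set (Euc (m + 1)) := fun l =>
    (g (e l).1 '' t (e l).1 (e l).2.1 \ Z') ∩ Metric.ball (q (e l).2.2) (d / 2)
  have hGm : ∀ l, MeasurableSet (G l) := fun l =>
    ((himgm _ _).diff (measurableSet_toMeasurable _ _)).inter Metric.isOpen_ball.measurableSet
  refine ⟨disjointed G, MeasurableSet.disjointed hGm, disjoint_disjointed G, fun i => ?_, ?_, ?_, ?_⟩
  · refine (disjointed_subset G i).trans ?_
    rintro _ ⟨⟨⟨a, ha, rfl⟩, -⟩, -⟩
    exact (htD _ _ ha).2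
  · rw [iUnion_disjointed]
    -- Four null sets: what the parametrizations miss, the points with a wrong tangent space, the
    -- images of the points of non-differentiability (Rademacher), and the critical values (Sard).
    have hsub : Γ \ ⋃ i, G i ⊆ (Γ \ ⋃ k, range (g k)) ∪ Z' ∪
        ((⋃ k, g k '' {a | ¬ DifferentiableAt ℝ (g k) a}) ∪
        ⋃ k, g k '' {a | DifferentiableAt ℝ (g k) a ∧ ¬ Function.Injective (fderiv ℝ (g k) a)}) := by
      rintro x ⟨hxΓ, hxG⟩
      by_contra hcon
      simp only [mem_union, not_or] at hcon
      obtain ⟨⟨h1, h2⟩, h3, h4⟩ := hcon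
      have : x ∈ ⋃ k, range (g k) := by
        by_contra h; exact h1 ⟨hxΓ, h⟩
      obtain ⟨k, a, rfl⟩ := mem_iUnion.1 this
      have hdiff : DifferentiableAt ℝ (g k) a := by
        by_contra h; exact h3 (mem_iUnion.2 ⟨k, a, h, rfl⟩)
      have hinj : Function.Injective (fderiv ℝ (g k) a) := by
        by_contra h; exact h4 (mem_iUnion.2 ⟨k, a, ⟨hdiff, h⟩, rfl⟩)
      obtain ⟨i, hi⟩ := mem_iUnion.1 (hcov k ⟨⟨hdiff, hinj⟩, hxΓ⟩)
      obtain ⟨l, hl⟩ : ∃ l, dist (g k a) (q l) < d / 2 :=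
        (TopologicalSpace.denseRange_denseSeq (Euc (m + 1))).exists_dist_lt (g k a) (half_pos hd)
      apply hxG
      refine mem_iUnion.2 ⟨e.symm (k, i, l), ?_⟩
      simp only [G, Equiv.apply_symm_apply]
      exact ⟨⟨⟨a, hi, rfl⟩, h2⟩, hl⟩
    refine measure_mono_null hsub (measure_union_null (measure_union_null hcovg hZ'0)
      (measure_union_null (measure_iUnion_null fun k => ?_) (measure_iUnion_null fun k => ?_)))
    · refine euclideanHausdorffMeasure_image_null hV (hK k) ?_
      exact (hK k).ae_differentiableAt
    · exact euclideanHausdorffMeasure_image_critical hV (hK k)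
  · intro i x hx y hy
    have hx' := (disjointed_subset G i hx).2
    have hy' := (disjointed_subset G i hy).2
    rw [← dist_eq_norm]
    have := dist_triangle_right x y (q (e i).2.2)
    rw [Metric.mem_ball] at hx' hy'
    linarith
  · intro i x hx y hy w hw
    obtain ⟨⟨⟨a, ha, rfl⟩, -⟩, -⟩ := disjointed_subset G i hx
    obtain ⟨⟨⟨b, hb, rfl⟩, -⟩, -⟩ := disjointed_subset G i hy
    obtain ⟨⟨⟨c, hc, rfl⟩, hcZ⟩, -⟩ := disjointed_subset G i hw
    set k := (e i).1
    have htan := hZ k c (htD _ _ hc) fun h =>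
      hcZ (subset_toMeasurable _ _ (mem_iUnion.2 ⟨k, h⟩))
    rw [htan.approxTangent_eq]
    set L := fderiv ℝ (g k) c
    have hmem : L (a - b) ∈ LinearMap.range L.toLinearMap := ⟨a - b, rfl⟩
    have hproj : ‖(g k a - g k b) - (LinearMap.range L.toLinearMap).starProjection
        (g k a - g k b)‖ ≤ ‖g k a - g k b - L (a - b)‖ := by
      rw [Submodule.starProjection_minimal]
      exact ciInf_le ⟨0, by rintro _ ⟨_, rfl⟩; exact norm_nonneg _⟩
        (⟨L (a - b), hmem⟩ : LinearMap.range L.toLinearMap)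
    refine hproj.trans ((happ k _ a ha b hb c hc).trans ?_)
    have h1 := hlow k _ a ha b hb c hc
    calc η * ‖L (a - b)‖ ≤ ε / 2 * (2 * ‖g k a - g k b‖) := by gcongr
      _ = _ := by ring

end Tangent

/-! ### Open partitions, admissible maps and boundary mass. -/

section Partition

variable {n N : ℕ} {Ω : Euc n → ℝ} {E : Fin N → Set (Euc n)}

theorem isClosed_bdry (E : Fin N → Set (Euc n)) : IsClosed (bdry E) :=
  isClosed_iUnion_of_finite fun _ => isClosed_frontier

theorem bdry_subset_compl (ho : ∀ i, IsOpen (E i))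
    (hd : Pairwise fun i k => Disjoint (E i) (E k)) : bdry E ⊆ (⋃ i, E i)ᶜ := by
  intro x hx hxE
  obtain ⟨i, hi⟩ := mem_iUnion.1 hx
  obtain ⟨k, hk⟩ := mem_iUnion.1 hxE
  rcases eq_or_ne i k with rfl | hne
  · rw [(ho i).frontier_eq] at hi
    exact hi.2 hk
  · exact ((hd hne).closure_left (ho k)).le_bot ⟨frontier_subset_closure hi, hk⟩

/-- The weight is continuous and positive, hence bounded below on compact sets. -/
theorem IsOpenPartition.measure_compl_inter_lt_top (hΩ : IsWeightFunction Ω)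
    (hE : IsOpenPartition Ω E) {K : Set (Euc n)} (hK : IsCompact K) :
    μHE[n] ((⋃ i, E i)ᶜ ∩ K) < ⊤ := by
  rcases K.eq_empty_or_nonempty with rfl | hne
  · simp
  obtain ⟨x₀, -, hx₀⟩ := hK.exists_isMinOn hne hΩ.1.continuous.continuousOn
  have hpos : 0 < Ω x₀ := (hΩ.2.1 x₀).1
  have hle : ENNReal.ofReal (Ω x₀) * μHE[n] ((⋃ i, E i)ᶜ ∩ K) ≤
      ∫⁻ x in (⋃ i, E i)ᶜ, ENNReal.ofReal (Ω x) ∂μHE[n] := by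
    rw [← setLIntegral_const]
    refine (setLIntegral_mono' ?_ fun x hx => ?_).trans
      (lintegral_mono_set (inter_subset_left (t := K)))
    · exact (isOpen_iUnion hE.isOpen).measurableSet.compl.inter hK.measurableSet
    · exact ENNReal.ofReal_le_ofReal (hx₀ hx.2)
  by_contra htop
  rw [not_lt, top_le_iff] at htop
  rw [htop, ENNReal.mul_top (by simpa using hpos)] at hle
  exact absurd hE.finite (by simpa using hle)

theorem IsOpenPartition.isLocallyFiniteMeasure (hΩ : IsWeightFunction Ω)
    (hE : IsOpenPartition Ω E) :
    IsLocallyFiniteMeasure ((μHE[n] : Measure (Euc n)).restrict (bdry E)) := by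
  refine ⟨fun x => ⟨Metric.closedBall x 1, Metric.closedBall_mem_nhds x one_pos, ?_⟩⟩
  rw [Measure.restrict_apply Metric.isClosed_closedBall.measurableSet, inter_comm]
  exact (measure_mono (inter_subset_inter_left _ (bdry_subset_compl hE.isOpen hE.disjoint))).trans_lt
    (hE.measure_compl_inter_lt_top hΩ (isCompact_closedBall x 1))

theorem euclideanHausdorffMeasure_succ_eq_volume (n : ℕ) :
    (μHE[n + 1] : Measure (Euc n)) = volume :=
  EuclideanSpace.euclideanHausdorffMeasure_eq_volume (n + 1)

/-- Locally finite `ℋⁿ` measure forces `ℋⁿ⁺¹`, which is Lebesgue measure, to vanish. -/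
theorem IsOpenPartition.volume_compl (hΩ : IsWeightFunction Ω) (hE : IsOpenPartition Ω E) :
    volume (⋃ i, E i)ᶜ = 0 := by
  have hcov : (⋃ i, E i)ᶜ ⊆ ⋃ k : ℕ, (⋃ i, E i)ᶜ ∩ Metric.closedBall 0 k := by
    rw [← inter_iUnion, Metric.iUnion_closedBall_nat, inter_univ]
  refine measure_mono_null hcov (measure_iUnion_null fun k => ?_)
  rw [← euclideanHausdorffMeasure_succ_eq_volume]
  rcases Measure.euclideanHausdorffMeasure_zero_or_top (Nat.lt_succ_self n)
    ((⋃ i, E i)ᶜ ∩ Metric.closedBall (0 : Euc n) k) with h | h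
  · exact h
  · exact absurd h (hE.measure_compl_inter_lt_top hΩ (isCompact_closedBall 0 (k : ℝ))).ne

/-- A Lebesgue null complement has empty interior, so the open sets are jointly dense; as they are
finitely many, the closure of the union is the union of the closures. -/
theorem IsOpenPartition.compl_eq_bdry (hΩ : IsWeightFunction Ω) (hE : IsOpenPartition Ω E) :
    (⋃ i, E i)ᶜ = bdry E := by
  refine Subset.antisymm (fun x hx => ?_) (bdry_subset_compl hE.isOpen hE.disjoint)
  have hdense : x ∈ closure (⋃ i, E i) := by
    have hint : interior (⋃ i, E i)ᶜ = ∅ := by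
      by_contra hne
      have := isOpen_interior.measure_pos volume (nonempty_iff_ne_empty.2 hne)
      exact this.ne' (measure_mono_null interior_subset (hE.volume_compl hΩ))
    rw [interior_compl, compl_empty_iff] at hint
    rw [hint]; trivial
  rw [closure_iUnion_of_finite] at hdense
  obtain ⟨i, hi⟩ := mem_iUnion.1 hdense
  refine mem_iUnion.2 ⟨i, ?_⟩
  rw [(hE.isOpen i).frontier_eq]
  exact ⟨hi, fun h => hx (mem_iUnion.2 ⟨i, h⟩)⟩

theorem IsOpenPartition.volume_image_bdry (hΩ : IsWeightFunction Ω) (hE : IsOpenPartition Ω E)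
    {f : Euc n → Euc n} {K : ℝ≥0} (hf : LipschitzWith K f) : volume (f '' bdry E) = 0 := by
  have h0 : volume (bdry E) = 0 := by rw [← hE.compl_eq_bdry hΩ]; exact hE.volume_compl hΩ
  exact le_antisymm (by
    have := euclideanHausdorffMeasure_image_le (d := n + 1) (hf.lipschitzOnWith (s := bdry E))
    rwa [euclideanHausdorffMeasure_succ_eq_volume, h0, mul_zero] at this) zero_le

/-- A Lipschitz map at bounded distance from the identity with connected fibres is admissible. -/
theorem IsOpenPartition.isAdmissible (hΩ : IsWeightFunction Ω) (hE : IsOpenPartition Ω E)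
    {f : Euc n → Euc n} {K : ℝ≥0} (hf : LipschitzWith K f) {M : ℝ} (hM : ∀ x, ‖f x - x‖ ≤ M)
    (hfib : ∀ y, IsConnected (f ⁻¹' {y})) : IsAdmissible E f := by
  -- a fibre which does not meet the boundary lies in one of the open sets
  have hone : ∀ y, y ∉ f '' bdry E → ∃ i, f ⁻¹' {y} ⊆ E i := by
    intro y hy
    have hsub : f ⁻¹' {y} ⊆ ⋃ i, E i := by
      intro x hx
      by_contra hxE
      have : x ∈ bdry E := by rw [← hE.compl_eq_bdry hΩ]; exact hxE
      exact hy ⟨x, this, hx⟩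
    obtain ⟨x, hx⟩ := (hfib y).nonempty
    obtain ⟨i, hi⟩ := mem_iUnion.1 (hsub hx)
    refine ⟨i, (hfib y).isPreconnected.subset_left_of_subset_union (hE.isOpen i)
      (v := ⋃ k ≠ i, E k) (isOpen_biUnion fun k _ => hE.isOpen k) ?_ ?_ ⟨x, hx, hi⟩⟩
    · rw [disjoint_iUnion₂_right]
      exact fun k hk => hE.disjoint hk.symm
    · intro z hz
      obtain ⟨k, hk⟩ := mem_iUnion.1 (hsub hz)
      rcases eq_or_ne k i with rfl | hne
      · exact Or.inl hk
      · exact Or.inr (mem_iUnion₂.2 ⟨k, hne, hk⟩)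
  -- A continuous map at bounded distance from the identity is proper, hence closed.
  have hclosed : IsClosedMap f := by
    refine IsProperMap.isClosedMap (isProperMap_iff_isCompact_preimage.2
      ⟨hf.continuous, fun L hL => ?_⟩)
    refine Metric.isCompact_of_isClosed_isBounded (hL.isClosed.preimage hf.continuous) ?_
    obtain ⟨ρ, hρ⟩ := hL.isBounded.subset_closedBall 0
    refine (Metric.isBounded_closedBall (x := 0) (r := ρ + M)).subset fun x hx => ?_
    have h1 := mem_closedBall_zero_iff.1 (hρ hx)
    have h2 := hM x
    rw [mem_closedBall_zero_iff]
    calc ‖x‖ = ‖f x - (f x - x)‖ := by rw [sub_sub_cancel]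
      _ ≤ ‖f x‖ + ‖f x - x‖ := norm_sub_le _ _
      _ ≤ _ := add_le_add h1 h2
  refine ⟨⟨K, hf⟩, fun i k hik => ?_, fun y hy => ?_, ⟨M, hM⟩⟩
  · change Disjoint _ _
    rw [disjoint_iff_inter_eq_empty]
    by_contra hne
    have hopen : IsOpen (pushforward f E i ∩ pushforward f E k) :=
      isOpen_interior.inter isOpen_interior
    -- An open overlap would have positive volume, but off the null set `f '' bdry E` each fibre
    -- lies in a single `E i`.
    refine (hopen.measure_pos volume (nonempty_iff_ne_empty.2 hne)).ne'
      (measure_mono_null (fun y hy => ?_) (hE.volume_image_bdry hΩ hf))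
    by_contra hyb
    obtain ⟨l, hl⟩ := hone y hyb
    obtain ⟨x, hx, hxy⟩ := interior_subset hy.1
    obtain ⟨x', hx', hxy'⟩ := interior_subset hy.2
    have h1 : l = i := by
      by_contra hne; exact (hE.disjoint hne).le_bot ⟨hl hxy, hx⟩
    have h2 : l = k := by
      by_contra hne; exact (hE.disjoint hne).le_bot ⟨hl hxy', hx'⟩
    exact hik (h1.symm.trans h2)
  · by_contra hyb
    obtain ⟨i, hi⟩ := hone y hyb
    apply hy
    -- The points whose whole fibre lies in `E i` form an open set because `f` is closed; since
    -- fibres are nonempty, this set lies in `f '' E i`.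
    refine mem_iUnion.2 ⟨i, mem_interior.2 ⟨(f '' (E i)ᶜ)ᶜ, fun z hz => ?_,
      (hclosed _ (hE.isOpen i).isClosed_compl).isOpen_compl, ?_⟩⟩
    · obtain ⟨x, hx⟩ := (hfib z).nonempty
      refine ⟨x, ?_, hx⟩
      by_contra hxE
      exact hz ⟨x, hxE, hx⟩
    · rintro ⟨x, hxE, hx⟩
      exact hxE (hi hx)

theorem IsAdmissible.bdry_pushforward_subset {f : Euc n → Euc n} (hf : IsAdmissible E f) :
    bdry (pushforward f E) ⊆ f '' bdry E :=
  (bdry_subset_compl (fun _ => isOpen_interior) hf.disjoint).trans hf.compl_subset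

theorem bdryMass_eq_of_aemeasurable
    (h : AEMeasurable (fun x => (x, approxTangent (bdry E) x)) (μHE[n].restrict (bdry E))) :
    bdryMass E = μHE[n].restrict (bdry E) := by
  rw [bdryMass, weight, bdryVarifold, setVarifold,
    AEMeasurable.map_map_of_aemeasurable measurable_fst.aemeasurable h]
  exact Measure.map_id

theorem bdryMass_eq_zero_of_not_aemeasurable
    (h : ¬ AEMeasurable (fun x => (x, approxTangent (bdry E) x)) (μHE[n].restrict (bdry E))) :
    bdryMass E = 0 := by
  rw [bdryMass, weight, bdryVarifold, setVarifold, Measure.map_of_not_aemeasurable h,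
    Measure.map_zero]

/-- No measurability of the tangent field is needed, since `Measure.map` is zero by default without
it. This is what allows the bound to be applied to a pushed-forward partition, whose tangent field
is not examined. -/
theorem bdryMass_le (E : Fin N → Set (Euc n)) : bdryMass E ≤ μHE[n].restrict (bdry E) := by
  by_cases h : AEMeasurable (fun x => (x, approxTangent (bdry E) x)) (μHE[n].restrict (bdry E))
  · exact (bdryMass_eq_of_aemeasurable h).le
  · rw [bdryMass_eq_zero_of_not_aemeasurable h]; exact Measure.zero_le _

/-- Without measurability the mass would be the zero measure by default, whose density is zero. Thus
one point of density one makes the mass equal to `ℋⁿ⌊Γ`. -/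
theorem HasDensity.aemeasurable {y : Euc n} (h : HasDensity (bdryMass E) y 1) :
    AEMeasurable (fun x => (x, approxTangent (bdry E) x)) (μHE[n].restrict (bdry E)) := by
  by_contra hcon
  rw [HasDensity, bdryMass_eq_zero_of_not_aemeasurable hcon] at h
  simp only [measureReal_zero_apply, zero_div] at h
  exact zero_ne_one (tendsto_nhds_unique tendsto_const_nhds h)

/-- Grönwall along the segment from `y` to `x`: the bound `|∇φ| ≤ j φ` makes `exp (-j ‖x - y‖ t) φ`
decrease. -/
theorem testFunctions_le_exp_mul {j : ℕ} {φ : Euc n → ℝ} (hφ : φ ∈ testFunctions Ω j)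
    (x y : Euc n) : φ x ≤ Real.exp (j * ‖x - y‖) * φ y := by
  set c := (j : ℝ) * ‖x - y‖ with hc
  let u : ℝ → ℝ := fun t => Real.exp (-(c * t)) * φ (y + t • (x - y))
  have hline : ∀ t : ℝ, HasDerivAt (fun t : ℝ => y + t • (x - y)) (x - y) t := by
    intro t
    simpa using ((hasDerivAt_id t).smul_const (x - y)).const_add y
  have hd : ∀ t, HasDerivAt u (-c * Real.exp (-(c * t)) * φ (y + t • (x - y)) +
      Real.exp (-(c * t)) * fderiv ℝ φ (y + t • (x - y)) (x - y)) t := by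
    intro t
    have h1 : HasDerivAt (fun t : ℝ => Real.exp (-(c * t))) (-c * Real.exp (-(c * t))) t := by
      have := ((hasDerivAt_id t).const_mul c).neg.exp
      simpa [mul_comm] using this
    have h2 : HasDerivAt (fun t : ℝ => φ (y + t • (x - y)))
        (fderiv ℝ φ (y + t • (x - y)) (x - y)) t :=
      ((hφ.1.differentiable (by norm_num)) _).hasFDerivAt.comp_hasDerivAt t (hline t)
    exact h1.mul h2
  have hanti : Antitone u := by
    refine antitone_of_hasDerivAt_nonpos hd fun t => ?_
    have h1 := (le_abs_self _).trans ((fderiv ℝ φ (y + t • (x - y))).le_opNorm (x - y))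
    have h2 := mul_le_mul_of_nonneg_right (hφ.2 (y + t • (x - y))).2.2.1 (norm_nonneg (x - y))
    have h3 : fderiv ℝ φ (y + t • (x - y)) (x - y) ≤ c * φ (y + t • (x - y)) := by
      rw [hc]; linarith
    have h4 := Real.exp_pos (-(c * t))
    have h5 := mul_le_mul_of_nonneg_left h3 h4.le
    simp only [Pi.zero_apply]
    linarith
  have h01 := hanti zero_le_one
  simp only [u, mul_one, one_smul, mul_zero, neg_zero, Real.exp_zero, zero_smul, add_zero, one_mul,
    add_sub_cancel] at h01
  rw [Real.exp_neg, inv_mul_le_iff₀ (Real.exp_pos _)] at h01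
  exact h01

end Partition

/-! ### The tilt of the tangent spaces. -/

section Tilt

variable {n N : ℕ} {E : Fin N → Set (Euc n)}

/-- The tilt of the approximate tangent space of `Γ` at `x` against the horizontal plane. -/
noncomputable def tilt (Γ : Set (Euc n)) (x : Euc n) : ℝ :=
  ‖(approxTangent Γ x).proj - (horizontal n).proj‖

theorem Grass.norm_proj_le (S : Grass n) : ‖S.proj‖ ≤ 1 := Submodule.starProjection_norm_le _

theorem tilt_nonneg (Γ : Set (Euc n)) (x : Euc n) : 0 ≤ tilt Γ x := norm_nonneg _

theorem tilt_le_two (Γ : Set (Euc n)) (x : Euc n) : tilt Γ x ≤ 2 :=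
  (norm_sub_le _ _).trans (by
    linarith [(approxTangent Γ x).norm_proj_le, (horizontal n).norm_proj_le])

theorem continuous_norm_proj_sub (P : Grass n) :
    Continuous fun S : Grass n => ‖S.proj - P.proj‖ :=
  ((continuous_induced_dom (f := Grass.proj)).sub continuous_const).norm

theorem aemeasurable_tilt {μ : Measure (Euc n)} {Γ : Set (Euc n)}
    (h : AEMeasurable (fun x => (x, approxTangent Γ x)) μ) : AEMeasurable (tilt Γ) μ :=
  (continuous_norm_proj_sub (horizontal n)).measurable.comp_aemeasurable
    (measurable_snd.comp_aemeasurable h)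

/-- Translates the tilt hypothesis on the varifold into a lower integral over `Γ`. Finite mass of
`C` and the bound two for the tilt make the Bochner integral genuine and not the default zero. -/
theorem lintegral_tilt_le
    (h : AEMeasurable (fun x => (x, approxTangent (bdry E) x)) (μHE[n].restrict (bdry E)))
    {C : Set (Euc n)} (hC : MeasurableSet C) (hfin : μHE[n].restrict (bdry E) C ≠ ⊤) {b : ℝ}
    (hb : ∫ p in C ×ˢ (univ : Set (Grass n)), ‖p.2.proj - (horizontal n).proj‖ ∂(bdryVarifold E) ≤
      b) :
    ∫⁻ x in C, ENNReal.ofReal (tilt (bdry E) x) ∂(μHE[n].restrict (bdry E)) ≤ ENNReal.ofReal b := by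
  have hm : Measurable fun p : Euc n × Grass n => ‖p.2.proj - (horizontal n).proj‖ :=
    (continuous_norm_proj_sub (horizontal n)).measurable.comp measurable_snd
  have hmeas : AEMeasurable (tilt (bdry E)) ((μHE[n].restrict (bdry E)).restrict C) :=
    (aemeasurable_tilt h).restrict
  have hint : Integrable (tilt (bdry E)) ((μHE[n].restrict (bdry E)).restrict C) := by
    have : IsFiniteMeasure ((μHE[n].restrict (bdry E)).restrict C) :=
      ⟨by rw [Measure.restrict_apply_univ]; exact lt_top_iff_ne_top.2 hfin⟩
    refine Integrable.of_bound hmeas.aestronglyMeasurable 2 (ae_of_all _ fun x => ?_)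
    rw [Real.norm_of_nonneg (tilt_nonneg _ _)]
    exact tilt_le_two _ _
  rw [← ofReal_integral_eq_lintegral_ofReal hint (ae_of_all _ fun x => tilt_nonneg _ _)]
  refine ENNReal.ofReal_le_ofReal (le_of_eq_of_le ?_ hb)
  rw [bdryVarifold, setVarifold, setIntegral_map (hC.prod MeasurableSet.univ)
    hm.aestronglyMeasurable h]
  have : (fun x => (x, approxTangent (bdry E) x)) ⁻¹' C ×ˢ (univ : Set (Grass n)) = C := by
    ext x; simp
  rw [this]
  rfl

end Tilt

/-! ### The gauge of a disc seen from an interior point. -/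

section Gauge

variable {H : Type*} [NormedAddCommGroup H] [InnerProductSpace ℝ H]

/-- The gauge of the ball of radius `r` about the origin, seen from the point `a`. -/
noncomputable def gaugeFrom (a : H) (r : ℝ) (v : H) : ℝ := gauge (Metric.closedBall (-a) r) v

variable {a : H} {r c : ℝ}

theorem gaugeFrom_nonneg (v : H) : 0 ≤ gaugeFrom a r v := gauge_nonneg v

theorem gaugeFrom_smul {t : ℝ} (ht : 0 ≤ t) (v : H) :
    gaugeFrom a r (t • v) = t * gaugeFrom a r v := gauge_smul_of_nonneg ht v

theorem ball_subset_closedBall_neg {H : Type*} [NormedAddCommGroup H] {a : H} {r c : ℝ} (ha : ‖a‖ + c ≤ r) :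
    Metric.ball (0 : H) c ⊆ Metric.closedBall (-a) r := by
  intro v hv
  rw [mem_ball_zero_iff] at hv
  rw [mem_closedBall_iff_norm, sub_neg_eq_add]
  exact (norm_add_le _ _).trans (by linarith)

theorem gaugeFrom_le_one_iff (hc : 0 < c) (ha : ‖a‖ + c ≤ r) {v : H} :
    gaugeFrom a r v ≤ 1 ↔ ‖a + v‖ ≤ r := by
  rw [gaugeFrom, gauge_le_one_iff_mem_closure (convex_closedBall _ _)
    (Filter.mem_of_superset (Metric.ball_mem_nhds 0 hc) (ball_subset_closedBall_neg ha)),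
    Metric.isClosed_closedBall.closure_eq, mem_closedBall_iff_norm, sub_neg_eq_add, add_comm]

theorem norm_le_mul_gaugeFrom (hc : 0 < c) (ha : ‖a‖ + c ≤ r) (v : H) :
    ‖v‖ ≤ 2 * r * gaugeFrom a r v := by
  have hr : 0 < r := by linarith [norm_nonneg a]
  have h := le_gauge_of_subset_closedBall (x := v) (r := 2 * r)
    ((absorbent_ball_zero hc).mono (ball_subset_closedBall_neg ha)) (by positivity) (fun w hw => by
      rw [mem_closedBall_iff_norm, sub_neg_eq_add] at hw
      rw [mem_closedBall_zero_iff]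
      calc ‖w‖ = ‖(w + a) - a‖ := by rw [add_sub_cancel_right]
        _ ≤ ‖w + a‖ + ‖a‖ := norm_sub_le _ _
        _ ≤ 2 * r := by linarith)
  rwa [div_le_iff₀ (by positivity), mul_comm] at h

theorem mul_gaugeFrom_le_norm (ha : ‖a‖ + c ≤ r) (v : H) : c * gaugeFrom a r v ≤ ‖v‖ :=
  mul_gauge_le_norm (ball_subset_closedBall_neg ha)

theorem abs_gaugeFrom_sub_le (hc : 0 < c) (ha : ‖a‖ + c ≤ r) (v w : H) :
    |gaugeFrom a r v - gaugeFrom a r w| ≤ c⁻¹ * ‖v - w‖ := by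
  have := (Convex.lipschitzWith_gauge (r := ⟨c, hc.le⟩) (convex_closedBall (-a) r) hc
    (ball_subset_closedBall_neg ha)).dist_le_mul v w
  rwa [Real.dist_eq, dist_eq_norm] at this

theorem gaugeFrom_pos (hc : 0 < c) (ha : ‖a‖ + c ≤ r) {v : H} (hv : v ≠ 0) :
    0 < gaugeFrom a r v := by
  have hr : 0 < r := by linarith [norm_nonneg a]
  have h1 := norm_le_mul_gaugeFrom hc ha v
  have h2 := norm_pos_iff.2 hv
  by_contra hcon
  have : gaugeFrom a r v = 0 := le_antisymm (not_lt.1 hcon) (gaugeFrom_nonneg v)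
  rw [this] at h1
  linarith

end Gauge

/-! ### The expansion: invariance of the cylinder, Lipschitz continuity and fibres. -/

section Expansion

variable {F : Type*} [NormedAddCommGroup F] [InnerProductSpace ℝ F] [FiniteDimensional ℝ F]

/-- The factor by which the horizontal position relative to `a` is divided. -/
noncomputable def shrinkFactor (H : Submodule ℝ F) (a : H) (r : ℝ) (s : F → ℝ) (x : F) : ℝ :=
  min 1 (max (s x) (gaugeFrom a r (H.orthogonalProjectionOnto x - a)))

/-- The horizontal expansion about `a` of the cylinder of radius `r`: the part near the axis through
`a` is stretched over the whole cylinder, the rest is pushed into the wall. -/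
noncomputable def expansion (H : Submodule ℝ F) (a : H) (r : ℝ) (s : F → ℝ) (x : F) : F :=
  x + ((shrinkFactor H a r s x)⁻¹ - 1) • ((H.orthogonalProjectionOnto x - a : H) : F)

variable {H : Submodule ℝ F} {a : H} {r c ℓ σ : ℝ} {s : F → ℝ}

local notation "π" => Submodule.orthogonalProjectionOnto H

theorem proj_expansion_sub (x : F) : π (expansion H a r s x) - a =
    (shrinkFactor H a r s x)⁻¹ • (π x - a) := by
  rw [expansion, map_add, map_smul, Submodule.orthogonalProjectionOnto_mem_subspace_eq_self,
    sub_smul, one_smul]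
  abel

/-- The displacement is horizontal, so heights are preserved. -/
theorem expansion_sub_proj (x : F) : expansion H a r s x - π (expansion H a r s x) = x - π x := by
  have h := congrArg (fun v : H => (v : F)) (proj_expansion_sub (H := H) (a := a) (r := r) (s := s) x)
  simp only [Submodule.coe_sub, Submodule.coe_smul] at h
  have h' : (π (expansion H a r s x) : F) = (shrinkFactor H a r s x)⁻¹ • ((π x : F) - a) + a := by
    rw [← h]; abel
  rw [h', expansion, Submodule.coe_sub, sub_smul, one_smul]
  abel

theorem shrinkFactor_le_one (x : F) : shrinkFactor H a r s x ≤ 1 := min_le_left _ _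

theorem le_shrinkFactor (hσ : ∀ x, σ ≤ s x) (hs1 : ∀ x, s x ≤ 1) (x : F) :
    σ ≤ shrinkFactor H a r s x :=
  le_min ((hσ x).trans (hs1 x)) (le_max_of_le_left (hσ x))

theorem expansion_eq_self_of_one_le (x : F) (h : 1 ≤ max (s x) (gaugeFrom a r (π x - a))) :
    expansion H a r s x = x := by
  rw [expansion, shrinkFactor, min_eq_left h]; simp

theorem expansion_of_gauge_le (hs1 : ∀ x, s x ≤ 1) {x : F} (h : gaugeFrom a r (π x - a) ≤ s x) :
    expansion H a r s x = x + ((s x)⁻¹ - 1) • ((π x - a : H) : F) := by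
  rw [expansion, shrinkFactor, max_eq_left h, min_eq_right (hs1 x)]

theorem expansion_of_le_gauge {x : F} (h : s x ≤ gaugeFrom a r (π x - a))
    (h1 : gaugeFrom a r (π x - a) ≤ 1) :
    expansion H a r s x = x + ((gaugeFrom a r (π x - a))⁻¹ - 1) • ((π x - a : H) : F) := by
  rw [expansion, shrinkFactor, max_eq_right h, min_eq_right h1]

/-- The divisor is at least the gauge as long as the latter is at most one, so no point is carried
beyond the wall. -/
theorem gauge_expansion_le_one (hσ0 : 0 < σ) (hσ : ∀ x, σ ≤ s x) (hs1 : ∀ x, s x ≤ 1) {x : F}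
    (h1 : gaugeFrom a r (π x - a) ≤ 1) :
    gaugeFrom a r (π (expansion H a r s x) - a) ≤ 1 := by
  have hk : 0 < shrinkFactor H a r s x := hσ0.trans_le (le_shrinkFactor hσ hs1 x)
  rw [proj_expansion_sub, gaugeFrom_smul (by positivity), inv_mul_le_iff₀ hk, mul_one]
  exact le_min h1 (le_max_right _ _)

theorem norm_proj_expansion_le (hc : 0 < c) (ha : ‖a‖ + c ≤ r) (hσ0 : 0 < σ) (hσ : ∀ x, σ ≤ s x)
    (hs1 : ∀ x, s x ≤ 1) {x : F} (hx : ‖π x‖ ≤ r) : ‖π (expansion H a r s x)‖ ≤ r := by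
  have h1 : gaugeFrom a r (π x - a) ≤ 1 := by
    rw [gaugeFrom_le_one_iff hc ha, add_sub_cancel]; exact hx
  have := gauge_expansion_le_one hσ0 hσ hs1 h1
  rwa [gaugeFrom_le_one_iff hc ha, add_sub_cancel] at this

theorem expansion_eq_self_of_norm (hc : 0 < c) (ha : ‖a‖ + c ≤ r) {x : F} (hx : r < ‖π x‖) :
    expansion H a r s x = x := by
  refine expansion_eq_self_of_one_le x (le_max_of_le_right ?_)
  by_contra hcon
  have := (gaugeFrom_le_one_iff hc ha).1 (not_le.1 hcon).le
  rw [add_sub_cancel] at this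
  linarith

theorem norm_proj_sub_proj_le (x y : F) : ‖(x - (π x : F)) - (y - (π y : F))‖ ≤ ‖x - y‖ := by
  have : (x - (π x : F)) - (y - (π y : F)) = (x - y) - (π (x - y) : F) := by
    rw [map_sub, Submodule.coe_sub]; abel
  rw [this]
  have h : (x - y) - (π (x - y) : F) = Hᗮ.starProjection (x - y) :=
    (Submodule.starProjection_orthogonal_val _).symm
  rw [h]
  exact Submodule.norm_orthogonalProjectionOnto_apply_le Hᗮ (x - y)

theorem norm_proj_sub_le (x y : F) : ‖π x - π y‖ ≤ ‖x - y‖ := by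
  rw [← map_sub]; exact Submodule.norm_orthogonalProjectionOnto_apply_le _ _

/-- The divisor is Lipschitz and at least `σ`, and nothing moves where the horizontal position is
large. The constant degenerates as `σ → 0`, but the area estimates use it only to see that null sets
have null images. -/
theorem exists_lipschitzWith_expansion (hc : 0 < c) (ha : ‖a‖ + c ≤ r) (hσ0 : 0 < σ)
    (hσ : ∀ x, σ ≤ s x) (hs1 : ∀ x, s x ≤ 1) (hℓ : 0 ≤ ℓ)
    (hs : ∀ x y, |s x - s y| ≤ ℓ * ‖(x - (π x : F)) - (y - (π y : F))‖) :
    ∃ K, LipschitzWith K (expansion H a r s) := by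
  have hr : 0 < r := by linarith [norm_nonneg a]
  set k := shrinkFactor H a r s with hk
  have hkσ : ∀ x, σ ≤ k x := le_shrinkFactor hσ hs1
  have hk0 : ∀ x, 0 < k x := fun x => hσ0.trans_le (hkσ x)
  have hklip : ∀ x y, |k x - k y| ≤ (ℓ + c⁻¹) * ‖x - y‖ := by
    intro x y
    have h1 : |s x - s y| ≤ ℓ * ‖x - y‖ :=
      (hs x y).trans (by gcongr; exact norm_proj_sub_proj_le x y)
    have h2 : |gaugeFrom a r (π x - a) - gaugeFrom a r (π y - a)| ≤ c⁻¹ * ‖x - y‖ := by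
      refine (abs_gaugeFrom_sub_le hc ha _ _).trans ?_
      rw [sub_sub_sub_cancel_right]
      gcongr
      exact norm_proj_sub_le x y
    have h3 := abs_min_sub_min_le_max 1 (max (s x) (gaugeFrom a r (π x - a))) 1
      (max (s y) (gaugeFrom a r (π y - a)))
    have h4 := abs_max_sub_max_le_max (s x) (gaugeFrom a r (π x - a)) (s y)
      (gaugeFrom a r (π y - a))
    rw [sub_self, abs_zero, max_eq_right (a := (0 : ℝ)) (abs_nonneg _)] at h3
    refine h3.trans (h4.trans (max_le ?_ ?_))
    · refine h1.trans ?_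
      gcongr
      linarith [inv_pos.2 hc]
    · refine h2.trans ?_
      gcongr
      linarith
  set u : F → ℝ := fun x => (k x)⁻¹ - 1 with hu
  have hu0 : ∀ x, 0 ≤ u x := fun x => by
    have := (one_le_inv₀ (hk0 x)).2 (shrinkFactor_le_one x)
    simp only [hu]; linarith
  have hub : ∀ x, u x ≤ σ⁻¹ := fun x => by
    have := inv_anti₀ hσ0 (hkσ x)
    simp only [hu]; linarith
  set Ku := (σ⁻¹ * σ⁻¹) * (ℓ + c⁻¹) with hKu
  have hKu0 : 0 ≤ Ku := by positivity
  have hulip : ∀ x y, |u x - u y| ≤ Ku * ‖x - y‖ := by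
    intro x y
    have : u x - u y = (k x)⁻¹ * (k y)⁻¹ * (k y - k x) := by
      simp only [hu]
      have := (hk0 x).ne'
      have := (hk0 y).ne'
      field_simp
      ring
    rw [this, abs_mul, abs_of_nonneg (by have := hk0 x; have := hk0 y; positivity), abs_sub_comm,
      hKu, mul_assoc (σ⁻¹ * σ⁻¹)]
    have i1 := inv_anti₀ hσ0 (hkσ x)
    have i2 := inv_anti₀ hσ0 (hkσ y)
    have i3 : 0 ≤ (k x)⁻¹ := (inv_pos.2 (hk0 x)).le
    have i4 : 0 ≤ (k y)⁻¹ := (inv_pos.2 (hk0 y)).le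
    gcongr
    exact hklip x y
  have hsupp : ∀ x, u x ≠ 0 → ‖π x - a‖ ≤ 2 * r := by
    intro x hx
    have hg : gaugeFrom a r (π x - a) ≤ 1 := by
      by_contra hcon
      apply hx
      have : k x = 1 := by
        rw [hk, shrinkFactor, min_eq_left (le_max_of_le_right (not_le.1 hcon).le)]
      simp [hu, this]
    have := norm_le_mul_gaugeFrom hc ha (π x - a)
    nlinarith
  have key : ∀ x y, u y ≠ 0 → ‖u x • ((π x - a : H) : F) - u y • ((π y - a : H) : F)‖ ≤
      (σ⁻¹ + 2 * r * Ku) * ‖x - y‖ := by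
    intro x y hy
    have e : u x • ((π x - a : H) : F) - u y • ((π y - a : H) : F) =
        u x • ((π x - π y : H) : F) + (u x - u y) • ((π y - a : H) : F) := by
      simp only [Submodule.coe_sub, smul_sub, sub_smul]; abel
    rw [e]
    refine (norm_add_le _ _).trans ?_
    rw [norm_smul, norm_smul, ← Submodule.coe_norm, ← Submodule.coe_norm, Real.norm_of_nonneg (hu0 x),
      Real.norm_eq_abs, add_mul]
    have i1 := mul_le_mul (hub x) (norm_proj_sub_le (H := H) x y) (norm_nonneg _) (by positivity)
    have i2 := mul_le_mul (hulip x y) (hsupp y hy) (norm_nonneg _) (by positivity)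
    linarith
  refine ⟨(1 + (σ⁻¹ + 2 * r * Ku)).toNNReal, LipschitzWith.of_dist_le_mul fun x y => ?_⟩
  rw [Real.coe_toNNReal _ (by positivity), dist_eq_norm, dist_eq_norm]
  have e : expansion H a r s x - expansion H a r s y =
      (x - y) + (u x • ((π x - a : H) : F) - u y • ((π y - a : H) : F)) := by
    simp only [expansion, hu, hk]; abel
  rw [e, add_mul, one_mul]
  refine (norm_add_le _ _).trans (add_le_add_right ?_ _)
  by_cases hy : u y = 0
  · by_cases hx : u x = 0
    · rw [hx, hy, zero_smul, zero_smul, sub_zero, norm_zero]; positivity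
    · rw [norm_sub_rev, norm_sub_rev x y]
      exact key y x hx
  · exact key x y hy

/-- By `hs` the factor `s` depends on the height alone. The preimages of `y` therefore lie on the
ray through `w = π y - a` at the same height, at the positions `t • w` whose divisor is `t`. If the
gauge of `w` is below one only `t = s y` is possible; on the wall every `t ∈ [s y, 1]` is; beyond it
only `t = 1`. -/
theorem isConnected_fiber_expansion (hσ0 : 0 < σ) (hσ : ∀ x, σ ≤ s x) (hs1 : ∀ x, s x ≤ 1)
    (hs : ∀ x y, |s x - s y| ≤ ℓ * ‖(x - (π x : F)) - (y - (π y : F))‖) (y : F) :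
    IsConnected (expansion H a r s ⁻¹' {y}) := by
  set w := π y - a with hw
  have hseq : ∀ x, x - (π x : F) = y - (π y : F) → s x = s y := by
    intro x hx
    have := hs x y
    rw [hx, sub_self, norm_zero, mul_zero] at this
    exact sub_eq_zero.1 (abs_nonpos_iff.1 this)
  have hk0 : ∀ x, 0 < shrinkFactor H a r s x := fun x => hσ0.trans_le (le_shrinkFactor hσ hs1 x)
  have hsy : 0 < s y := hσ0.trans_le (hσ y)
  -- points of the fibre
  have hfib : ∀ x, expansion H a r s x = y →
      x = y + (shrinkFactor H a r s x - 1) • (w : F) ∧ s x = s y ∧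
        π x - a = shrinkFactor H a r s x • w := by
    intro x hx
    have h1 := proj_expansion_sub (H := H) (a := a) (r := r) (s := s) x
    have h2 := expansion_sub_proj (H := H) (a := a) (r := r) (s := s) x
    rw [hx] at h1 h2
    have h3 : π x - a = shrinkFactor H a r s x • w := by
      rw [hw, h1, smul_smul, mul_inv_cancel₀ (hk0 x).ne', one_smul]
    refine ⟨?_, hseq x h2.symm, h3⟩
    have h4 := congrArg (fun v : H => (v : F)) h3
    simp only [Submodule.coe_sub, Submodule.coe_smul] at h4
    have h5 : x = y - (π y : F) + (π x : F) := by rw [h2]; abel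
    have h6 : (π x : F) = shrinkFactor H a r s x • (w : F) + a := by rw [← h4]; abel
    have h7 : (π y : F) = (w : F) + a := by rw [hw, Submodule.coe_sub]; abel
    rw [h6, h7] at h5
    rw [sub_smul, one_smul]
    calc x = _ := h5
      _ = _ := by abel
  have hpt : ∀ t : ℝ, s (y + (t - 1) • (w : F)) = s y ∧ π (y + (t - 1) • (w : F)) - a = t • w := by
    intro t
    have h1 : π (y + (t - 1) • (w : F)) = π y + (t - 1) • w := by
      rw [map_add, map_smul, Submodule.orthogonalProjectionOnto_mem_subspace_eq_self]
    refine ⟨hseq _ ?_, ?_⟩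
    · rw [h1, Submodule.coe_add, Submodule.coe_smul]; abel
    · rw [h1, sub_smul, one_smul, hw]; abel
  have hback : ∀ t : ℝ, t ≠ 0 → shrinkFactor H a r s (y + (t - 1) • (w : F)) = t →
      expansion H a r s (y + (t - 1) • (w : F)) = y := by
    intro t ht hk
    rw [expansion, hk, (hpt t).2, Submodule.coe_smul, smul_smul, sub_mul, inv_mul_cancel₀ ht,
      one_mul, add_assoc, ← add_smul]
    simp
  rcases lt_trichotomy (gaugeFrom a r w) 1 with hg | hg | hg
  · have : expansion H a r s ⁻¹' {y} = {y + (s y - 1) • (w : F)} := by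
      ext x
      rw [mem_preimage, mem_singleton_iff, mem_singleton_iff]
      constructor
      · intro hx
        obtain ⟨h1, h2, h3⟩ := hfib x hx
        set k := shrinkFactor H a r s x with hk
        have hk' : k = min 1 (max (s y) (k * gaugeFrom a r w)) := by
          conv_lhs => rw [hk, shrinkFactor, h3, h2, gaugeFrom_smul (hk0 x).le]
        have hlt : k * gaugeFrom a r w < k := by nlinarith [hk0 x]
        have : k = s y := by
          rcases min_choice 1 (max (s y) (k * gaugeFrom a r w)) with h | h
          · rw [h] at hk'
            rw [hk'] at hlt ⊢
            have h5 := min_eq_left_iff.1 h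
            rw [hk', one_mul] at h5
            rw [one_mul] at hlt
            rcases le_max_iff.1 h5 with h6 | h6
            · exact le_antisymm h6 (hs1 y)
            · linarith
          · rw [h] at hk'
            rcases max_choice (s y) (k * gaugeFrom a r w) with h' | h'
            · rw [h'] at hk'; exact hk'
            · rw [h'] at hk'; linarith
        rw [h1, this]
      · rintro rfl
        refine hback _ hsy.ne' ?_
        rw [shrinkFactor, (hpt _).1, (hpt _).2, gaugeFrom_smul hsy.le,
          max_eq_left (by nlinarith), min_eq_right (hs1 y)]
    rw [this]
    exact isConnected_singleton
  · have : expansion H a r s ⁻¹' {y} = (fun t : ℝ => y + (t - 1) • (w : F)) '' Icc (s y) 1 := by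
      ext x
      rw [mem_preimage, mem_singleton_iff, mem_image]
      constructor
      · intro hx
        obtain ⟨h1, h2, h3⟩ := hfib x hx
        refine ⟨shrinkFactor H a r s x, ⟨?_, shrinkFactor_le_one x⟩, h1.symm⟩
        rw [← h2]
        exact le_min (hs1 x) (le_max_left _ _)
      · rintro ⟨t, ht, rfl⟩
        have ht0 : 0 < t := hsy.trans_le ht.1
        refine hback t ht0.ne' ?_
        rw [shrinkFactor, (hpt _).1, (hpt _).2, gaugeFrom_smul ht0.le, hg, mul_one,
          max_eq_right ht.1, min_eq_right ht.2]
    rw [this]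
    exact (isConnected_Icc (hs1 y)).image _ (by fun_prop)
  · have : expansion H a r s ⁻¹' {y} = {y} := by
      ext x
      rw [mem_preimage, mem_singleton_iff, mem_singleton_iff]
      constructor
      · intro hx
        by_cases h1 : gaugeFrom a r (π x - a) ≤ 1
        · have := gauge_expansion_le_one hσ0 hσ hs1 h1
          rw [hx] at this
          linarith
        · rw [← hx, expansion_eq_self_of_one_le x (le_max_of_le_right (not_le.1 h1).le)]
      · rintro rfl
        exact expansion_eq_self_of_one_le x (le_max_of_le_right hg.le)
    rw [this]
    exact isConnected_singleton

end Expansion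

/-! ### Radial projection to the sphere and to the wall. -/

section Sphere

variable {H : Type*} [NormedAddCommGroup H] [InnerProductSpace ℝ H]

theorem norm_sub_inner_smul_le {u : H} (hu : ‖u‖ = 1) (v : H) : ‖v - ⟪u, v⟫ • u‖ ≤ ‖v‖ := by
  have h : ‖v - ⟪u, v⟫ • u‖ ^ 2 = ‖v‖ ^ 2 - ⟪u, v⟫ ^ 2 := by
    rw [norm_sub_sq_real, inner_smul_right, norm_smul, hu, real_inner_comm, Real.norm_eq_abs,
      mul_one, sq_abs]
    ring
  exact abs_le_of_sq_le_sq' (by nlinarith [sq_nonneg ⟪u, v⟫]) (norm_nonneg _) |>.2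

/-- Two unit vectors in the same cap about `u` are no farther apart than thrice their projections
along `u`. -/
theorem norm_sub_le_of_inner_half {u p q : H} (hu : ‖u‖ = 1) (hp : ‖p‖ = 1) (hq : ‖q‖ = 1)
    (hup : 1 / 2 ≤ ⟪u, p⟫) (huq : 1 / 2 ≤ ⟪u, q⟫) :
    ‖p - q‖ ≤ 3 * ‖(p - ⟪u, p⟫ • u) - (q - ⟪u, q⟫ • u)‖ := by
  have hsq : ∀ v : H, ‖v - ⟪u, v⟫ • u‖ ^ 2 = ‖v‖ ^ 2 - ⟪u, v⟫ ^ 2 := fun v => by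
    rw [norm_sub_sq_real, inner_smul_right, norm_smul, hu, real_inner_comm, Real.norm_eq_abs,
      mul_one, sq_abs]
    ring
  set P := p - ⟪u, p⟫ • u with hP
  set Q := q - ⟪u, q⟫ • u with hQ
  have hP2 : ‖P‖ ^ 2 = 1 - ⟪u, p⟫ ^ 2 := by rw [hP, hsq, hp]; ring
  have hQ2 : ‖Q‖ ^ 2 = 1 - ⟪u, q⟫ ^ 2 := by rw [hQ, hsq, hq]; ring
  have hP1 : ‖P‖ ≤ 1 := hp ▸ norm_sub_inner_smul_le hu p
  have hQ1 : ‖Q‖ ≤ 1 := hq ▸ norm_sub_inner_smul_le hu q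
  have hPQ : |‖P‖ - ‖Q‖| ≤ ‖P - Q‖ := abs_norm_sub_norm_le _ _
  have hdiff : |⟪u, p⟫ - ⟪u, q⟫| ≤ 2 * ‖P - Q‖ := by
    -- Pythagoras for unit vectors. As the two inner products add up to at least one, the component
    -- along `u` is controlled by the transversal one.
    have e : (⟪u, p⟫ - ⟪u, q⟫) * (⟪u, p⟫ + ⟪u, q⟫) = (‖Q‖ - ‖P‖) * (‖Q‖ + ‖P‖) := by nlinarith
    have h1 : |⟪u, p⟫ - ⟪u, q⟫| * (⟪u, p⟫ + ⟪u, q⟫) = |‖Q‖ - ‖P‖| * (‖Q‖ + ‖P‖) := by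
      rw [← abs_of_nonneg (by linarith : 0 ≤ ⟪u, p⟫ + ⟪u, q⟫), ← abs_mul, e, abs_mul,
        abs_of_nonneg (by positivity : 0 ≤ ‖Q‖ + ‖P‖)]
    rw [abs_sub_comm] at hPQ
    have h2 : |‖Q‖ - ‖P‖| * (‖Q‖ + ‖P‖) ≤ ‖P - Q‖ * 2 :=
      mul_le_mul hPQ (by linarith) (by positivity) (norm_nonneg _)
    nlinarith [abs_nonneg (⟪u, p⟫ - ⟪u, q⟫)]
  have e : p - q = (P - Q) + (⟪u, p⟫ - ⟪u, q⟫) • u := by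
    rw [hP, hQ, sub_smul]; abel
  rw [e]
  refine (norm_add_le _ _).trans ?_
  rw [norm_smul, hu, mul_one, Real.norm_eq_abs]
  linarith

/-- The radial projection to the sphere is almost constant in the radial direction. -/
theorem norm_normalize_sub_le {v₀ v w : H} {d : ℝ} (hv₀ : 0 < ‖v₀‖) (hd : 4 * d ≤ ‖v₀‖)
    (hv : ‖v - v₀‖ ≤ d) (hw : ‖w - v₀‖ ≤ d) :
    ‖‖v‖⁻¹ • v - ‖w‖⁻¹ • w‖ ≤ 3 * (‖v‖⁻¹ * ‖(v - w) - ⟪‖v₀‖⁻¹ • v₀, v - w⟫ • ‖v₀‖⁻¹ • v₀‖ +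
      ‖v‖⁻¹ * ‖w‖⁻¹ * (d * ‖v - w‖)) := by
  set u := ‖v₀‖⁻¹ • v₀ with hu
  have hu1 : ‖u‖ = 1 := norm_smul_inv_norm (𝕜 := ℝ) (norm_pos_iff.1 hv₀)
  have hv0 : v₀ = ‖v₀‖ • u := by rw [hu, smul_smul, mul_inv_cancel₀ hv₀.ne', one_smul]
  have hin0 : ⟪u, v₀⟫ = ‖v₀‖ := by
    rw [hu, real_inner_smul_left, real_inner_self_eq_norm_sq]; field_simp
  have hcap : ∀ x : H, ‖x - v₀‖ ≤ d → 0 < ‖x‖ ∧ ‖‖x‖⁻¹ • x‖ = 1 ∧ 1 / 2 ≤ ⟪u, ‖x‖⁻¹ • x⟫ := by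
    intro x hx
    have h1 : ‖v₀‖ ≤ ‖x‖ + ‖x - v₀‖ := by
      calc ‖v₀‖ = ‖x - (x - v₀)‖ := by rw [sub_sub_cancel]
        _ ≤ _ := norm_sub_le _ _
    have h1' : ‖x‖ ≤ ‖v₀‖ + ‖x - v₀‖ := by
      calc ‖x‖ = ‖v₀ + (x - v₀)‖ := by rw [add_sub_cancel]
        _ ≤ _ := norm_add_le _ _
    have h2 : 0 < ‖x‖ := by linarith
    refine ⟨h2, norm_smul_inv_norm (𝕜 := ℝ) (norm_pos_iff.1 h2), ?_⟩
    have h3 : ⟪u, x⟫ = ‖v₀‖ + ⟪u, x - v₀⟫ := by rw [inner_sub_right, hin0]; ring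
    have h4 := (abs_le.1 (abs_real_inner_le_norm u (x - v₀))).1
    rw [hu1, one_mul] at h4
    rw [inner_smul_right, inv_mul_eq_div, le_div_iff₀ h2]
    linarith
  obtain ⟨hvp, hv1, hvh⟩ := hcap v hv
  obtain ⟨hwp, hw1, hwh⟩ := hcap w hw
  refine (norm_sub_le_of_inner_half hu1 hv1 hw1 hvh hwh).trans ?_
  refine mul_le_mul_of_nonneg_left ?_ (by norm_num)
  -- The part of `w` transversal to `v₀` is at most `d`, so the variation of the length contributes
  -- only at second order.
  have hR : ‖w - ⟪u, w⟫ • u‖ ≤ d := by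
    have : w - ⟪u, w⟫ • u = (w - v₀) - ⟪u, w - v₀⟫ • u := by
      rw [inner_sub_right, hin0, sub_smul, ← hv0]; abel
    rw [this]
    exact (norm_sub_inner_smul_le hu1 _).trans hw
  have e : (‖v‖⁻¹ • v - ⟪u, ‖v‖⁻¹ • v⟫ • u) - (‖w‖⁻¹ • w - ⟪u, ‖w‖⁻¹ • w⟫ • u) =
      ‖v‖⁻¹ • ((v - w) - ⟪u, v - w⟫ • u) + (‖v‖⁻¹ - ‖w‖⁻¹) • (w - ⟪u, w⟫ • u) := by
    simp only [inner_smul_right, inner_sub_right]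
    module
  rw [e]
  refine (norm_add_le _ _).trans ?_
  rw [norm_smul, norm_smul, norm_inv, norm_norm]
  refine add_le_add_right ?_ _
  have hinv : ‖‖v‖⁻¹ - ‖w‖⁻¹‖ ≤ ‖v‖⁻¹ * ‖w‖⁻¹ * ‖v - w‖ := by
    have : ‖v‖⁻¹ - ‖w‖⁻¹ = ‖v‖⁻¹ * ‖w‖⁻¹ * (‖w‖ - ‖v‖) := by field_simp
    rw [this, norm_mul, Real.norm_of_nonneg (by positivity), Real.norm_eq_abs]
    gcongr
    rw [norm_sub_rev]; exact abs_norm_sub_norm_le _ _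
  calc ‖‖v‖⁻¹ - ‖w‖⁻¹‖ * ‖w - ⟪u, w⟫ • u‖ ≤ (‖v‖⁻¹ * ‖w‖⁻¹ * ‖v - w‖) * d := by gcongr
    _ = _ := by ring

/-- The map onto the boundary of the ball along rays from `a` is Lipschitz on the unit sphere. -/
theorem norm_div_gauge_sub_le {a : H} {r c : ℝ} (hc : 0 < c) (ha : ‖a‖ + c ≤ r) {v w : H}
    (hv : v ≠ 0) (hw : w ≠ 0) :
    ‖(gaugeFrom a r v)⁻¹ • v - (gaugeFrom a r w)⁻¹ • w‖ ≤
      (2 + 4 * r / c) * r * ‖‖v‖⁻¹ • v - ‖w‖⁻¹ • w‖ := by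
  have hr : 0 < r := by linarith [norm_nonneg a]
  have hunit : ∀ x : H, x ≠ 0 → ‖‖x‖⁻¹ • x‖ = 1 ∧ (2 * r)⁻¹ ≤ gaugeFrom a r (‖x‖⁻¹ • x) ∧
      (gaugeFrom a r x)⁻¹ • x = (gaugeFrom a r (‖x‖⁻¹ • x))⁻¹ • (‖x‖⁻¹ • x) := by
    intro x hx
    have h1 : ‖‖x‖⁻¹ • x‖ = 1 := norm_smul_inv_norm (𝕜 := ℝ) hx
    have hx0 := norm_pos_iff.2 hx
    refine ⟨h1, ?_, ?_⟩
    · have := norm_le_mul_gaugeFrom hc ha (‖x‖⁻¹ • x)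
      rw [h1] at this
      rw [inv_le_iff_one_le_mul₀ (by positivity), mul_comm]
      exact this
    · rw [gaugeFrom_smul (by positivity), smul_smul]
      congr 1
      have := (gaugeFrom_pos hc ha hx).ne'
      field_simp
  obtain ⟨hv1, hvg, hve⟩ := hunit v hv
  obtain ⟨hw1, hwg, hwe⟩ := hunit w hw
  rw [hve, hwe]
  set p := ‖v‖⁻¹ • v
  set q := ‖w‖⁻¹ • w
  have hgp : 0 < gaugeFrom a r p := (by positivity : 0 < (2 * r)⁻¹).trans_le hvg
  have hgq : 0 < gaugeFrom a r q := (by positivity : 0 < (2 * r)⁻¹).trans_le hwg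
  have hip : (gaugeFrom a r p)⁻¹ ≤ 2 * r := inv_le_of_inv_le₀ (by positivity) hvg
  have hiq : (gaugeFrom a r q)⁻¹ ≤ 2 * r := inv_le_of_inv_le₀ (by positivity) hwg
  have e : (gaugeFrom a r p)⁻¹ • p - (gaugeFrom a r q)⁻¹ • q =
      (gaugeFrom a r p)⁻¹ • (p - q) + ((gaugeFrom a r p)⁻¹ - (gaugeFrom a r q)⁻¹) • q := by
    simp only [smul_sub, sub_smul]; abel
  have hdiff : ‖(gaugeFrom a r p)⁻¹ - (gaugeFrom a r q)⁻¹‖ ≤ 2 * r * (2 * r) * (c⁻¹ * ‖p - q‖) := by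
    have : (gaugeFrom a r p)⁻¹ - (gaugeFrom a r q)⁻¹ =
        (gaugeFrom a r p)⁻¹ * (gaugeFrom a r q)⁻¹ * (gaugeFrom a r q - gaugeFrom a r p) := by
      field_simp
    rw [this, norm_mul, Real.norm_of_nonneg (by positivity), Real.norm_eq_abs, abs_sub_comm]
    gcongr
    exact abs_gaugeFrom_sub_le hc ha p q
  rw [e]
  refine (norm_add_le _ _).trans ?_
  rw [norm_smul, norm_smul, hw1, mul_one, Real.norm_of_nonneg (by positivity)]
  calc _ ≤ 2 * r * ‖p - q‖ + 2 * r * (2 * r) * (c⁻¹ * ‖p - q‖) := by gcongr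
    _ = _ := by field_simp; ring

end Sphere

theorem one_add_pow_le {u : ℝ} (h0 : 0 ≤ u) (h1 : u ≤ 1) (n : ℕ) :
    (1 + u) ^ n ≤ 1 + 2 ^ n * u := by
  have : (1 + u) ^ n ≤ 1 + (2 ^ n - 1) * u := by
    induction n with
    | zero => simp
    | succ n ih =>
      have h2 : (1 : ℝ) ≤ 2 ^ n := one_le_pow₀ (by norm_num)
      calc (1 + u) ^ (n + 1) = (1 + u) ^ n * (1 + u) := pow_succ _ _
        _ ≤ (1 + (2 ^ n - 1) * u) * (1 + u) := by gcongr
        _ ≤ _ := by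
          rw [pow_succ]
          nlinarith [mul_nonneg (sub_nonneg.2 h2) (mul_nonneg h0 (sub_nonneg.2 h1))]
  linarith

/-! ### Lipschitz bounds on almost flat pieces. -/

section Pieces

variable {F : Type*} [NormedAddCommGroup F] [InnerProductSpace ℝ F] [FiniteDimensional ℝ F]

variable {H S : Submodule ℝ F} {a : H} {r c ℓ σ ε d : ℝ} {s : F → ℝ} {B : Set F}

local notation "π" => Submodule.orthogonalProjectionOnto H

theorem norm_sub_proj_le_of_flat {z : F} (h : ‖z - S.starProjection z‖ ≤ ε * ‖z‖) :
    ‖z - (π z : F)‖ ≤ (‖S.starProjection - H.starProjection‖ + ε) * ‖z‖ := by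
  have e : z - (π z : F) = (z - S.starProjection z) +
      (S.starProjection - H.starProjection) z := by
    rw [sub_apply, Submodule.starProjection_apply H]
    abel
  rw [e]
  refine (norm_add_le _ _).trans ?_
  have := (S.starProjection - H.starProjection).le_opNorm z
  linarith

theorem sub_proj_sub (x y : F) :
    (x - (π x : F)) - (y - (π y : F)) = (x - y) - (π (x - y) : F) := by
  rw [map_sub, Submodule.coe_sub]; abel

theorem dist_expansion_le_of_const (hσ0 : 0 < σ) (hs1 : ∀ x, s x ≤ 1) {x y : F}
    (hx : s x = σ) (hy : s y = σ) (hgx : gaugeFrom a r (π x - a) ≤ σ)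
    (hgy : gaugeFrom a r (π y - a) ≤ σ) :
    dist (expansion H a r s x) (expansion H a r s y) ≤ σ⁻¹ * dist x y := by
  rw [expansion_of_gauge_le hs1 (hx ▸ hgx), expansion_of_gauge_le hs1 (hy ▸ hgy), hx, hy,
    dist_eq_norm, dist_eq_norm]
  have e : x + (σ⁻¹ - 1) • ((π x - a : H) : F) - (y + (σ⁻¹ - 1) • ((π y - a : H) : F)) =
      (x - y) + (σ⁻¹ - 1) • ((π x - π y : H) : F) := by
    simp only [Submodule.coe_sub]; module
  have h1 : 1 ≤ σ⁻¹ := (one_le_inv₀ hσ0).2 (hx ▸ hs1 x)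
  rw [e]
  refine (norm_add_le _ _).trans ?_
  rw [norm_smul, ← Submodule.coe_norm, Real.norm_of_nonneg (by linarith)]
  have := mul_le_mul_of_nonneg_left (norm_proj_sub_le (H := H) x y) (sub_nonneg.2 h1)
  linarith

/-- Points of an almost horizontal piece differ in height by at most `t` times their distance, so
the variation of `s` enters only through `ℓ * t`. In the core `‖π y - a‖ ≤ 2 * r * s y`, which
cancels one of the two reciprocals of `s`. -/
theorem dist_expansion_le_of_gauge_le (hc : 0 < c) (ha : ‖a‖ + c ≤ r) (hs0 : ∀ x, 0 < s x)
    (hs1 : ∀ x, s x ≤ 1) (hℓ : 0 ≤ ℓ)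
    (hs : ∀ x y, |s x - s y| ≤ ℓ * ‖(x - (π x : F)) - (y - (π y : F))‖) {t : ℝ} {x y : F}
    (hgx : gaugeFrom a r (π x - a) ≤ s x) (hgy : gaugeFrom a r (π y - a) ≤ s y)
    (ht : ‖(x - y) - (π (x - y) : F)‖ ≤ t * ‖x - y‖) :
    dist (expansion H a r s x) (expansion H a r s y) ≤
      (s x)⁻¹ * (1 + 2 * r * ℓ * t) * dist x y := by
  have hr : 0 < r := by linarith [norm_nonneg a]
  rw [expansion_of_gauge_le hs1 hgx, expansion_of_gauge_le hs1 hgy, dist_eq_norm, dist_eq_norm]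
  have e : x + ((s x)⁻¹ - 1) • ((π x - a : H) : F) - (y + ((s y)⁻¹ - 1) • ((π y - a : H) : F)) =
      (x - y) + ((s x)⁻¹ - 1) • ((π x - π y : H) : F) +
        ((s x)⁻¹ - (s y)⁻¹) • ((π y - a : H) : F) := by
    simp only [Submodule.coe_sub]; module
  have h1 : 1 ≤ (s x)⁻¹ := (one_le_inv₀ (hs0 x)).2 (hs1 x)
  rw [e]
  refine (norm_add_le _ _).trans ?_
  have h2 : ‖(x - y) + ((s x)⁻¹ - 1) • ((π x - π y : H) : F)‖ ≤ (s x)⁻¹ * ‖x - y‖ := by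
    refine (norm_add_le _ _).trans ?_
    rw [norm_smul, ← Submodule.coe_norm, Real.norm_of_nonneg (by linarith)]
    have := mul_le_mul_of_nonneg_left (norm_proj_sub_le (H := H) x y) (sub_nonneg.2 h1)
    linarith
  have h3 : ‖((s x)⁻¹ - (s y)⁻¹) • ((π y - a : H) : F)‖ ≤
      (s x)⁻¹ * (2 * r * ℓ * t) * ‖x - y‖ := by
    rw [norm_smul, ← Submodule.coe_norm]
    have h4 : (s x)⁻¹ - (s y)⁻¹ = (s x)⁻¹ * (s y)⁻¹ * (s y - s x) := by
      have := (hs0 x).ne'; have := (hs0 y).ne'; field_simp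
    have h5 : ‖π y - a‖ ≤ 2 * r * s y := (norm_le_mul_gaugeFrom hc ha _).trans (by gcongr)
    have h6 : |s y - s x| ≤ ℓ * (t * ‖x - y‖) := by
      rw [abs_sub_comm]
      refine (hs x y).trans ?_
      rw [sub_proj_sub]
      gcongr
    have := hs0 x; have := hs0 y
    rw [h4, norm_mul, Real.norm_of_nonneg (by positivity), Real.norm_eq_abs]
    have h7 := (abs_nonneg _).trans h6
    calc _ ≤ (s x)⁻¹ * (s y)⁻¹ * (ℓ * (t * ‖x - y‖)) * (2 * r * s y) :=
          mul_le_mul (mul_le_mul_of_nonneg_left h6 (by positivity)) h5 (norm_nonneg _)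
            (mul_nonneg (by positivity) h7)
      _ = _ := by field_simp
  calc _ ≤ (s x)⁻¹ * ‖x - y‖ + (s x)⁻¹ * (2 * r * ℓ * t) * ‖x - y‖ := add_le_add h2 h3
    _ = _ := by ring

/-- A direction of `S` whose horizontal part is parallel to `u`. -/
theorem exists_unit_mem_radial {m : ℕ} (hS : finrank ℝ S = m + 1) (hH : finrank ℝ H = m + 1)
    {u : H} (hu : ‖u‖ = 1) :
    ∃ h : S, ‖h‖ = 1 ∧ π (h : F) - ⟪u, π (h : F)⟫ • u = 0 := by
  have hu0 : u ≠ 0 := by rintro rfl; simp at hu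
  have hfin : finrank ℝ (ℝ ∙ u)ᗮ = m := by
    have : Fact (finrank ℝ H = m + 1) := ⟨hH⟩
    exact Submodule.finrank_orthogonal_span_singleton hu0
  let P : S →ₗ[ℝ] (ℝ ∙ u)ᗮ :=
    ((ℝ ∙ u)ᗮ.orthogonalProjectionOnto.toLinearMap ∘ₗ
      (Submodule.orthogonalProjectionOnto H).toLinearMap) ∘ₗ S.subtype
  -- `P` goes from dimension `m + 1` to the `m`-dimensional complement of `u`, so some direction of
  -- `S` has no transversal horizontal part.
  have hker : LinearMap.ker P ≠ ⊥ := LinearMap.ker_ne_bot_of_finrank_lt (by rw [hfin, hS]; omega)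
  obtain ⟨h, hh, h0⟩ := Submodule.exists_mem_ne_zero_of_ne_bot hker
  have hP : (ℝ ∙ u)ᗮ.starProjection (π (h : F)) = 0 := by
    have : P h = 0 := hh
    exact congrArg (fun z : (ℝ ∙ u)ᗮ => (z : H)) this
  have hP' : π (h : F) - ⟪u, π (h : F)⟫ • u = 0 := by
    rw [Submodule.starProjection_orthogonal_val, Submodule.starProjection_unit_singleton ℝ hu] at hP
    exact hP
  refine ⟨‖h‖⁻¹ • h, norm_smul_inv_norm (𝕜 := ℝ) h0, ?_⟩
  rw [Submodule.coe_smul, map_smul, inner_smul_right, mul_smul, ← smul_sub, hP', smul_zero]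

end Pieces

/-! ### Area of the images of almost flat pieces. -/

section Measure

variable {F : Type*} [NormedAddCommGroup F] [InnerProductSpace ℝ F] [FiniteDimensional ℝ F]
  [MeasurableSpace F] [BorelSpace F]

variable {H S : Submodule ℝ F} {a : H} {r c ℓ σ ε d : ℝ} {s : F → ℝ} {B : Set F}

local notation "π" => Submodule.orthogonalProjectionOnto H

/-- Area of the image of an almost flat piece that is pushed into the wall. -/
theorem measure_image_expansion_wall_le {m : ℕ} (hS : finrank ℝ S = m + 1)
    (hH : finrank ℝ H = m + 1)
    (hc : 0 < c) (ha : ‖a‖ + c ≤ r) {b e : ℝ} (hb : 0 < b) (he : e ≤ 1) (hε : 0 ≤ ε)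
    (hε' : ε ≤ 1 / 2)
    (hd : 0 ≤ d) (hdb : 4 * d ≤ b)
    (hsmall : ε + 6 * (2 + 4 * r / c) * (r / b) * ε + 12 * (2 + 4 * r / c) * (r / b) * (d / b) ≤ e)
    (hdiam : ∀ x ∈ B, ∀ y ∈ B, ‖x - y‖ ≤ d)
    (hflat : ∀ x ∈ B, ∀ y ∈ B, ‖(x - y) - S.starProjection (x - y)‖ ≤ ε * ‖x - y‖)
    (hlow : ∀ x ∈ B, b ≤ ‖π x - a‖)
    (hg : ∀ x ∈ B, s x ≤ gaugeFrom a r (π x - a)) (hg1 : ∀ x ∈ B, gaugeFrom a r (π x - a) ≤ 1)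
    {w : F} (hw : w ∈ B) :
    μHE[m + 1] (expansion H a r s '' B) ≤ ENNReal.ofReal
      (2 ^ (m + 1) * ((6 * (2 + 4 * r / c) + 16) * (r / ‖π w - a‖)) ^ m *
        (2 * (‖S.starProjection - H.starProjection‖ + e))) * μHE[m + 1] B := by
  have hr : 0 < r := by linarith [norm_nonneg a]
  set CP := 2 + 4 * r / c with hCP
  have hCP0 : 0 < CP := by positivity
  set v₀ := π w - a with hv₀
  have hv0 : b ≤ ‖v₀‖ := hlow w hw
  have hv0p : 0 < ‖v₀‖ := hb.trans_le hv0
  set κ := r / ‖v₀‖ with hκ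
  have hκb : κ ≤ r / b := by rw [hκ]; gcongr
  have hκ0 : 0 < κ := by positivity
  have hκ2 : 1 ≤ 2 * κ := by
    rw [hκ, ← mul_div_assoc, one_le_div hv0p]
    refine (norm_le_mul_gaugeFrom hc ha v₀).trans ?_
    have := hg1 w hw
    nlinarith
  set τ := ‖S.starProjection - H.starProjection‖ with hτ
  have hτ0 : 0 ≤ τ := norm_nonneg _
  have hτ2 : τ ≤ 2 := by
    refine (norm_sub_le _ _).trans ?_
    linarith [S.starProjection_norm_le, H.starProjection_norm_le]
  set u := ‖v₀‖⁻¹ • v₀ with hu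
  have hu1 : ‖u‖ = 1 := norm_smul_inv_norm (𝕜 := ℝ) (norm_pos_iff.1 hv0p)
  obtain ⟨h, hh1, hh0⟩ := exists_unit_mem_radial (H := H) hS hH hu1
  have he0 : 0 ≤ e := by
    refine le_trans ?_ hsmall
    positivity
  set Tt := τ + e with hTt
  have hTt0 : 0 ≤ Tt := by positivity
  have hTt3 : Tt ≤ 3 := by linarith
  -- The horizontal part of `h` is radial, and the projection to the wall collapses the radial
  -- direction. Hence only the tilt and the small errors survive along `h`, while the other
  -- directions are stretched by a multiple of `r / ‖v₀‖`.
  refine euclideanHausdorffMeasure_image_le_of_stretch (V := S) hS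
    (p := fun x => S.orthogonalProjectionOnto x) (h := h) hh1
    (κ := (6 * CP + 16) * κ) (τ := 2 * Tt) (by positivity) (by positivity) ?_ ?_
  · intro x _ y _
    rw [dist_eq_norm, dist_eq_norm]
    exact norm_proj_sub_le x y
  intro x hx y hy
  set q := S.orthogonalProjectionOnto x - S.orthogonalProjectionOnto y with hq
  have hqc : (q : F) = S.starProjection (x - y) := by
    rw [hq, ← map_sub]; rfl
  set z := x - y with hz
  have hzq : ‖z - (q : F)‖ ≤ ε * ‖z‖ := by rw [hqc]; exact hflat x hx y hy
  set p := q - ⟪h, q⟫ • h with hp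
  have hzn : ‖z‖ ≤ 2 * (‖p‖ + |⟪h, q⟫|) := by
    have h1 : ‖z‖ ≤ ‖z - (q : F)‖ + ‖(q : F)‖ := by
      calc ‖z‖ = ‖(z - (q : F)) + (q : F)‖ := by rw [sub_add_cancel]
        _ ≤ _ := norm_add_le _ _
    have h2 : ‖(q : F)‖ ≤ ‖p‖ + |⟪h, q⟫| := by
      rw [← Submodule.coe_norm]
      calc ‖q‖ = ‖p + ⟪h, q⟫ • h‖ := by rw [hp, sub_add_cancel]
        _ ≤ ‖p‖ + ‖⟪h, q⟫ • h‖ := norm_add_le _ _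
        _ = _ := by rw [norm_smul, hh1, mul_one, Real.norm_eq_abs]
    nlinarith [norm_nonneg z]
  -- the radial projection of the horizontal part
  have hrad : ‖π z - ⟪u, π z⟫ • u‖ ≤ ‖p‖ + ε * ‖z‖ := by
    have e1 : π z - ⟪u, π z⟫ • u =
        (π (z - (q : F)) - ⟪u, π (z - (q : F))⟫ • u) + (π (p : F) - ⟪u, π (p : F)⟫ • u) := by
      have e2 : (z : F) = (z - (q : F)) + ((p : F) + ⟪h, q⟫ • (h : F)) := by
        have : (p : F) = (q : F) - ⟪h, q⟫ • (h : F) := rfl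
        rw [this]; abel
      have e3 : π z = π (z - (q : F)) + (π (p : F) + ⟪h, q⟫ • π (h : F)) := by
        conv_lhs => rw [e2]
        rw [map_add, map_add, map_smul]
      have e4 : π (h : F) = ⟪u, π (h : F)⟫ • u := sub_eq_zero.1 hh0
      rw [e3, inner_add_right, inner_add_right, inner_smul_right]
      have e5 : ⟪h, q⟫ • π (h : F) = (⟪h, q⟫ * ⟪u, π (h : F)⟫) • u := by
        rw [mul_smul, ← e4]
      rw [e5]
      module
    rw [e1]
    refine (norm_add_le _ _).trans ?_
    have i1 := (norm_sub_inner_smul_le hu1 (π (z - (q : F)))).trans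
      ((Submodule.norm_orthogonalProjectionOnto_apply_le _ _).trans hzq)
    have i2 := (norm_sub_inner_smul_le hu1 (π (p : F))).trans
      (Submodule.norm_orthogonalProjectionOnto_apply_le _ _)
    rw [← Submodule.coe_norm] at i2
    linarith
  have hvx : ∀ x ∈ B, ‖(π x - a) - v₀‖ ≤ d := fun x hx => by
    rw [hv₀, sub_sub_sub_cancel_right]
    exact (norm_proj_sub_le x w).trans (hdiam x hx w hw)
  have hinv : ∀ x ∈ B, ‖π x - a‖⁻¹ ≤ 2 * ‖v₀‖⁻¹ := fun x hx => by
    have h1 : ‖v₀‖ ≤ ‖π x - a‖ + d := by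
      have := norm_sub_norm_le v₀ (π x - a)
      have h2 := hvx x hx
      rw [norm_sub_rev (π x - a) v₀] at h2
      linarith
    have h2 : ‖v₀‖ / 2 ≤ ‖π x - a‖ := by linarith
    calc ‖π x - a‖⁻¹ ≤ (‖v₀‖ / 2)⁻¹ := inv_anti₀ (by positivity) h2
      _ = _ := by rw [inv_div]; ring
  have hxne : π x - a ≠ 0 := norm_pos_iff.1 (hb.trans_le (hlow x hx))
  have hyne : π y - a ≠ 0 := norm_pos_iff.1 (hb.trans_le (hlow y hy))
  have hnorm := norm_normalize_sub_le hv0p (hdb.trans hv0) (hvx x hx) (hvx y hy)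
  rw [← hu, sub_sub_sub_cancel_right, ← map_sub, ← hz] at hnorm
  have hπz : ‖π z‖ ≤ ‖z‖ := Submodule.norm_orthogonalProjectionOnto_apply_le _ _
  have hmain : ‖(gaugeFrom a r (π x - a))⁻¹ • (π x - a) - (gaugeFrom a r (π y - a))⁻¹ • (π y - a)‖
      ≤ 6 * CP * κ * ‖p‖ + (6 * CP * κ * ε + 12 * CP * κ * (d / b)) * ‖z‖ := by
    refine (norm_div_gauge_sub_le hc ha hxne hyne).trans ?_
    have i0 : ‖v₀‖⁻¹ ≤ b⁻¹ := inv_anti₀ hb hv0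
    calc CP * r * _ ≤ CP * r * (3 * (2 * ‖v₀‖⁻¹ * (‖p‖ + ε * ‖z‖) +
          2 * ‖v₀‖⁻¹ * (2 * b⁻¹) * (d * ‖z‖))) := by
          refine mul_le_mul_of_nonneg_left (hnorm.trans ?_) (by positivity)
          have i1 := hinv x hx
          have i2 : ‖π y - a‖⁻¹ ≤ 2 * b⁻¹ := (hinv y hy).trans (by linarith)
          gcongr
      _ = _ := by rw [hκ]; field_simp; ring
  have hperp := norm_sub_proj_le_of_flat (H := H) (hflat x hx y hy)
  rw [expansion_of_le_gauge (hg x hx) (hg1 x hx), expansion_of_le_gauge (hg y hy) (hg1 y hy),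
    dist_eq_norm]
  have e1 : x + ((gaugeFrom a r (π x - a))⁻¹ - 1) • ((π x - a : H) : F) -
      (y + ((gaugeFrom a r (π y - a))⁻¹ - 1) • ((π y - a : H) : F)) =
      (z - (π z : F)) + (((gaugeFrom a r (π x - a))⁻¹ • (π x - a) -
        (gaugeFrom a r (π y - a))⁻¹ • (π y - a) : H) : F) := by
    rw [← sub_proj_sub]
    simp only [Submodule.coe_sub, Submodule.coe_smul]; module
  rw [e1]
  refine (norm_add_le _ _).trans ?_
  rw [← Submodule.coe_norm (_ - _ : H)]
  have hTz : (τ + ε) * ‖z‖ + (6 * CP * κ * ε + 12 * CP * κ * (d / b)) * ‖z‖ ≤ Tt * ‖z‖ := by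
    rw [← add_mul]
    refine mul_le_mul_of_nonneg_right ?_ (norm_nonneg _)
    have i1 : 6 * CP * κ * ε ≤ 6 * CP * (r / b) * ε := by gcongr
    have i2 : 12 * CP * κ * (d / b) ≤ 12 * CP * (r / b) * (d / b) := by gcongr
    linarith
  have hTz2 : Tt * ‖z‖ ≤ 2 * Tt * ‖p‖ + 2 * Tt * |⟪h, q⟫| := by
    refine (mul_le_mul_of_nonneg_left hzn hTt0).trans_eq ?_
    ring
  -- Uses `Tt ≤ 3` and `1 ≤ 2 * κ`; this is the origin of the summand `16` in the constant.
  have hTp : 2 * Tt * ‖p‖ ≤ 16 * κ * ‖p‖ := by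
    refine mul_le_mul_of_nonneg_right ?_ (norm_nonneg _)
    linarith
  calc _ ≤ (τ + ε) * ‖z‖ + (6 * CP * κ * ‖p‖ + (6 * CP * κ * ε + 12 * CP * κ * (d / b)) * ‖z‖) :=
        add_le_add hperp hmain
    _ ≤ 6 * CP * κ * ‖p‖ + (2 * Tt * ‖p‖ + 2 * Tt * |⟪h, q⟫|) := by linarith only [hTz, hTz2]
    _ ≤ _ := by linarith only [hTp]

/-- An almost flat piece has little more area than its projection. -/
theorem measure_le_measure_proj_add {m : ℕ} [MeasurableSpace H] [BorelSpace H]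
    (hε : 0 ≤ ε)
    (hflat : ∀ x ∈ B, ∀ y ∈ B, ‖(x - y) - S.starProjection (x - y)‖ ≤ ε * ‖x - y‖) :
    μHE[m] B ≤ μHE[m] ((fun x => π x) '' B) +
      ENNReal.ofReal (2 ^ (m + 1) * (‖S.starProjection - H.starProjection‖ + ε)) * μHE[m] B := by
  set t := ‖S.starProjection - H.starProjection‖ + ε with ht
  have ht0 : 0 ≤ t := by positivity
  -- For larger `t` the second summand alone exceeds the area of `B`.
  by_cases h : t ≤ 1 / 2
  · have h1 : μHE[m] (id '' B) ≤ ENNReal.ofReal ((1 + 2 * t) ^ m) *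
        μHE[m] ((fun x => π x) '' B) := by
      refine euclideanHausdorffMeasure_image_le_image (by positivity) fun x hx y hy => ?_
      rw [dist_eq_norm, dist_eq_norm, id, id, ← map_sub]
      have h2 := norm_sub_proj_le_of_flat (H := H) (hflat x hx y hy)
      rw [← ht] at h2
      have h3 : ‖x - y‖ ≤ ‖(x - y) - (π (x - y) : F)‖ + ‖π (x - y)‖ := by
        rw [Submodule.coe_norm]
        calc ‖x - y‖ = ‖((x - y) - (π (x - y) : F)) + (π (x - y) : F)‖ := by rw [sub_add_cancel]
          _ ≤ _ := norm_add_le _ _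
      have h4 : (1 - t) * ‖x - y‖ ≤ ‖π (x - y)‖ := by linarith
      have h5 : 1 ≤ (1 + 2 * t) * (1 - t) := by nlinarith
      calc ‖x - y‖ ≤ (1 + 2 * t) * (1 - t) * ‖x - y‖ := le_mul_of_one_le_left (norm_nonneg _) h5
        _ = (1 + 2 * t) * ((1 - t) * ‖x - y‖) := by ring
        _ ≤ _ := by gcongr
    rw [image_id] at h1
    have h2 : μHE[m] ((fun x => π x) '' B) ≤ μHE[m] B := by
      have := euclideanHausdorffMeasure_image_le_of_dist_le (d := m) (A := B) (C := 1)
        (f := fun x => π x) zero_le_one fun x _ y _ => by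
          rw [dist_eq_norm, dist_eq_norm, one_mul]; exact norm_proj_sub_le x y
      simpa using this
    have h3 : (1 + 2 * t) ^ m ≤ 1 + 2 ^ (m + 1) * t := by
      refine (one_add_pow_le (by positivity) (by linarith) m).trans_eq ?_
      rw [pow_succ]; ring
    calc μHE[m] B ≤ ENNReal.ofReal (1 + 2 ^ (m + 1) * t) * μHE[m] ((fun x => π x) '' B) :=
          h1.trans (by gcongr)
      _ = μHE[m] ((fun x => π x) '' B) +
          ENNReal.ofReal (2 ^ (m + 1) * t) * μHE[m] ((fun x => π x) '' B) := by
          rw [ENNReal.ofReal_add zero_le_one (by positivity), ENNReal.ofReal_one, add_mul, one_mul]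
      _ ≤ _ := by gcongr
  · refine le_add_left ?_
    conv_lhs => rw [← one_mul (μHE[m] B)]
    gcongr
    rw [ENNReal.one_le_ofReal]
    have : (1 : ℝ) ≤ 2 ^ m := one_le_pow₀ (by norm_num)
    rw [pow_succ]
    nlinarith [not_le.1 h]

/-- As `s` is comparable on `B`, its value at `w` stands for all others. The bound then depends on a
single point and is ready to be integrated. -/
theorem measure_image_expansion_layer_le {m : ℕ}
    (hc : 0 < c) (ha : ‖a‖ + c ≤ r) (hs0 : ∀ x, 0 < s x)
    (hs1 : ∀ x, s x ≤ 1) (hℓ : 0 ≤ ℓ) (hε : 0 ≤ ε)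
    (hs : ∀ x y, |s x - s y| ≤ ℓ * ‖(x - (π x : F)) - (y - (π y : F))‖)
    (hflat : ∀ x ∈ B, ∀ y ∈ B, ‖(x - y) - S.starProjection (x - y)‖ ≤ ε * ‖x - y‖)
    (hg : ∀ x ∈ B, gaugeFrom a r (π x - a) ≤ s x) {w : F} (hw : ∀ x ∈ B, s w ≤ 2 * s x) :
    μHE[m] (expansion H a r s '' B) ≤ ENNReal.ofReal
      ((2 * (s w)⁻¹ * (1 + 2 * r * ℓ * (‖S.starProjection - H.starProjection‖ + ε))) ^ m) *
        μHE[m] B := by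
  have hr : 0 < r := by linarith [norm_nonneg a]
  have hsw := hs0 w
  refine euclideanHausdorffMeasure_image_le_of_dist_le (by positivity) fun x hx y hy => ?_
  refine (dist_expansion_le_of_gauge_le hc ha hs0 hs1 hℓ hs (hg x hx) (hg y hy)
    (norm_sub_proj_le_of_flat (hflat x hx y hy))).trans ?_
  have h1 : (s x)⁻¹ ≤ 2 * (s w)⁻¹ := by
    calc (s x)⁻¹ ≤ (s w / 2)⁻¹ := inv_anti₀ (by positivity) (by linarith [hw x hx])
      _ = _ := by rw [inv_div]; ring
  gcongr

end Measure

/-! ### From bounds on pieces to integrals. -/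

section Integrate

variable {X : Type*} [MeasurableSpace X]

/-- The constant `M / μ B` lies below `φ` at every point of `B`, so it may be integrated. The empty
set needs its own hypothesis, since there `h` says nothing. -/
theorem le_lintegral_of_forall_le_mul {μ : Measure X} {B : Set X} (hB : MeasurableSet B)
    (hfin : μ B ≠ ∞) {φ : X → ℝ≥0∞} {M : ℝ≥0∞} (hne : B = ∅ → M = 0)
    (h : ∀ w ∈ B, M ≤ φ w * μ B) : M ≤ ∫⁻ x in B, φ x ∂μ := by
  rcases B.eq_empty_or_nonempty with h0 | ⟨w, hw⟩
  · simp [hne h0]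
  by_cases hμ : μ B = 0
  · have := h w hw
    rw [hμ, mul_zero] at this
    exact this.trans zero_le
  calc M = M / μ B * μ B := (ENNReal.div_mul_cancel hμ hfin).symm
    _ = ∫⁻ _ in B, M / μ B ∂μ := (setLIntegral_const _ _).symm
    _ ≤ _ := setLIntegral_mono' hB fun x hx => ENNReal.div_le_of_le_mul (h x hx)

/-- Sums the bounds of the pieces, in which the density may be taken at any point of the piece. The
Lipschitz constant serves only to discard the image of the uncovered null set. -/
theorem measure_image_le_lintegral {m : ℕ} {X Z : Type*} [MetricSpace X] [MeasurableSpace X]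
    [BorelSpace X] [MetricSpace Z] [MeasurableSpace Z] [BorelSpace Z] {Γ A : Set X}
    (hA : MeasurableSet A) (hAΓ : A ⊆ Γ) (hfin : μHE[m] A ≠ ∞) {f : X → Z}
    {K : ℝ≥0} (hf : LipschitzWith K f) {B : ℕ → Set X} (hB : ∀ i, MeasurableSet (B i))
    (hdisj : Pairwise (Function.onFun Disjoint B)) (hnull : μHE[m] (Γ \ ⋃ i, B i) = 0)
    {φ : X → ℝ≥0∞}
    (h : ∀ i, ∀ w ∈ B i ∩ A, μHE[m] (f '' (B i ∩ A)) ≤ φ w * μHE[m] (B i ∩ A)) :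
    μHE[m] (f '' A) ≤ ∫⁻ x in A, φ x ∂μHE[m] := by
  have hsub : f '' A ⊆ f '' (Γ \ ⋃ i, B i) ∪ ⋃ i, f '' (B i ∩ A) := by
    rintro _ ⟨x, hx, rfl⟩
    by_cases hxB : x ∈ ⋃ i, B i
    · obtain ⟨i, hi⟩ := mem_iUnion.1 hxB
      exact Or.inr (mem_iUnion.2 ⟨i, x, ⟨hi, hx⟩, rfl⟩)
    · exact Or.inl ⟨x, ⟨hAΓ hx, hxB⟩, rfl⟩
  have h0 : μHE[m] (f '' (Γ \ ⋃ i, B i)) = 0 := by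
    have := euclideanHausdorffMeasure_image_le (d := m) (hf.lipschitzOnWith (s := Γ \ ⋃ i, B i))
    rwa [hnull, mul_zero, nonpos_iff_eq_zero] at this
  calc μHE[m] (f '' A) ≤ μHE[m] (f '' (Γ \ ⋃ i, B i)) + μHE[m] (⋃ i, f '' (B i ∩ A)) :=
        (measure_mono hsub).trans (measure_union_le _ _)
    _ ≤ ∑' i, μHE[m] (f '' (B i ∩ A)) := by rw [h0, zero_add]; exact measure_iUnion_le _
    _ ≤ ∑' i, ∫⁻ x in B i ∩ A, φ x ∂μHE[m] := by
        refine ENNReal.tsum_le_tsum fun i => le_lintegral_of_forall_le_mul ((hB i).inter hA)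
          (measure_ne_top_of_subset inter_subset_right hfin) ?_ (h i)
        intro he
        rw [he, image_empty, measure_empty]
    _ = ∫⁻ x in ⋃ i, B i ∩ A, φ x ∂μHE[m] := by
        rw [lintegral_iUnion (fun i => (hB i).inter hA) fun i k hik =>
          (hdisj hik).mono inter_subset_left inter_subset_left]
    _ ≤ _ := lintegral_mono_set (iUnion_subset fun i => inter_subset_right)

end Integrate

/-! ### Area of the image of the rectifiable set and the number of sheets. -/

section Area

variable {m : ℕ} {Γ A : Set (Euc (m + 1))} {H : Submodule ℝ (Euc (m + 1))} {a : H}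
  {r c ℓ σ e : ℝ} {s τ : Euc (m + 1) → ℝ}

local notation "π" => Submodule.orthogonalProjectionOnto H

/-- Area of the image of the part of `Γ` that is pushed into the wall of the cylinder. -/
theorem measure_image_expansion_le_of_le_gauge (hΓ : MeasurableSet Γ)
    [IsLocallyFiniteMeasure (μHE[m + 1].restrict Γ)] (hrect : IsCountablyRectifiable Γ)
    (hτ : ∀ x, τ x = ‖(approxTangent Γ x).1.starProjection - H.starProjection‖)
    (hH : finrank ℝ H = m + 1)
    (hc : 0 < c) (ha : ‖a‖ + c ≤ r) (hσ0 : 0 < σ) (hσ : ∀ x, σ ≤ s x) (he : 0 < e) (he1 : e ≤ 1)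
    {K : ℝ≥0} (hf : LipschitzWith K (expansion H a r s))
    (hA : MeasurableSet A) (hAΓ : A ⊆ Γ) (hfin : μHE[m + 1] A ≠ ∞)
    (hg : ∀ x ∈ A, s x ≤ gaugeFrom a r (π x - a)) (hg1 : ∀ x ∈ A, gaugeFrom a r (π x - a) ≤ 1) :
    μHE[m + 1] (expansion H a r s '' A) ≤ ∫⁻ x in A, ENNReal.ofReal
      (2 ^ (m + 1) * ((6 * (2 + 4 * r / c) + 16) * (r / ‖π x - a‖)) ^ m *
        (2 * (τ x + e))) ∂μHE[m + 1] := by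
  have hr : 0 < r := by linarith [norm_nonneg a]
  -- Where the gauge is at least `σ`, the horizontal distance to `a` is at least `c * σ`. The
  -- fineness of the partition depends on `b`, hence on `σ`; the resulting bound does not.
  set b := c * σ with hb
  have hb0 : 0 < b := by positivity
  set P := 2 + 4 * r / c with hP
  have hP0 : 0 < P := by positivity
  set M := 1 + 6 * P * (r / b) with hM
  set M' := 12 * P * (r / b) / b with hM'
  have hM0 : 0 < M := by positivity
  have hM'0 : 0 < M' := by positivity
  set ε := min (1 / 2) (e / 2 / M) with hε
  set d := min (b / 4) (e / 2 / M') with hd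
  have hε0 : 0 < ε := by positivity
  have hd0 : 0 < d := by positivity
  have hsmall : ε + 6 * P * (r / b) * ε + 12 * P * (r / b) * (d / b) ≤ e := by
    have h1 : M * ε ≤ e / 2 := by
      calc M * ε ≤ M * (e / 2 / M) := by gcongr; exact min_le_right _ _
        _ = _ := mul_div_cancel₀ _ hM0.ne'
    have h2 : M' * d ≤ e / 2 := by
      calc M' * d ≤ M' * (e / 2 / M') := by gcongr; exact min_le_right _ _
        _ = _ := mul_div_cancel₀ _ hM'0.ne'
    have h3 : ε + 6 * P * (r / b) * ε + 12 * P * (r / b) * (d / b) = M * ε + M' * d := by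
      rw [hM, hM']; ring
    linarith
  obtain ⟨B, hB, hdisj, hBΓ, hnull, hdiam, hflat⟩ :=
    exists_partition_almost_flat hΓ hrect hε0 hd0
  refine measure_image_le_lintegral hA hAΓ hfin hf hB hdisj hnull fun i w hw => ?_
  rw [hτ]
  refine measure_image_expansion_wall_le (S := (approxTangent Γ w).1) (b := b) (ε := ε) (d := d)
    (approxTangent Γ w).2 hH hc ha hb0 he1 hε0.le (min_le_left _ _) hd0.le ?_
    hsmall (fun x hx y hy => hdiam i x hx.1 y hy.1)
    (fun x hx y hy => hflat i x hx.1 y hy.1 w hw.1) ?_ (fun x hx => hg x hx.2)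
    (fun x hx => hg1 x hx.2) hw
  · have := min_le_left (b / 4) (e / 2 / M')
    linarith
  · intro x hx
    refine le_trans ?_ (mul_gaugeFrom_le_norm ha (π x - a))
    rw [hb]
    gcongr
    exact (hσ x).trans (hg x hx.2)

/-- Area of the image of the part of `Γ` that is stretched over the cylinder with a factor that
depends on the height. -/
theorem measure_image_expansion_le_of_gauge_le (hΓ : MeasurableSet Γ)
    [IsLocallyFiniteMeasure (μHE[m + 1].restrict Γ)] (hrect : IsCountablyRectifiable Γ)
    (hτ : ∀ x, τ x = ‖(approxTangent Γ x).1.starProjection - H.starProjection‖)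
    (hc : 0 < c) (ha : ‖a‖ + c ≤ r) (hσ0 : 0 < σ) (hσ : ∀ x, σ ≤ s x) (hs1 : ∀ x, s x ≤ 1)
    (hℓ : 0 ≤ ℓ) (hs : ∀ x y, |s x - s y| ≤ ℓ * ‖(x - (π x : Euc (m + 1))) - (y - (π y : Euc (m + 1)))‖)
    (he : 0 < e) {K : ℝ≥0} (hf : LipschitzWith K (expansion H a r s))
    (hA : MeasurableSet A) (hAΓ : A ⊆ Γ) (hfin : μHE[m + 1] A ≠ ∞)
    (hg : ∀ x ∈ A, gaugeFrom a r (π x - a) ≤ s x) :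
    μHE[m + 1] (expansion H a r s '' A) ≤ ∫⁻ x in A, ENNReal.ofReal
      ((2 * (s x)⁻¹ * (1 + 2 * r * ℓ * (τ x + e))) ^ (m + 1)) ∂μHE[m + 1] := by
  -- On a piece of diameter `d` the function `s` varies by at most `ℓ * d ≤ σ`, hence by no more
  -- than a factor two.
  set d := σ / (ℓ + 1) with hd
  have hd0 : 0 < d := by positivity
  obtain ⟨B, hB, hdisj, hBΓ, hnull, hdiam, hflat⟩ :=
    exists_partition_almost_flat hΓ hrect he hd0
  refine measure_image_le_lintegral hA hAΓ hfin hf hB hdisj hnull fun i w hw => ?_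
  rw [hτ]
  refine measure_image_expansion_layer_le (S := (approxTangent Γ w).1) (ε := e) hc ha
    (fun x => hσ0.trans_le (hσ x)) hs1 hℓ he.le hs
    (fun x hx y hy => hflat i x hx.1 y hy.1 w hw.1) (fun x hx => hg x hx.2) ?_
  intro x hx
  have h1 : |s w - s x| ≤ ℓ * d := (hs w x).trans (by
    gcongr
    exact (norm_proj_sub_proj_le w x).trans (hdiam i w hw.1 x hx.1))
  have h2 : ℓ * d ≤ σ := by
    rw [hd, mul_div_assoc', div_le_iff₀ (by positivity)]
    nlinarith
  have h3 := (abs_le.1 h1).2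
  have h4 := hσ x
  linarith

theorem measure_image_expansion_le_of_const (hσ0 : 0 < σ) (hs1 : ∀ x, s x ≤ 1)
    (hA : ∀ x ∈ A, s x = σ) (hg : ∀ x ∈ A, gaugeFrom a r (π x - a) ≤ σ) :
    μHE[m + 1] (expansion H a r s '' A) ≤ ENNReal.ofReal (σ⁻¹ ^ (m + 1)) * μHE[m + 1] A :=
  euclideanHausdorffMeasure_image_le_of_dist_le (by positivity) fun x hx y hy =>
    dist_expansion_le_of_const hσ0 hs1 (hA x hx) (hA y hy) (hg x hx) (hg y hy)

/-- The number of sheets of `A` over a point of the horizontal plane. -/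
theorem exists_sheet_count (hΓ : MeasurableSet Γ)
    [IsLocallyFiniteMeasure (μHE[m + 1].restrict Γ)] (hrect : IsCountablyRectifiable Γ)
    (hτ : ∀ x, τ x = ‖(approxTangent Γ x).1.starProjection - H.starProjection‖)
    (hH : finrank ℝ H = m + 1) (he : 0 < e) (hA : MeasurableSet A) (hAΓ : A ⊆ Γ) (hfin : μHE[m + 1] A ≠ ∞) :
    ∃ Θ : H → ℝ≥0∞, Measurable Θ ∧ (∀ (k : ℕ) v, Θ v < k + 1 → Θ v ≤ k) ∧
      ∫⁻ v, Θ v ≤ μHE[m + 1] A ∧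
      ∀ Q : Set H, MeasurableSet Q → μHE[m + 1] (A ∩ (fun x => π x) ⁻¹' Q) ≤ (∫⁻ v in Q, Θ v) +
        ∫⁻ x in A ∩ (fun x => π x) ⁻¹' Q, ENNReal.ofReal (2 ^ (m + 2) * (τ x + e))
          ∂μHE[m + 1] := by
  obtain ⟨B, hB, hdisj, hBΓ, hnull, -, hflat⟩ :=
    exists_partition_almost_flat hΓ hrect he one_pos
  have hvol : (μHE[m + 1] : Measure H) = volume :=
    euclideanHausdorffMeasure_eq_volume_of_finrank hH
  have hproj : ∀ D : Set (Euc (m + 1)), volume ((fun x => π x) '' D) ≤ μHE[m + 1] D := fun D => by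
    have := euclideanHausdorffMeasure_image_le_of_dist_le (d := m + 1) (A := D) (C := 1)
      (f := fun x => π x) zero_le_one fun x _ y _ => by
        rw [dist_eq_norm, dist_eq_norm, one_mul]; exact norm_proj_sub_le x y
    rw [← hvol]
    simpa using this
  -- The sheets are counted as shadows of the almost flat pieces; measurable hulls leave their
  -- volumes unchanged. The count is an integer or infinite, which is all the second property says.
  set U : ℕ → Set H := fun i => toMeasurable volume ((fun x => π x) '' (B i ∩ A)) with hU
  have hUm : ∀ i, MeasurableSet (U i) := fun i => measurableSet_toMeasurable _ _
  refine ⟨fun v => ∑' i, (U i).indicator 1 v, ?_, ?_, ?_, ?_⟩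
  · exact Measurable.tsum fun i => measurable_one.indicator (hUm i)
  · intro k v hv
    beta_reduce at hv ⊢
    by_contra hcon
    rw [not_le, ENNReal.tsum_eq_iSup_sum, lt_iSup_iff] at hcon
    obtain ⟨t, ht⟩ := hcon
    have hle := (ENNReal.sum_le_tsum (f := fun i => (U i).indicator (1 : H → ℝ≥0∞) v) t).trans_lt hv
    classical
    have hcard : ∑ i ∈ t, (U i).indicator (1 : H → ℝ≥0∞) v =
        ((t.filter fun i => v ∈ U i).card : ℝ≥0∞) := by
      simp only [indicator_apply, Pi.one_apply, Finset.sum_boole]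
    rw [hcard] at ht hle
    have h1 : k < (t.filter fun i => v ∈ U i).card := by exact_mod_cast ht
    have h2 : (t.filter fun i => v ∈ U i).card < k + 1 := by exact_mod_cast hle
    omega
  · rw [lintegral_tsum fun i => (measurable_one.indicator (hUm i)).aemeasurable]
    calc ∑' i, ∫⁻ v, (U i).indicator 1 v = ∑' i, volume ((fun x => π x) '' (B i ∩ A)) := by
          congr 1; ext i
          rw [lintegral_indicator_one (hUm i), hU, measure_toMeasurable]
      _ ≤ ∑' i, μHE[m + 1] (B i ∩ A) := ENNReal.tsum_le_tsum fun i => hproj _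
      _ = μHE[m + 1] (⋃ i, B i ∩ A) := (measure_iUnion (fun i k hik =>
          (hdisj hik).mono inter_subset_left inter_subset_left) fun i => (hB i).inter hA).symm
      _ ≤ _ := measure_mono (iUnion_subset fun i => inter_subset_right)
  · intro Q hQ
    set A' := A ∩ (fun x => π x) ⁻¹' Q with hA'
    have hA'm : MeasurableSet A' :=
      hA.inter ((Submodule.orthogonalProjectionOnto H).continuous.measurable hQ)
    have hsub : A' ⊆ (Γ \ ⋃ i, B i) ∪ ⋃ i, B i ∩ A' := by
      intro x hx
      by_cases hxB : x ∈ ⋃ i, B i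
      · obtain ⟨i, hi⟩ := mem_iUnion.1 hxB
        exact Or.inr (mem_iUnion.2 ⟨i, hi, hx⟩)
      · exact Or.inl ⟨hAΓ hx.1, hxB⟩
    set φ : Euc (m + 1) → ℝ≥0∞ := fun x => ENNReal.ofReal (2 ^ (m + 2) * (τ x + e)) with hφ
    have hpiece : ∀ i, μHE[m + 1] (B i ∩ A') ≤
        volume (U i ∩ Q) + ∫⁻ x in B i ∩ A', φ x ∂μHE[m + 1] := by
      intro i
      have h1 : volume ((fun x => π x) '' (B i ∩ A')) ≤ volume (U i ∩ Q) := by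
        refine measure_mono ?_
        rintro _ ⟨x, hx, rfl⟩
        exact ⟨subset_toMeasurable _ _ ⟨x, ⟨hx.1, hx.2.1⟩, rfl⟩, hx.2.2⟩
      rw [← tsub_le_iff_left]
      refine le_lintegral_of_forall_le_mul ((hB i).inter hA'm)
        (measure_ne_top_of_subset (inter_subset_right.trans inter_subset_left) hfin) ?_ ?_
      · intro h0
        rw [h0, measure_empty, zero_tsub]
      · intro w hw
        rw [tsub_le_iff_left]
        have h2 := measure_le_measure_proj_add (m := m + 1) (H := H)
          (S := (approxTangent Γ w).1) (B := B i ∩ A') he.le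
          (fun x hx y hy => hflat i x hx.1 y hy.1 w hw.1)
        rw [hvol] at h2
        refine h2.trans ?_
        simp only [hφ, hτ]
        gcongr
    calc μHE[m + 1] A' ≤ μHE[m + 1] (Γ \ ⋃ i, B i) + μHE[m + 1] (⋃ i, B i ∩ A') :=
          (measure_mono hsub).trans (measure_union_le _ _)
      _ ≤ ∑' i, μHE[m + 1] (B i ∩ A') := by rw [hnull, zero_add]; exact measure_iUnion_le _
      _ ≤ ∑' i, (volume (U i ∩ Q) + ∫⁻ x in B i ∩ A', φ x ∂μHE[m + 1]) :=
          ENNReal.tsum_le_tsum hpiece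
      _ = (∑' i, volume (U i ∩ Q)) + ∑' i, ∫⁻ x in B i ∩ A', φ x ∂μHE[m + 1] := ENNReal.tsum_add
      _ ≤ _ := by
          refine add_le_add (le_of_eq ?_) ?_
          · rw [lintegral_tsum fun i => (measurable_one.indicator (hUm i)).aemeasurable]
            congr 1; ext i
            rw [lintegral_indicator_one (hUm i), Measure.restrict_apply (hUm i)]
          · rw [← lintegral_iUnion (fun i => (hB i).inter hA'm) fun i k hik =>
              (hdisj hik).mono inter_subset_left inter_subset_left]
            exact lintegral_mono_set (iUnion_subset fun i => inter_subset_right)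

end Area

/-! ### Centres and scales in the horizontal disc. -/

section Centers

variable {V : Type*} [NormedAddCommGroup V] [InnerProductSpace ℝ V]

/-- The sublevel set is the disc shrunk by the factor `s` towards `a`. -/
theorem gaugeFrom_sub_le_iff {a v : V} {r c s : ℝ} (hc : 0 < c) (ha : ‖a‖ + c ≤ r) (hs : 0 < s) :
    gaugeFrom a r (v - a) ≤ s ↔ ‖v - (1 - s) • a‖ ≤ s * r := by
  have h1 : gaugeFrom a r (v - a) ≤ s ↔ gaugeFrom a r (s⁻¹ • (v - a)) ≤ 1 := by
    rw [gaugeFrom_smul (by positivity), inv_mul_le_iff₀ hs, mul_one]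
  have h2 : a + s⁻¹ • (v - a) = s⁻¹ • (v - (1 - s) • a) := by
    have : a = s⁻¹ • (s • a) := by rw [smul_smul, inv_mul_cancel₀ hs.ne', one_smul]
    conv_lhs => lhs; rw [this]
    rw [← smul_add]
    congr 1
    module
  rw [h1, gaugeFrom_le_one_iff hc ha, h2, norm_smul, norm_inv, Real.norm_of_nonneg hs.le,
    inv_mul_le_iff₀ hs]

variable [FiniteDimensional ℝ V] [MeasurableSpace V] [BorelSpace V]

/-- For `s ≤ 1 / 2`, division by `1 - s` confines `a` to a ball of radius `2 * r * s`; for larger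
`s` the whole disc is already this small. -/
theorem volume_setOf_norm_sub_le {n : ℕ} (hV : finrank ℝ V = n) {r s : ℝ} (hr : 0 < r) (hs : 0 < s)
    (v : V) :
    volume {a : V | ‖a‖ ≤ r ∧ ‖v - (1 - s) • a‖ ≤ s * r} ≤
      ENNReal.ofReal ((2 * r) ^ n * s ^ n) * volume (Metric.ball (0 : V) 1) := by
  have key : ∃ z : V, {a : V | ‖a‖ ≤ r ∧ ‖v - (1 - s) • a‖ ≤ s * r} ⊆
      Metric.closedBall z (2 * r * s) := by
    by_cases h : s ≤ 1 / 2
    · refine ⟨(1 - s)⁻¹ • v, fun a ha => ?_⟩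
      have h1 : 0 < 1 - s := by linarith
      rw [mem_closedBall_iff_norm, norm_sub_rev]
      have : (1 - s)⁻¹ • v - a = (1 - s)⁻¹ • (v - (1 - s) • a) := by
        rw [smul_sub, smul_smul, inv_mul_cancel₀ h1.ne', one_smul]
      rw [this, norm_smul, norm_inv, Real.norm_of_nonneg h1.le, inv_mul_le_iff₀ h1]
      have hm := mul_pos hs hr
      nlinarith [ha.2]
    · refine ⟨0, fun a ha => ?_⟩
      rw [mem_closedBall_zero_iff]
      nlinarith [ha.1]
  obtain ⟨z, hz⟩ := key
  refine (measure_mono hz).trans_eq ?_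
  rw [Measure.addHaar_closedBall _ _ (by positivity), hV, mul_pow]

/-- Dyadic decomposition about `v`: at distance of order `2 ^ (-k) * r` the kernel is of order `2 ^
(k * m)`, on a set of volume of order `2 ^ (-k * (m + 1))`. The sum is geometric because the
dimension exceeds the exponent by one. -/
theorem lintegral_div_norm_pow_le {m : ℕ} (hV : finrank ℝ V = m + 1) {r : ℝ} (hr : 0 < r) {v : V}
    (hv : ‖v‖ ≤ r) :
    ∫⁻ a in Metric.closedBall 0 r, ENNReal.ofReal ((r / ‖v - a‖) ^ m) ≤
      2 * ENNReal.ofReal ((2 * r) ^ (m + 1)) * volume (Metric.ball (0 : V) 1) := by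
  set D : ℕ → Set V := fun k => Metric.closedBall v (2 * r * (1 / 2) ^ k) with hD
  have hpt : ∀ a ∈ Metric.closedBall (0 : V) r, ENNReal.ofReal ((r / ‖v - a‖) ^ m) ≤
      ∑' k, (D k).indicator (fun _ => ENNReal.ofReal (2 ^ (k * m))) a := by
    intro a ha
    rw [mem_closedBall_zero_iff] at ha
    suffices h : ∃ k, a ∈ D k ∧ (r / ‖v - a‖) ^ m ≤ 2 ^ (k * m) by
      obtain ⟨k, hk, hle⟩ := h
      refine le_trans ?_ (ENNReal.le_tsum k)
      rw [indicator_of_mem hk]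
      exact ENNReal.ofReal_le_ofReal hle
    by_cases hva : v = a
    · refine ⟨0, ?_, ?_⟩
      · rw [hD, ← hva]
        exact Metric.mem_closedBall_self (by positivity)
      · rw [hva, sub_self, norm_zero, div_zero, zero_mul, pow_zero]
        exact pow_le_one₀ le_rfl zero_le_one
    · have hn : 0 < ‖v - a‖ := norm_pos_iff.2 (sub_ne_zero.2 hva)
      have hn2 : ‖v - a‖ ≤ 2 * r := (norm_sub_le _ _).trans (by linarith)
      obtain ⟨k, hk1, hk2⟩ := exists_nat_pow_near_of_lt_one
        (x := ‖v - a‖ / (2 * r)) (y := (1 / 2 : ℝ)) (by positivity)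
        ((div_le_one (by positivity)).2 hn2) (by norm_num) (by norm_num)
      refine ⟨k, ?_, ?_⟩
      · rw [div_le_iff₀ (by positivity)] at hk2
        rw [hD, mem_closedBall_iff_norm, norm_sub_rev]
        linarith
      · rw [pow_mul]
        refine pow_le_pow_left₀ (by positivity) ?_ _
        rw [div_le_iff₀ hn]
        rw [lt_div_iff₀ (by positivity), pow_succ] at hk1
        have h2 : (2 : ℝ) ^ k * (1 / 2) ^ k = 1 := by rw [← mul_pow]; norm_num
        calc r = 2 ^ k * ((1 / 2) ^ k * (1 / 2) * (2 * r)) := by linear_combination (-r) * h2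
          _ ≤ _ := by gcongr
  calc _ ≤ ∫⁻ a in Metric.closedBall 0 r,
        ∑' k, (D k).indicator (fun _ => ENNReal.ofReal (2 ^ (k * m))) a :=
        setLIntegral_mono' Metric.isClosed_closedBall.measurableSet hpt
    _ ≤ ∫⁻ a, ∑' k, (D k).indicator (fun _ => ENNReal.ofReal (2 ^ (k * m))) a :=
        setLIntegral_le_lintegral _ _
    _ = ∑' k, ENNReal.ofReal ((2 * r) ^ (m + 1) * (1 / 2) ^ k) *
          volume (Metric.ball (0 : V) 1) := by
        have hDm : ∀ k, MeasurableSet (D k) := fun k => Metric.isClosed_closedBall.measurableSet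
        rw [lintegral_tsum fun k => (measurable_const.indicator (hDm k)).aemeasurable]
        congr 1; ext k
        rw [lintegral_indicator_const (hDm k), Measure.addHaar_closedBall _ _ (by positivity), hV,
          ← mul_assoc, ← ENNReal.ofReal_mul (by positivity)]
        congr 2
        have h2 : (2 : ℝ) ^ (k * m) * (1 / 2) ^ (k * m) = 1 := by rw [← mul_pow]; norm_num
        rw [mul_pow, ← pow_mul (1 / 2 : ℝ), mul_add, mul_one, pow_add (1 / 2 : ℝ) (k * m)]
        linear_combination ((2 * r) ^ (m + 1) * (1 / 2) ^ k) * h2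
    _ = _ := by
        rw [ENNReal.tsum_mul_right, ← ENNReal.ofReal_tsum_of_nonneg (fun k => by positivity)
          (summable_geometric_two.mul_left _), tsum_mul_left, tsum_geometric_two, mul_comm _ (2 : ℝ),
          ENNReal.ofReal_mul zero_le_two, ENNReal.ofReal_ofNat]

/-- Where a summable function is at most `k`, its averages over small balls nearly are, uniformly
up to a set of small measure. -/
theorem exists_uniform_scale {Θ : V → ℝ≥0∞} (hΘ : Measurable Θ) (hfin : ∫⁻ v, Θ v ≠ ∞) {r : ℝ}
    (hr : 0 < r) {k η t : ℝ≥0∞} (hη : η ≠ 0) (hk : k ≠ ∞) {G : Set V}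
    (hG : ∀ a ∈ G, ‖a‖ ≤ r ∧ Θ a ≤ k) (ht : t < volume G) :
    ∃ σ : ℝ, 0 < σ ∧ σ < 1 ∧ ∃ G' ⊆ G, t < volume G' ∧ ∀ a ∈ G',
      ∫⁻ v in Metric.closedBall ((1 - σ) • a) (σ * r), Θ v ≤
        (k + η) * volume (Metric.closedBall ((1 - σ) • a) (σ * r)) := by
  set σ : ℕ → ℝ := fun p => 1 / ((p : ℝ) + 2) with hσ
  have hσ0 : ∀ p, 0 < σ p := fun p => by positivity
  have hσ1 : ∀ p, σ p < 1 := fun p => by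
    rw [hσ, div_lt_one (by positivity)]
    have : (0 : ℝ) ≤ p := Nat.cast_nonneg p
    linarith
  have hlim : Tendsto σ atTop (𝓝 0) := by
    refine squeeze_zero (fun p => (hσ0 p).le) (fun p => ?_) tendsto_one_div_add_atTop_nhds_zero_nat
    simp only [hσ]
    gcongr
    norm_num
  have hlim' : Tendsto (fun p => σ p * r) atTop (𝓝[>] 0) := by
    refine tendsto_nhdsWithin_iff.2 ⟨?_, Eventually.of_forall fun p => mul_pos (hσ0 p) hr⟩
    simpa using hlim.mul_const r
  set W : ℕ → V → Prop := fun p a =>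
    ∫⁻ v in Metric.closedBall ((1 - σ p) • a) (σ p * r), Θ v ≤
        (k + η) * volume (Metric.closedBall ((1 - σ p) • a) (σ p * r)) with hW
  set S : ℕ → Set V := fun P => {a ∈ G | ∀ p ≥ P, W p a} with hS
  have hmono : Monotone S := fun P Q hPQ a ha => ⟨ha.1, fun p hp => ha.2 p (hPQ.trans hp)⟩
  -- The balls contain `a` without being centred there, so the differentiation theorem is used in
  -- its form for doubling measures.
  have hae := (IsUnifLocDoublingMeasure.vitaliFamily (volume : Measure V) 1).ae_tendsto_lintegral_div'
    hΘ hfin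
  have hcov : volume G ≤ volume (⋃ P, S P) := by
    refine measure_mono_ae ?_
    filter_upwards [hae] with a ha haG
    have haG' : a ∈ G := haG
    have h1 := ha.comp (IsUnifLocDoublingMeasure.tendsto_closedBall_filterAt (volume : Measure V)
      (K := 1) (x := a) (fun p => (1 - σ p) • a) (fun p => σ p * r) hlim' (Eventually.of_forall
        fun p => by
          rw [mem_closedBall_iff_norm, sub_smul, one_smul, sub_sub_cancel, norm_smul,
            Real.norm_of_nonneg (hσ0 p).le, one_mul]
          have := (hG a haG').1
          have := hσ0 p
          gcongr))
    have h2 : Θ a < k + η := (hG a haG').2.trans_lt (ENNReal.lt_add_right hk hη)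
    obtain ⟨P, hP⟩ := eventually_atTop.1 (h1.eventually_lt_const h2)
    refine mem_iUnion.2 ⟨P, haG', fun p hp => ?_⟩
    have h3 := (hP p hp).le
    simp only [Function.comp] at h3
    have hpos : 0 < σ p * r := mul_pos (hσ0 p) hr
    rwa [ENNReal.div_le_iff (Metric.measure_closedBall_pos _ _ hpos).ne'
      measure_closedBall_lt_top.ne] at h3
  rw [hmono.measure_iUnion] at hcov
  -- The increasing sets `S P` exhaust almost all of `G`, so one of them already has measure above
  -- `t`, and a single scale serves all its points.
  obtain ⟨P, hP⟩ := lt_iSup_iff.1 (ht.trans_le hcov)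
  exact ⟨σ P, hσ0 P, hσ1 P, S P, fun a ha => ha.1, hP, fun a ha => ha.2 P le_rfl⟩

/-- An integer valued function with small integral is small on a large part of a ball. -/
theorem volume_setOf_le_of_lintegral_lt {n : ℕ} (hV : finrank ℝ V = n) {Θ : V → ℝ≥0∞}
    (hΘ : Measurable Θ) {r δ ζ ω : ℝ} (hr : 0 < r) (hδ1 : δ ≤ 1) (hω0 : 0 < ω)
    (hω : volume (Metric.ball (0 : V) 1) = ENNReal.ofReal ω) {k : ℕ}
    (hζ : ζ ≤ 1) (hneg : 0 ≤ ζ / (k + 1) - n * δ)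
    (hint : ∀ v, Θ v < k + 1 → Θ v ≤ k)
    (hsmall : ∫⁻ v, Θ v ≤ ENNReal.ofReal ((k + 1 - ζ) * (ω * r ^ n))) :
    ENNReal.ofReal ((ζ / (k + 1) - n * δ) * (ω * r ^ n)) ≤
      volume {a ∈ Metric.closedBall (0 : V) ((1 - δ) * r) | Θ a ≤ k} := by
  set U : Set V := {a | (k : ℝ≥0∞) + 1 ≤ Θ a} with hU
  set D := Metric.closedBall (0 : V) ((1 - δ) * r) with hD
  have hcov : D ⊆ {a ∈ D | Θ a ≤ k} ∪ U := fun a ha => by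
    by_cases h : Θ a < k + 1
    · exact Or.inl ⟨ha, hint a h⟩
    · exact Or.inr (not_lt.1 h)
  have hDvol : volume D = ENNReal.ofReal ((1 - δ) ^ n * (ω * r ^ n)) := by
    rw [hD, Measure.addHaar_closedBall _ _ (mul_nonneg (by linarith) hr.le), hV, hω,
      ← ENNReal.ofReal_mul (pow_nonneg (mul_nonneg (by linarith) hr.le) _), mul_pow]
    congr 1; ring
  have hUvol : volume U ≤ ENNReal.ofReal ((1 - ζ / (k + 1)) * (ω * r ^ n)) := by
    -- Markov's inequality bounds the set with at least `k + 1` sheets; Bernoulli's inequality below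
    -- bounds the volume lost near the wall.
    have h1 := (mul_meas_ge_le_lintegral hΘ ((k : ℝ≥0∞) + 1)).trans hsmall
    have h2 : (k : ℝ≥0∞) + 1 = ENNReal.ofReal (k + 1) := by
      rw [ENNReal.ofReal_add (by positivity) zero_le_one, ENNReal.ofReal_natCast,
        ENNReal.ofReal_one]
    rw [mul_comm, ← ENNReal.le_div_iff_mul_le (Or.inl (by simp)) (Or.inl (by finiteness)), h2,
      ← ENNReal.ofReal_div_of_pos (by positivity)] at h1
    rw [hU, h2]
    refine h1.trans_eq ?_
    congr 1
    field_simp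
  have hb : 1 - n * δ ≤ (1 - δ) ^ n := by
    have := one_add_mul_le_pow (a := -δ) (by linarith) n
    rw [← sub_eq_add_neg] at this
    linarith
  have hx : 0 ≤ ω * r ^ n := by positivity
  have h3 : volume D ≤ volume {a ∈ D | Θ a ≤ k} + volume U :=
    (measure_mono hcov).trans (measure_union_le _ _)
  rw [hDvol] at h3
  rw [← ENNReal.add_le_add_iff_right (a := volume U)
    (hUvol.trans_lt ENNReal.ofReal_lt_top).ne]
  refine le_trans ?_ h3
  have h4 : 0 ≤ 1 - ζ / (k + 1) := by
    rw [sub_nonneg, div_le_one (by positivity)]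
    have : (0 : ℝ) ≤ k := Nat.cast_nonneg k
    linarith
  refine (add_le_add le_rfl hUvol).trans ?_
  rw [← ENNReal.ofReal_add (mul_nonneg hneg hx) (mul_nonneg h4 hx), ← add_mul]
  refine ENNReal.ofReal_le_ofReal (mul_le_mul_of_nonneg_right ?_ hx)
  linarith

end Centers

/-- Averaging an integral depending on a parameter. -/
theorem lintegral_lintegral_mul_le {X : Type*} [MeasurableSpace X] {μ : Measure X} [SFinite μ]
    {V : Type*} [MeasurableSpace V] {lam : Measure V} [SFinite lam] {K : V × X → ℝ≥0∞} (hK : Measurable K) {θ : X → ℝ≥0∞}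
    (hθ : AEMeasurable θ μ) {M : ℝ≥0∞} (hM : ∀ᵐ x ∂μ, ∫⁻ a, K (a, x) ∂lam ≤ M) :
    ∫⁻ a, ∫⁻ x, K (a, x) * θ x ∂μ ∂lam ≤ M * ∫⁻ x, θ x ∂μ := by
  have hmeas : AEMeasurable (Function.uncurry fun a x => K (a, x) * θ x) (lam.prod μ) :=
    hK.aemeasurable.mul hθ.comp_snd
  rw [lintegral_lintegral_swap hmeas]
  calc ∫⁻ x, ∫⁻ a, K (a, x) * θ x ∂lam ∂μ = ∫⁻ x, (∫⁻ a, K (a, x) ∂lam) * θ x ∂μ := by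
        congr 1; ext x
        exact lintegral_mul_const _ (hK.comp measurable_prodMk_right)
    _ ≤ ∫⁻ x, M * θ x ∂μ := lintegral_mono_ae (hM.mono fun x hx => by gcongr)
    _ = _ := lintegral_const_mul'' _ hθ

/-! ### Kernels of the core. -/

section Kernels

variable {V X : Type*} [NormedAddCommGroup V] [InnerProductSpace ℝ V]

/-- The weight with which the point `x` counts for the expansion about `a`. -/
noncomputable def coreKernel (n : ℕ) (p : X → V) (r : ℝ) (s : X → ℝ) (z : V × X) : ℝ≥0∞ :=
  {z : V × X | ‖p z.2 - (1 - s z.2) • z.1‖ ≤ s z.2 * r}.indicator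
    (fun z => ENNReal.ofReal ((s z.2)⁻¹ ^ n)) z

variable {n : ℕ} {p : X → V} {r : ℝ} {s : X → ℝ}

theorem coreKernel_of_norm_le {a : V} {x : X} (h : ‖p x - (1 - s x) • a‖ ≤ s x * r) :
    coreKernel n p r s (a, x) = ENNReal.ofReal ((s x)⁻¹ ^ n) :=
  indicator_of_mem (s := {z : V × X | ‖p z.2 - (1 - s z.2) • z.1‖ ≤ s z.2 * r}) h _

variable [MeasurableSpace V] [BorelSpace V] [FiniteDimensional ℝ V]

theorem measurable_coreKernel [MeasurableSpace X] (hp : Measurable p) (hs : Measurable s) :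
    Measurable (coreKernel n p r s) := by
  have h1 : Measurable fun z : V × X => s z.2 := hs.comp measurable_snd
  have h2 : Measurable fun z : V × X => p z.2 := hp.comp measurable_snd
  refine Measurable.indicator (by fun_prop) (measurableSet_le ?_ ?_)
  · exact (h2.sub ((measurable_const.sub h1).smul measurable_fst)).norm
  · exact h1.mul_const r

/-- The weight `s⁻¹ ^ n` cancels the measure, of order `s ^ n`, of the centres whose core contains
`x`. Independence of `s` is what allows the scale to be chosen before the centre. -/
theorem lintegral_coreKernel_le (hV : finrank ℝ V = n) (hr : 0 < r) (hs : ∀ x, 0 < s x) (x : X) :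
    ∫⁻ a in Metric.closedBall 0 r, coreKernel n p r s (a, x) ≤
      ENNReal.ofReal ((2 * r) ^ n) * volume (Metric.ball (0 : V) 1) := by
  set D : Set V := {a | ‖p x - (1 - s x) • a‖ ≤ s x * r} with hD
  have hDm : MeasurableSet D :=
    (isClosed_le (by fun_prop) continuous_const).measurableSet
  have h1 : ∀ a, coreKernel n p r s (a, x) = D.indicator (fun _ => ENNReal.ofReal ((s x)⁻¹ ^ n)) a :=
    fun a => rfl
  simp_rw [h1]
  rw [lintegral_indicator_const hDm, Measure.restrict_apply hDm]
  have h2 : D ∩ Metric.closedBall 0 r = {a : V | ‖a‖ ≤ r ∧ ‖p x - (1 - s x) • a‖ ≤ s x * r} := by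
    ext a
    simp only [hD, mem_inter_iff, mem_ofPred_eq, mem_closedBall_zero_iff]
    tauto
  rw [h2]
  have hsx := hs x
  calc _ ≤ ENNReal.ofReal ((s x)⁻¹ ^ n) * (ENNReal.ofReal ((2 * r) ^ n * s x ^ n) *
        volume (Metric.ball (0 : V) 1)) := by
        gcongr
        exact volume_setOf_norm_sub_le hV hr hsx (p x)
    _ = _ := by
        rw [← mul_assoc, ← ENNReal.ofReal_mul (by positivity)]
        congr 2
        rw [inv_pow]
        field_simp

end Kernels

/-- Only the first moment of the tilt is small, so the power has to be dominated by an affine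
function of `t`; boundedness of `t` allows this. -/
theorem two_mul_one_add_mul_pow_le {A t : ℝ} (hA : 0 ≤ A) (ht : 0 ≤ t) (ht3 : t ≤ 3) (m : ℕ) :
    (2 * (1 + A * t)) ^ (m + 1) ≤ 4 ^ (m + 1) + 4 ^ (m + 1) * (3 * A) ^ (m + 1) * t := by
  have h1 : (1 + A * t) ^ (m + 1) ≤ 2 ^ (m + 1) * (1 + (A * t) ^ (m + 1)) := by
    have hle : 1 + A * t ≤ 2 * max 1 (A * t) := by
      linarith [le_max_left 1 (A * t), le_max_right 1 (A * t)]
    calc (1 + A * t) ^ (m + 1) ≤ (2 * max 1 (A * t)) ^ (m + 1) := by gcongr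
      _ = 2 ^ (m + 1) * max 1 (A * t) ^ (m + 1) := mul_pow _ _ _
      _ ≤ _ := by
        gcongr
        rcases max_choice 1 (A * t) with h | h <;> rw [h]
        · rw [one_pow]; linarith [pow_nonneg (mul_nonneg hA ht) (m + 1)]
        · linarith
  have h2 : (A * t) ^ (m + 1) ≤ (3 * A) ^ (m + 1) * t := by
    have h3 : (t / 3) ^ (m + 1) ≤ t := by
      rw [pow_succ]
      have : (t / 3) ^ m ≤ 1 := pow_le_one₀ (by positivity) (by linarith)
      nlinarith
    calc (A * t) ^ (m + 1) = (3 * A) ^ (m + 1) * (t / 3) ^ (m + 1) := by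
          rw [← mul_pow]; congr 1; ring
      _ ≤ _ := by gcongr
  have h4 : (4 : ℝ) ^ (m + 1) = 2 ^ (m + 1) * 2 ^ (m + 1) := by rw [← mul_pow]; norm_num
  calc (2 * (1 + A * t)) ^ (m + 1) = 2 ^ (m + 1) * (1 + A * t) ^ (m + 1) := mul_pow _ _ _
    _ ≤ 2 ^ (m + 1) * (2 ^ (m + 1) * (1 + (3 * A) ^ (m + 1) * t)) := by
        gcongr
        exact h1.trans (by gcongr)
    _ = _ := by rw [h4]; ring

/-! ### The choice of the centre. -/

section GoodCenter

variable {m : ℕ} {Γ A : Set (Euc (m + 1))} {H : Submodule ℝ (Euc (m + 1))}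
  {r ℓ e ω δ ζ η L lam₁ lam₂ : ℝ} {s₀ τ : Euc (m + 1) → ℝ} {k : ℕ}

local notation "π" => Submodule.orthogonalProjectionOnto H

/-- The constant in front of the tilt in the area estimate. -/
noncomputable def tiltConst (m : ℕ) (δ L : ℝ) : ℝ :=
  2 ^ (m + 2) + 4 ^ (m + 1) * (6 * L) ^ (m + 1) + 2 ^ (m + 2) * (6 * (2 + 4 / δ) + 16) ^ m

set_option maxHeartbeats 2000000 in
/-- A centre and a scale for which the expansion removes a sheet of `A`. -/
theorem exists_expansion_measure_le (hΓ : MeasurableSet Γ)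
    [IsLocallyFiniteMeasure (μHE[m + 1].restrict Γ)] (hrect : IsCountablyRectifiable Γ)
    (hτ : ∀ x, τ x = ‖(approxTangent Γ x).1.starProjection - H.starProjection‖)
    (hτm : AEMeasurable τ (μHE[m + 1].restrict Γ)) (hH : finrank ℝ H = m + 1)
    (hω0 : 0 < ω) (hω : volume (Metric.ball (0 : H) 1) = ENNReal.ofReal ω) (hr : 0 < r)
    (hA : MeasurableSet A) (hAΓ : A ⊆ Γ) (hfin : μHE[m + 1] A ≠ ∞) (hAr : ∀ x ∈ A, ‖π x‖ ≤ r)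
    (hs1 : ∀ x, s₀ x ≤ 1) (hℓ : 0 ≤ ℓ)
    (hs : ∀ x y, |s₀ x - s₀ y| ≤ ℓ * ‖(x - (π x : Euc (m + 1))) - (y - (π y : Euc (m + 1)))‖)
    (hδ : 0 < δ) (hδ1 : δ ≤ 1) (hζ : ζ ≤ 1) (he : 0 < e) (he1 : e ≤ 1) (hη : 0 < η)
    (hg : 0 < ζ / (k + 1) - (m + 1) * δ)
    (hlam₁ : 0 ≤ lam₁) (hlam₂ : 0 ≤ lam₂)
    (hin : μHE[m + 1] (A ∩ {x | s₀ x ≤ 0}) ≤ ENNReal.ofReal ((k + 1 - ζ) * (ω * r ^ (m + 1))))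
    (hlay : μHE[m + 1] (A ∩ {x | 0 < s₀ x}) ≤ ENNReal.ofReal (lam₁ * (ω * r ^ (m + 1))))
    (htilt : ∫⁻ x in A, ENNReal.ofReal (τ x + e) ∂μHE[m + 1] ≤
      ENNReal.ofReal (lam₂ * (ω * r ^ (m + 1))))
    (hL : r * ℓ ≤ L)
    (hsmall : 2 ^ (m + 2) * (4 ^ (m + 1) * lam₁ + tiltConst m δ L * lam₂) <
      η * ((ζ / (k + 1) - (m + 1) * δ) / 2)) :
    ∃ a : H, ∃ σ : ℝ, 0 < σ ∧ σ < 1 ∧ ‖a‖ + δ * r ≤ r ∧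
      μHE[m + 1] (expansion H a r (fun x => max σ (s₀ x)) '' A) ≤
        ENNReal.ofReal ((k + 2 * η) * (ω * r ^ (m + 1))) := by
  set x₀ := ω * r ^ (m + 1) with hx₀
  have hx₀0 : 0 < x₀ := by positivity
  set g := (ζ / (k + 1) - (m + 1) * δ) / 2 with hgdef
  have hg0 : 0 < g := by positivity
  have hL0 : 0 ≤ L := le_trans (by positivity) hL
  have hs₀c : Continuous s₀ := by
    refine (LipschitzWith.of_dist_le_mul (K := ⟨ℓ, hℓ⟩) fun x y => ?_).continuous
    rw [Real.dist_eq, dist_eq_norm]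
    exact (hs x y).trans (mul_le_mul_of_nonneg_left (norm_proj_sub_proj_le x y) hℓ)
  have hτ0 : ∀ x, 0 ≤ τ x := fun x => by rw [hτ]; exact norm_nonneg _
  have hτ2 : ∀ x, τ x ≤ 2 := fun x => by
    rw [hτ]
    refine (norm_sub_le _ _).trans ?_
    linarith [(approxTangent Γ x).1.starProjection_norm_le, H.starProjection_norm_le]
  -- the sheets over the inner part
  set Ain := A ∩ {x | s₀ x ≤ 0} with hAin
  have hAinm : MeasurableSet Ain := hA.inter (measurableSet_le hs₀c.measurable measurable_const)
  obtain ⟨Θ, hΘm, hΘint, hΘle, hΘ⟩ := exists_sheet_count hΓ hrect hτ hH he hAinm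
    (inter_subset_left.trans hAΓ) (measure_ne_top_of_subset inter_subset_left hfin)
  set G : Set H := {a ∈ Metric.closedBall (0 : H) ((1 - δ) * r) | Θ a ≤ k} with hG
  have hGvol : ENNReal.ofReal ((2 * g) * x₀) ≤ volume G := by
    have := volume_setOf_le_of_lintegral_lt hH hΘm hr hδ1 hω0 hω (k := k) hζ (ζ := ζ)
      (by push_cast; exact hg.le) (hΘint k) (hΘle.trans hin)
    refine le_trans (le_of_eq ?_) this
    rw [hgdef, mul_div_cancel₀ _ two_ne_zero]
    push_cast
    rfl
  have hGr : ∀ a ∈ G, ‖a‖ + δ * r ≤ r := fun a ha => by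
    have := mem_closedBall_zero_iff.1 ha.1
    linarith
  -- The scale is fixed here, before the centre. Nothing bounds it from below, so no later constant
  -- may depend on it.
  obtain ⟨σ, hσ0, hσ1, G', hG'G, hG'vol, hG'⟩ := exists_uniform_scale (G := G) hΘm
    (hΘle.trans_lt (hin.trans_lt ENNReal.ofReal_lt_top)).ne hr (k := k) (η := ENNReal.ofReal η)
    (t := ENNReal.ofReal (g * x₀)) (by simpa using hη) (by finiteness)
    (fun a ha => ⟨by linarith [hGr a ha, mul_pos hδ hr], ha.2⟩)
    (lt_of_lt_of_le ((ENNReal.ofReal_lt_ofReal_iff (by positivity)).2 (by nlinarith)) hGvol)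
  set s : Euc (m + 1) → ℝ := fun x => max σ (s₀ x) with hsdef
  have hsc : Continuous s := continuous_const.max hs₀c
  have hsσ : ∀ x, σ ≤ s x := fun x => le_max_left _ _
  have hspos : ∀ x, 0 < s x := fun x => hσ0.trans_le (hsσ x)
  have hsle : ∀ x, s x ≤ 1 := fun x => max_le hσ1.le (hs1 x)
  have hslip : ∀ x y, |s x - s y| ≤
      ℓ * ‖(x - (π x : Euc (m + 1))) - (y - (π y : Euc (m + 1)))‖ := fun x y => by
    refine (abs_max_sub_max_le_max σ (s₀ x) σ (s₀ y)).trans ?_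
    rw [sub_self, abs_zero, max_eq_right (abs_nonneg _)]
    exact hs x y
  -- the error terms
  set p : Euc (m + 1) → H := fun x => π x with hp
  have hpc : Continuous p := (Submodule.orthogonalProjectionOnto H).continuous
  set P := 2 + 4 / δ with hP
  have hP0 : 0 < P := by positivity
  set μ := μHE[m + 1].restrict A with hμ
  have : IsFiniteMeasure μ := ⟨by rw [hμ, Measure.restrict_apply_univ]; exact hfin.lt_top⟩
  have hτμ : AEMeasurable τ μ := hτm.mono_measure (Measure.restrict_mono hAΓ le_rfl)
  -- The three errors: the excess of area over the sheet count in the core, the core within the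
  -- layer, and the part pushed into the wall.
  set θ₁ : Euc (m + 1) → ℝ≥0∞ := fun x => ENNReal.ofReal (2 ^ (m + 2) * (τ x + e)) with hθ₁
  set θ₂ : Euc (m + 1) → ℝ≥0∞ := {x | 0 < s₀ x}.indicator fun x =>
    ENNReal.ofReal ((2 * (1 + 2 * r * ℓ * (τ x + e))) ^ (m + 1)) with hθ₂
  set θ₃ : Euc (m + 1) → ℝ≥0∞ := fun x => ENNReal.ofReal
    (2 ^ (m + 2) * (6 * P + 16) ^ m * (τ x + e)) with hθ₃
  have hθ₁m : AEMeasurable θ₁ μ := by fun_prop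
  have hθ₃m : AEMeasurable θ₃ μ := by fun_prop
  have hlayset : MeasurableSet {x | 0 < s₀ x} := measurableSet_lt measurable_const hs₀c.measurable
  have hθ₂m : AEMeasurable θ₂ μ := AEMeasurable.indicator (by fun_prop) hlayset
  set K₁ := coreKernel (m + 1) p r fun _ => σ with hK₁
  set K₂ := coreKernel (m + 1) p r s with hK₂
  set K₃ : H × Euc (m + 1) → ℝ≥0∞ := fun z => ENNReal.ofReal ((r / ‖p z.2 - z.1‖) ^ m) with hK₃
  have hK₁m : Measurable K₁ := measurable_coreKernel hpc.measurable measurable_const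
  have hK₂m : Measurable K₂ := measurable_coreKernel hpc.measurable hsc.measurable
  have hK₃m : Measurable K₃ := by
    have : Measurable fun z : H × Euc (m + 1) => ‖p z.2 - z.1‖ := by fun_prop
    exact ENNReal.measurable_ofReal.comp ((measurable_const.div this).pow_const m)
  set M := 2 * ENNReal.ofReal ((2 * r) ^ (m + 1)) * ENNReal.ofReal ω with hM
  have hMle : ENNReal.ofReal ((2 * r) ^ (m + 1)) * ENNReal.ofReal ω ≤ M := by
    rw [hM, mul_assoc]
    exact le_mul_of_one_le_left' one_le_two
  set Λ := (volume : Measure H).restrict (Metric.closedBall 0 r) with hΛ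
  have hI₁ : ∫⁻ a, ∫⁻ x, K₁ (a, x) * θ₁ x ∂μ ∂Λ ≤ M * ∫⁻ x, θ₁ x ∂μ :=
    lintegral_lintegral_mul_le hK₁m hθ₁m (Eventually.of_forall fun x =>
      ((lintegral_coreKernel_le hH hr (fun _ => hσ0) x).trans_eq (by rw [hω])).trans hMle)
  have hI₂ : ∫⁻ a, ∫⁻ x, K₂ (a, x) * θ₂ x ∂μ ∂Λ ≤ M * ∫⁻ x, θ₂ x ∂μ :=
    lintegral_lintegral_mul_le hK₂m hθ₂m (Eventually.of_forall fun x =>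
      ((lintegral_coreKernel_le hH hr hspos x).trans_eq (by rw [hω])).trans hMle)
  have hI₃ : ∫⁻ a, ∫⁻ x, K₃ (a, x) * θ₃ x ∂μ ∂Λ ≤ M * ∫⁻ x, θ₃ x ∂μ := by
    refine lintegral_lintegral_mul_le hK₃m hθ₃m ?_
    rw [hμ, ae_restrict_iff' hA]
    refine Eventually.of_forall fun x hx => ?_
    refine (lintegral_div_norm_pow_le hH hr (hAr x hx)).trans_eq ?_
    rw [hω]
  set err : H → ℝ≥0∞ := fun a => ∫⁻ x, K₁ (a, x) * θ₁ x ∂μ + ∫⁻ x, K₂ (a, x) * θ₂ x ∂μ +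
    ∫⁻ x, K₃ (a, x) * θ₃ x ∂μ with herr
  have hmeas : ∀ {K : H × Euc (m + 1) → ℝ≥0∞} {θ : Euc (m + 1) → ℝ≥0∞}, Measurable K →
      AEMeasurable θ μ → AEMeasurable (fun a => ∫⁻ x, K (a, x) * θ x ∂μ) Λ := fun hK hθ =>
    AEMeasurable.lintegral_prod_right' (hK.aemeasurable.mul hθ.comp_snd)
  have herrm : AEMeasurable err Λ :=
    ((hmeas hK₁m hθ₁m).add (hmeas hK₂m hθ₂m)).add (hmeas hK₃m hθ₃m)
  have hθsum : ∫⁻ x, θ₁ x ∂μ + ∫⁻ x, θ₂ x ∂μ + ∫⁻ x, θ₃ x ∂μ ≤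
      ENNReal.ofReal ((4 ^ (m + 1) * lam₁ + tiltConst m δ L * lam₂) * x₀) := by
    have hD0 : 0 ≤ tiltConst m δ L := by rw [tiltConst]; positivity
    have hpt : ∀ x, θ₁ x + θ₂ x + θ₃ x ≤
        {x | 0 < s₀ x}.indicator (fun _ => ENNReal.ofReal (4 ^ (m + 1))) x +
          ENNReal.ofReal (tiltConst m δ L) * ENNReal.ofReal (τ x + e) := by
      intro x
      have ht0 : 0 ≤ τ x + e := by linarith [hτ0 x]
      have h2 : θ₂ x ≤ {x | 0 < s₀ x}.indicator (fun _ => ENNReal.ofReal (4 ^ (m + 1))) x +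
          ENNReal.ofReal (4 ^ (m + 1) * (6 * L) ^ (m + 1) * (τ x + e)) := by
        by_cases hx : x ∈ {x | 0 < s₀ x}
        · rw [hθ₂, indicator_of_mem hx, indicator_of_mem hx,
            ← ENNReal.ofReal_add (by positivity) (by positivity)]
          refine ENNReal.ofReal_le_ofReal ?_
          refine (two_mul_one_add_mul_pow_le (by positivity) ht0 (by linarith [hτ2 x]) m).trans ?_
          have : 3 * (2 * r * ℓ) ≤ 6 * L := by linarith
          gcongr
        · rw [hθ₂, indicator_of_notMem hx, indicator_of_notMem hx]
          exact zero_le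
      refine (add_le_add (add_le_add le_rfl h2) le_rfl).trans_eq ?_
      rw [hθ₁, hθ₃, ← ENNReal.ofReal_mul hD0, tiltConst, add_mul, add_mul,
        ENNReal.ofReal_add (by positivity) (by positivity),
        ENNReal.ofReal_add (by positivity) (by positivity)]
      ring
    rw [← lintegral_add_right' _ hθ₂m, ← lintegral_add_right' _ hθ₃m]
    refine (lintegral_mono hpt).trans ?_
    rw [lintegral_add_left (measurable_const.indicator hlayset), lintegral_indicator_const hlayset,
      lintegral_const_mul' _ _ ENNReal.ofReal_ne_top, add_mul,
      ENNReal.ofReal_add (by positivity) (by positivity), mul_assoc, mul_assoc,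
      ENNReal.ofReal_mul (by positivity), ENNReal.ofReal_mul hD0]
    gcongr
    rw [hμ, Measure.restrict_apply hlayset, inter_comm]
    exact hlay
  have herrint : ∫⁻ a, err a ∂Λ ≤
      M * ENNReal.ofReal ((4 ^ (m + 1) * lam₁ + tiltConst m δ L * lam₂) * x₀) := by
    rw [herr, lintegral_add_right' _ (hmeas hK₃m hθ₃m), lintegral_add_right' _ (hmeas hK₂m hθ₂m)]
    refine (add_le_add (add_le_add hI₁ hI₂) hI₃).trans ?_
    rw [← mul_add, ← mul_add]
    gcongr
  -- a centre with small errors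
  obtain ⟨a, haG', haerr⟩ : ∃ a ∈ G', err a ≤ ENNReal.ofReal (η * x₀) := by
    by_contra! hcon
    -- Since `G'` has measure above `g * x₀`, errors above `η * x₀` on all of it would contradict
    -- the bound on their integral over the disc.
    have h1 : ENNReal.ofReal (η * x₀) * ENNReal.ofReal (g * x₀) ≤ ∫⁻ a, err a ∂Λ := by
      refine le_trans ?_ (mul_meas_ge_le_lintegral₀ herrm (ENNReal.ofReal (η * x₀)))
      gcongr
      refine hG'vol.le.trans (le_trans (measure_mono fun a ha => ?_)
        (Measure.le_restrict_apply (Metric.closedBall (0 : H) r) _))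
      refine ⟨(hcon a ha).le, mem_closedBall_zero_iff.2 ?_⟩
      linarith [hGr a (hG'G ha), mul_pos hδ hr]
    have hD0 : 0 ≤ tiltConst m δ L := by rw [tiltConst]; positivity
    have h2 := h1.trans herrint
    have h3 : M = ENNReal.ofReal (2 ^ (m + 2) * x₀) := by
      rw [hM, ← ENNReal.ofReal_ofNat 2, ← ENNReal.ofReal_mul (by norm_num),
        ← ENNReal.ofReal_mul (by positivity), hx₀]
      congr 1
      rw [mul_pow]; ring
    rw [h3, ← ENNReal.ofReal_mul (by positivity), ← ENNReal.ofReal_mul (by positivity),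
      ENNReal.ofReal_le_ofReal_iff (by positivity)] at h2
    have h4 := mul_lt_mul_of_pos_right hsmall (mul_pos hx₀0 hx₀0)
    linarith
  have haG := hG'G haG'
  have har := hGr a haG
  have hc : 0 < δ * r := by positivity
  refine ⟨a, σ, hσ0, hσ1, har, ?_⟩
  obtain ⟨K, hlip⟩ := exists_lipschitzWith_expansion hc har hσ0 hsσ hsle hℓ hslip
  have hgauge : ∀ x, gaugeFrom a r (p x - a) ≤ s x ↔ ‖p x - (1 - s x) • a‖ ≤ s x * r := fun x =>
    gaugeFrom_sub_le_iff hc har (hspos x)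
  have hQ : ∀ x, p x ∈ Metric.closedBall ((1 - σ) • a) (σ * r) ↔ ‖p x - (1 - σ) • a‖ ≤ σ * r :=
    fun x => mem_closedBall_iff_norm
  -- The core at inner heights, where `s = σ`; the core in the layer; and the remainder, which goes
  -- into the wall.
  set A₁ := Ain ∩ p ⁻¹' Metric.closedBall ((1 - σ) • a) (σ * r) with hA₁
  set A₂ := A ∩ ({x | 0 < s₀ x} ∩ {x | ‖p x - (1 - s x) • a‖ ≤ s x * r}) with hA₂
  have hA₁m : MeasurableSet A₁ :=
    hAinm.inter (hpc.measurable Metric.isClosed_closedBall.measurableSet)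
  have hA₂m : MeasurableSet A₂ := hA.inter (hlayset.inter
    (isClosed_le (by fun_prop) (by fun_prop)).measurableSet)
  set A₃ := A \ (A₁ ∪ A₂) with hA₃
  have hA₃m : MeasurableSet A₃ := hA.diff (hA₁m.union hA₂m)
  have hA₁s : ∀ x ∈ A₁, s x = σ := fun x hx => max_eq_left (le_trans hx.1.2 hσ0.le)
  have hA₃g : ∀ x ∈ A₃, s x ≤ gaugeFrom a r (p x - a) := by
    intro x hx
    by_contra hcon
    have h1 := (hgauge x).1 (not_le.1 hcon).le
    refine hx.2 ?_
    by_cases h0 : 0 < s₀ x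
    · exact Or.inr ⟨hx.1, h0, h1⟩
    · have h2 : s x = σ := max_eq_left ((not_lt.1 h0).trans hσ0.le)
      rw [h2] at h1
      exact Or.inl ⟨⟨hx.1, not_lt.1 h0⟩, (hQ x).2 h1⟩
  have hmono : ∀ {D : Set (Euc (m + 1))} {φ : Euc (m + 1) → ℝ≥0∞}, D ⊆ A →
      ∫⁻ x in D, φ x ∂μHE[m + 1] ≤ ∫⁻ x, φ x ∂μ := fun hD => lintegral_mono_set hD
  have hE₁ : μHE[m + 1] (expansion H a r s '' A₁) ≤ ENNReal.ofReal ((k + η) * x₀) +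
      ∫⁻ x, K₁ (a, x) * θ₁ x ∂μ := by
    have h1 := measure_image_expansion_le_of_const (H := H) (a := a) (r := r) hσ0 hsle hA₁s
      (fun x hx => by
        have := (hgauge x).2
        rw [hA₁s x hx] at this
        exact this ((hQ x).1 hx.2))
    have h2 := hΘ _ (Metric.isClosed_closedBall (x := (1 - σ) • a) (ε := σ * r)).measurableSet
    have h3 := hG' a haG'
    rw [Measure.addHaar_closedBall _ _ (by positivity), hH, hω] at h3
    have h4 : ENNReal.ofReal (σ⁻¹ ^ (m + 1)) * (((k : ℝ≥0∞) + ENNReal.ofReal η) *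
        (ENNReal.ofReal ((σ * r) ^ (m + 1)) * ENNReal.ofReal ω)) =
        ENNReal.ofReal ((k + η) * x₀) := by
      rw [← ENNReal.ofReal_natCast, ← ENNReal.ofReal_add (by positivity) hη.le,
        ← ENNReal.ofReal_mul (by positivity), ← ENNReal.ofReal_mul (by positivity),
        ← ENNReal.ofReal_mul (by positivity), hx₀]
      congr 1
      rw [inv_pow, mul_pow]
      field_simp
    have h5 : ENNReal.ofReal (σ⁻¹ ^ (m + 1)) * ∫⁻ x in A₁, θ₁ x ∂μHE[m + 1] ≤
        ∫⁻ x, K₁ (a, x) * θ₁ x ∂μ := by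
      rw [← lintegral_const_mul' _ _ ENNReal.ofReal_ne_top]
      refine le_trans (le_of_eq ?_) (hmono (D := A₁)
        (inter_subset_left.trans inter_subset_left))
      refine setLIntegral_congr_fun hA₁m fun x hx => ?_
      beta_reduce
      rw [hK₁, coreKernel_of_norm_le ((hQ x).1 hx.2)]
    refine h1.trans ?_
    rw [← h4]
    refine le_trans ?_ (add_le_add le_rfl h5)
    rw [← mul_add]
    gcongr
    exact h2.trans (add_le_add h3 le_rfl)
  have hE₂ : μHE[m + 1] (expansion H a r s '' A₂) ≤ ∫⁻ x, K₂ (a, x) * θ₂ x ∂μ := by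
    refine (measure_image_expansion_le_of_gauge_le hΓ hrect hτ hc har hσ0 hsσ hsle hℓ hslip he hlip
      hA₂m (inter_subset_left.trans hAΓ) (measure_ne_top_of_subset inter_subset_left hfin)
      fun x hx => (hgauge x).2 hx.2.2).trans ?_
    refine le_trans (le_of_eq ?_) (hmono (D := A₂) inter_subset_left)
    refine setLIntegral_congr_fun hA₂m fun x hx => ?_
    beta_reduce
    have := hspos x
    rw [hK₂, coreKernel_of_norm_le hx.2.2, hθ₂, indicator_of_mem hx.2.1,
      ← ENNReal.ofReal_mul (by positivity), ← mul_pow]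
    congr 2
    ring
  have hE₃ : μHE[m + 1] (expansion H a r s '' A₃) ≤ ∫⁻ x, K₃ (a, x) * θ₃ x ∂μ := by
    refine (measure_image_expansion_le_of_le_gauge hΓ hrect hτ hH hc har hσ0 hsσ he he1 hlip
      hA₃m (sdiff_subset.trans hAΓ) (measure_ne_top_of_subset sdiff_subset hfin) hA₃g
      fun x hx => ?_).trans ?_
    · rw [gaugeFrom_le_one_iff hc har, add_sub_cancel]
      exact hAr x hx.1
    refine le_trans (le_of_eq ?_) (hmono (D := A₃) sdiff_subset)
    refine setLIntegral_congr_fun hA₃m fun x hx => ?_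
    beta_reduce
    rw [hK₃, hθ₃]
    beta_reduce
    rw [← ENNReal.ofReal_mul (by positivity)]
    congr 1
    have : 4 * r / (δ * r) = 4 / δ := by field_simp
    rw [this, ← hP, mul_pow]
    ring
  have hcov : A ⊆ A₁ ∪ A₂ ∪ A₃ := fun x hx => by
    by_cases h : x ∈ A₁ ∪ A₂
    · exact Or.inl h
    · exact Or.inr ⟨hx, h⟩
  calc μHE[m + 1] (expansion H a r s '' A)
      ≤ μHE[m + 1] (expansion H a r s '' A₁ ∪ expansion H a r s '' A₂ ∪
          expansion H a r s '' A₃) := by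
        rw [← image_union, ← image_union]
        exact measure_mono (image_mono hcov)
    _ ≤ μHE[m + 1] (expansion H a r s '' A₁) + μHE[m + 1] (expansion H a r s '' A₂) +
          μHE[m + 1] (expansion H a r s '' A₃) :=
        (measure_union_le _ _).trans (add_le_add (measure_union_le _ _) le_rfl)
    _ ≤ ENNReal.ofReal ((k + η) * x₀) + err a := by
        refine (add_le_add (add_le_add hE₁ hE₂) hE₃).trans_eq ?_
        rw [herr]
        simp only [add_assoc]
    _ ≤ ENNReal.ofReal ((k + η) * x₀) + ENNReal.ofReal (η * x₀) := by gcongr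
    _ = _ := by
        rw [← ENNReal.ofReal_add (by positivity) (by positivity)]
        congr 1
        ring

end GoodCenter

/-! ### Membership in the class of local deformations. -/

section Deformation

variable {n N j : ℕ} {Ω : Euc n → ℝ} {E : Fin N → Set (Euc n)} {C : Set (Euc n)}
  {f : Euc n → Euc n}

theorem symmDiff_pushforward_subset (hE : ∀ i, IsOpen (E i)) (hC : IsClosed C)
    (hid : ∀ x ∉ C, f x = x) (hmaps : ∀ x ∈ C, f x ∈ C) (i : Fin N) :
    symmDiff (pushforward f E i) (E i) ⊆ C := by
  rintro x (⟨hx, hxE⟩ | ⟨hx, hxf⟩)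
  · by_contra hxC
    obtain ⟨z, hz, rfl⟩ := interior_subset hx
    by_cases hzC : z ∈ C
    · exact hxC (hmaps z hzC)
    · rw [hid z hzC] at hxE
      exact hxE hz
  · by_contra hxC
    refine hxf (mem_interior.2 ⟨E i ∩ Cᶜ, fun z hz => ⟨z, hz.1, hid z hz.2⟩,
      (hE i).inter hC.isOpen_compl, hx, hxC⟩)

theorem bdry_pushforward_inter_subset (hf : IsAdmissible E f) (hid : ∀ x ∉ C, f x = x) :
    bdry (pushforward f E) ∩ C ⊆ f '' (bdry E ∩ C) := by
  rintro x ⟨hx, hxC⟩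
  obtain ⟨z, hz, rfl⟩ := hf.bdry_pushforward_subset hx
  refine ⟨z, ⟨hz, ?_⟩, rfl⟩
  by_contra hzC
  rw [hid z hzC] at hxC
  exact hzC hxC

theorem bdry_pushforward_sdiff_subset (hf : IsAdmissible E f) (hid : ∀ x ∉ C, f x = x)
    (hmaps : ∀ x ∈ C, f x ∈ C) : bdry (pushforward f E) \ C ⊆ bdry E \ C := by
  rintro x ⟨hx, hxC⟩
  obtain ⟨z, hz, rfl⟩ := hf.bdry_pushforward_subset hx
  have hzC : z ∉ C := fun h => hxC (hmaps z h)
  rw [hid z hzC]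
  exact ⟨hz, hzC⟩

theorem bdryMass_pushforward_le (hf : IsAdmissible E f) (hC : MeasurableSet C)
    (hid : ∀ x ∉ C, f x = x) :
    bdryMass (pushforward f E) C ≤ μHE[n] (f '' (bdry E ∩ C)) := by
  refine (bdryMass_le _ C).trans ?_
  rw [Measure.restrict_apply hC, inter_comm]
  exact measure_mono (bdry_pushforward_inter_subset hf hid)

/-- On `C` a test function varies at most by the factor `exp (j * D)`, so a loss of area by this
factor settles all test functions at once; outside `C` the boundary can only shrink. Each symmetric
difference lies in `C`, whose volume is small. -/
theorem mem_localDeformations (hΩ : IsWeightFunction Ω) (hE : IsOpenPartition Ω E)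
    (hmass : bdryMass E = μHE[n].restrict (bdry E)) (hC : IsCompact C) {K : ℝ≥0}
    (hf : LipschitzWith K f) (hfib : ∀ y, IsConnected (f ⁻¹' {y}))
    (hid : ∀ x ∉ C, f x = x) (hmaps : ∀ x ∈ C, f x ∈ C)
    (hdist : ∀ x, ‖f x - x‖ ≤ 1 / (j : ℝ) ^ 2) (hvol : volume C ≤ ENNReal.ofReal (1 / j))
    {D : ℝ} (hdiam : ∀ x ∈ C, ∀ y ∈ C, ‖x - y‖ ≤ D)
    (harea : ENNReal.ofReal (Real.exp (j * D)) * μHE[n] (f '' (bdry E ∩ C)) ≤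
      μHE[n] (bdry E ∩ C)) :
    f ∈ localDeformations Ω E C j := by
  have hadm := hE.isAdmissible hΩ hf hdist hfib
  have hΓm : MeasurableSet (bdry E) := (isClosed_bdry E).measurableSet
  have hΓ'm : MeasurableSet (bdry (pushforward f E)) := (isClosed_bdry _).measurableSet
  refine ⟨⟨hadm, hdist, fun i => (measure_mono (symmDiff_pushforward_subset hE.isOpen hC.isClosed
    hid hmaps i)).trans hvol, fun φ hφ => ?_⟩, ?_⟩
  · refine (lintegral_mono' (bdryMass_le _) le_rfl).trans ?_
    rw [hmass, ← lintegral_inter_add_sdiff _ (bdry (pushforward f E)) hC.measurableSet,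
      ← lintegral_inter_add_sdiff _ (bdry E) hC.measurableSet]
    refine add_le_add ?_ (lintegral_mono_set (bdry_pushforward_sdiff_subset hadm hid hmaps))
    refine le_lintegral_of_forall_le_mul (hΓm.inter hC.measurableSet) ?_ ?_ ?_
    · refine (lt_of_le_of_lt (measure_mono (inter_subset_inter_left _ ?_))
        (hE.measure_compl_inter_lt_top hΩ hC)).ne
      exact bdry_subset_compl hE.isOpen hE.disjoint
    · intro h0
      have : bdry (pushforward f E) ∩ C = ∅ := by
        have := bdry_pushforward_inter_subset hadm hid
        rwa [h0, image_empty, subset_empty_iff] at this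
      rw [this, Measure.restrict_empty, lintegral_zero_measure]
    · intro w hw
      calc ∫⁻ x in bdry (pushforward f E) ∩ C, ENNReal.ofReal (φ x) ∂μHE[n]
          ≤ ∫⁻ _ in bdry (pushforward f E) ∩ C,
              ENNReal.ofReal (φ w) * ENNReal.ofReal (Real.exp (j * D)) ∂μHE[n] := by
            refine setLIntegral_mono' (hΓ'm.inter hC.measurableSet) fun x hx => ?_
            rw [← ENNReal.ofReal_mul (hφ.2 w).1]
            refine ENNReal.ofReal_le_ofReal ((testFunctions_le_exp_mul hφ x w).trans ?_)
            rw [mul_comm]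
            refine mul_le_mul_of_nonneg_left (Real.exp_le_exp.2 ?_) (hφ.2 w).1
            exact mul_le_mul_of_nonneg_left (hdiam x hx.2 w hw.2) (Nat.cast_nonneg j)
        _ ≤ ENNReal.ofReal (φ w) *
              (ENNReal.ofReal (Real.exp (j * D)) * μHE[n] (f '' (bdry E ∩ C))) := by
            rw [setLIntegral_const, mul_assoc]
            gcongr
            exact bdry_pushforward_inter_subset hadm hid
        _ ≤ _ := by gcongr
  · rintro x (hx | ⟨z, hz, rfl⟩)
    · by_contra hxC
      exact hx (hid x hxC)
    · refine hmaps z ?_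
      by_contra hzC
      exact hz (hid z hzC)

/-- Masses are nonnegative, so the differences are bounded below and the infimum is not the default
value of `sInf`. -/
theorem massReduction_le (hf : f ∈ localDeformations Ω E C j) :
    massReduction Ω E j C ≤ (bdryMass (pushforward f E)).real C - (bdryMass E).real C := by
  refine csInf_le ⟨-(bdryMass E).real C, ?_⟩ ⟨f, hf, rfl⟩
  rintro _ ⟨g, -, rfl⟩
  have := measureReal_nonneg (μ := bdryMass (pushforward g E)) (s := C)
  simp only
  linarith

end Deformation

/-! ### The crossing scale. -/

section Scales

/-- A scale at which the ratio to `κ rⁿ` crosses one. -/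
theorem exists_scale_crossing {M : ℝ → ℝ} {κ δ R : ℝ} {n : ℕ} (hδ : 0 < δ) (hδ1 : δ < 1)
    {r₀ : ℝ} (hr₀ : r₀ ∈ Ioo 0 R) (hM : M r₀ < κ * r₀ ^ n)
    (hsmall : ∀ᶠ r in 𝓝[>] (0 : ℝ), κ * r ^ n ≤ M r) :
    ∃ r ∈ Ioo 0 R, M r < κ * r ^ n ∧ κ * ((1 - δ) * r) ^ n ≤ M ((1 - δ) * r) := by
  set u : ℕ → ℝ := fun i => (1 - δ) ^ i * r₀ with hu
  have hδ0 : 0 < 1 - δ := by linarith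
  have hu0 : ∀ i, 0 < u i := fun i => mul_pos (pow_pos hδ0 i) hr₀.1
  have hulim : Tendsto u atTop (𝓝[>] 0) := by
    refine tendsto_nhdsWithin_iff.2 ⟨?_, Eventually.of_forall hu0⟩
    simpa using (tendsto_pow_atTop_nhds_zero_of_lt_one hδ0.le (by linarith : 1 - δ < 1)).mul_const r₀
  have hex : ∃ i, κ * u i ^ n ≤ M (u i) := (hulim.eventually hsmall).exists
  classical
  -- The first index at which the ratio has recovered; it is not zero by `hM`, so its predecessor is
  -- the required scale.
  set i := Nat.find hex with hi
  have hi1 := Nat.find_spec hex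
  have hi0 : i ≠ 0 := fun h => by
    rw [← hi, h] at hi1
    simp only [hu, pow_zero, one_mul] at hi1
    linarith
  obtain ⟨l, hl⟩ := Nat.exists_eq_succ_of_ne_zero hi0
  refine ⟨u l, ⟨hu0 l, ?_⟩, not_le.1 (Nat.find_min hex (by rw [← hi, hl]; exact Nat.lt_succ_self l)),
    ?_⟩
  · refine lt_of_le_of_lt ?_ hr₀.2
    exact mul_le_of_le_one_left hr₀.1.le (pow_le_one₀ hδ0.le (by linarith))
  · rw [← hi, hl] at hi1
    have : (1 - δ) * u l = u (l + 1) := by simp only [hu, pow_succ]; ring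
    rw [this]
    exact hi1

end Scales

/-! ### Cylinders over finite sets of heights. -/

section Cylinder

variable {n : ℕ} {H : Submodule ℝ (Euc n)} {Y : Finset (Euc n)}

/-- The points whose distance to `Hᗮ` is at most `r₁` and whose height is within `r₂` of `Y`. -/
def cylinderOver (H : Submodule ℝ (Euc n)) (Y : Finset (Euc n)) (r₁ r₂ : ℝ) : Set (Euc n) :=
  {x | ‖H.orthogonalProjectionOnto x‖ ≤ r₁ ∧
    Metric.infDist (x - (H.orthogonalProjectionOnto x : Euc n)) (Y : Set (Euc n)) ≤ r₂}

/-- Nonemptiness matters: for empty `Y` the real distance `infDist` is zero, whereas `infEDist` is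
infinite. -/
theorem cylinder_eq_cylinderOver (hY : Y.Nonempty) {r₁ r₂ : ℝ} (hr₂ : 0 ≤ r₂) :
    cylinder (Y : Set (Euc n)) r₁ r₂ = cylinderOver (horizontal n).1 Y r₁ r₂ := by
  ext x
  rw [cylinder, cylinderOver, mem_ofPred_eq, mem_ofPred_eq, Submodule.starProjection_orthogonal_val,
    Metric.infDist, ENNReal.le_ofReal_iff_toReal_le
      (Metric.infEDist_ne_top (Finset.coe_nonempty.2 hY)) hr₂]
  rfl

theorem isClosed_cylinderOver {r₁ r₂ : ℝ} : IsClosed (cylinderOver H Y r₁ r₂) := by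
  have h1 : IsClosed {x : Euc n | ‖H.orthogonalProjectionOnto x‖ ≤ r₁} :=
    isClosed_le (by fun_prop) continuous_const
  have h2 : IsClosed {x : Euc n |
      Metric.infDist (x - (H.orthogonalProjectionOnto x : Euc n)) (Y : Set (Euc n)) ≤ r₂} :=
    isClosed_le ((Metric.continuous_infDist_pt _).comp (by fun_prop)) continuous_const
  exact h1.inter h2

theorem cylinderOver_mono {r₁ r₂ r₁' r₂' : ℝ} (h₁ : r₁ ≤ r₁') (h₂ : r₂ ≤ r₂') :
    cylinderOver H Y r₁ r₂ ⊆ cylinderOver H Y r₁' r₂' := fun _ hx => ⟨hx.1.trans h₁, hx.2.trans h₂⟩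

theorem exists_mem_norm_sub_le (hY : Y.Nonempty) {r₁ r₂ : ℝ} {x : Euc n}
    (hx : x ∈ cylinderOver H Y r₁ r₂) :
    ∃ y ∈ Y, ‖x - (H.orthogonalProjectionOnto x : Euc n) - y‖ ≤ r₂ := by
  obtain ⟨y, hy, hd⟩ := (Finset.finite_toSet Y).isCompact.exists_infDist_eq_dist
    (Finset.coe_nonempty.2 hY) (x - (H.orthogonalProjectionOnto x : Euc n))
  refine ⟨y, hy, ?_⟩
  rw [← dist_eq_norm, ← hd]
  exact hx.2

theorem norm_sub_le_of_mem_cylinderOver (hY : Y.Nonempty) {r₁ r₂ : ℝ} {x z : Euc n}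
    (hx : x ∈ cylinderOver H Y r₁ r₂) (hz : z ∈ cylinderOver H Y r₁ r₂) :
    ‖x - z‖ ≤ 2 * r₁ + 2 * r₂ + Metric.diam (Y : Set (Euc n)) := by
  obtain ⟨y, hy, hd⟩ := exists_mem_norm_sub_le hY hx
  obtain ⟨y', hy', hd'⟩ := exists_mem_norm_sub_le hY hz
  have h1 : ‖y - y'‖ ≤ Metric.diam (Y : Set (Euc n)) := by
    rw [← dist_eq_norm]
    exact Metric.dist_le_diam_of_mem (Finset.finite_toSet Y).isBounded hy hy'
  have e : x - z = ((H.orthogonalProjectionOnto x : Euc n) - H.orthogonalProjectionOnto z) +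
      ((x - (H.orthogonalProjectionOnto x : Euc n) - y) -
        (z - (H.orthogonalProjectionOnto z : Euc n) - y') + (y - y')) := by abel
  have hx1 := hx.1
  have hz1 := hz.1
  rw [Submodule.coe_norm] at hx1 hz1
  rw [e]
  refine (norm_add_le _ _).trans ?_
  have i1 := norm_sub_le (H.orthogonalProjectionOnto x : Euc n) (H.orthogonalProjectionOnto z)
  have i2 := norm_add_le ((x - (H.orthogonalProjectionOnto x : Euc n) - y) -
        (z - (H.orthogonalProjectionOnto z : Euc n) - y')) (y - y')
  have i3 := norm_sub_le (x - (H.orthogonalProjectionOnto x : Euc n) - y)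
    (z - (H.orthogonalProjectionOnto z : Euc n) - y')
  linarith

theorem closedBall_subset_cylinderOver (hYH : (Y : Set (Euc n)) ⊆ (Hᗮ : Submodule ℝ (Euc n)))
    {y : Euc n} (hy : y ∈ Y) {r₁ r₂ : ℝ} (h : r₁ ≤ r₂) :
    Metric.closedBall y r₁ ⊆ cylinderOver H Y r₁ r₂ := by
  intro x hx
  rw [mem_closedBall_iff_norm] at hx
  have h0 : H.orthogonalProjectionOnto y = 0 :=
    by
    rw [Submodule.orthogonalProjectionOnto_eq_zero_iff]; exact hYH hy
  refine ⟨?_, ?_⟩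
  · have := norm_proj_sub_le (H := H) x y
    rw [h0, sub_zero] at this
    exact this.trans hx
  · refine (Metric.infDist_le_dist_of_mem (Finset.mem_coe.2 hy)).trans ?_
    have := norm_proj_sub_proj_le (H := H) x y
    rw [h0, Submodule.coe_zero, sub_zero] at this
    rw [dist_eq_norm]
    exact this.trans (hx.trans h)

/-- For small `r` the balls about the points of `Y` are disjoint and lie in the cylinder, whose
height stays above `ρ`. Each may lose the share `ζ / #Y`. -/
theorem eventually_le_measureReal_cylinderOver {μ : Measure (Euc n)} [IsLocallyFiniteMeasure μ]
    (hYH : (Y : Set (Euc n)) ⊆ (Hᗮ : Submodule ℝ (Euc n))) (hY : Y.Nonempty)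
    (hdens : ∀ y ∈ Y, HasDensity μ y 1) {ζ R ρ : ℝ} (hζ : 0 < ζ) (hR : 0 < R) (hρ : 0 < ρ)
    (hω : 0 < unitBallVolume n) (hfin : ∀ r₁ r₂, μ (cylinderOver H Y r₁ r₂) ≠ ∞) :
    ∀ᶠ r in 𝓝[>] (0 : ℝ), (Y.card - ζ) * unitBallVolume n * r ^ n ≤
      μ.real (cylinderOver H Y r ((1 + R⁻¹ * r) * ρ)) := by
  have hk : 0 < (Y.card : ℝ) := by exact_mod_cast hY.card_pos
  have h1 : ∀ᶠ r in 𝓝[>] (0 : ℝ), ∀ y ∈ Y,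
      1 - ζ / Y.card < μ.real (Metric.closedBall y r) / (unitBallVolume n * r ^ n) := by
    rw [Finset.eventually_all]
    intro y hy
    exact (hdens y hy).eventually_const_lt (by linarith [div_pos hζ hk])
  have h2 : ∀ᶠ r in 𝓝[>] (0 : ℝ), ∀ y ∈ Y, ∀ y' ∈ Y, y ≠ y' → r + r < dist y y' := by
    rw [Finset.eventually_all]
    intro y hy
    rw [Finset.eventually_all]
    intro y' hy'
    by_cases hne : y = y'
    · exact Eventually.of_forall fun r h => absurd hne h
    · have : ∀ᶠ r in 𝓝 (0 : ℝ), r + r < dist y y' :=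
        (continuous_id.add continuous_id).tendsto' 0 0 (by simp) |>.eventually_lt_const
          (dist_pos.2 hne)
      exact (this.filter_mono nhdsWithin_le_nhds).mono fun r hr _ => hr
  have h3 : ∀ᶠ r in 𝓝[>] (0 : ℝ), r < ρ :=
    (eventually_lt_nhds hρ).filter_mono nhdsWithin_le_nhds
  filter_upwards [h1, h2, h3, self_mem_nhdsWithin] with r hr1 hr2 hr3 hr0
  have hr0 : 0 < r := hr0
  have hle : r ≤ (1 + R⁻¹ * r) * ρ := by
    have : 0 < R⁻¹ * r * ρ := by positivity
    linarith
  have hsub : (⋃ y ∈ Y, Metric.closedBall y r) ⊆ cylinderOver H Y r ((1 + R⁻¹ * r) * ρ) :=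
    iUnion₂_subset fun y hy => closedBall_subset_cylinderOver hYH hy hle
  calc (Y.card - ζ) * unitBallVolume n * r ^ n
      = ∑ y ∈ Y, (1 - ζ / Y.card) * (unitBallVolume n * r ^ n) := by
        rw [Finset.sum_const, nsmul_eq_mul]
        field_simp
    _ ≤ ∑ y ∈ Y, μ.real (Metric.closedBall y r) := by
        refine Finset.sum_le_sum fun y hy => ?_
        have := (hr1 y hy).le
        rwa [le_div_iff₀ (by positivity)] at this
    _ = μ.real (⋃ y ∈ Y, Metric.closedBall y r) := by
        refine (measureReal_biUnion_finset ?_ (fun y _ => Metric.isClosed_closedBall.measurableSet)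
          fun y _ => measure_closedBall_lt_top.ne).symm
        intro y hy y' hy' hne
        exact Metric.closedBall_disjoint_closedBall (hr2 y hy y' hy' hne)
    _ ≤ _ := measureReal_mono hsub (hfin _ _)

end Cylinder

theorem volume_ball_eq_unitBallVolume {n : ℕ} {H : Type*} [NormedAddCommGroup H]
    [InnerProductSpace ℝ H] [FiniteDimensional ℝ H] [MeasurableSpace H] [BorelSpace H]
    (hH : finrank ℝ H = n) :
    volume (Metric.ball (0 : H) 1) = ENNReal.ofReal (unitBallVolume n) := by
  subst hH
  have h := (stdOrthonormalBasis ℝ H).measurePreserving_repr.measure_preimage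
    (measurableSet_ball (x := (0 : EuclideanSpace ℝ (Fin (finrank ℝ H)))) (ε := 1)).nullMeasurableSet
  rw [unitBallVolume, measureReal_def, ENNReal.ofReal_toReal measure_ball_lt_top.ne, ← h]
  congr 1
  ext x
  simp

theorem unitBallVolume_pos (n : ℕ) : 0 < unitBallVolume n :=
  ENNReal.toReal_pos (Metric.measure_ball_pos _ _ one_pos).ne' measure_ball_lt_top.ne

/-! ### Removal of a sheet at the crossing scale. -/

section Reduction

variable {m N j k : ℕ} {Ω : Euc (m + 1) → ℝ} {E : Fin N → Set (Euc (m + 1))}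
  {H : Submodule ℝ (Euc (m + 1))} {Y : Finset (Euc (m + 1))} {τ : Euc (m + 1) → ℝ}
  {α ζ δ δ' γ ν R ρ r : ℝ}

local notation "π" => Submodule.orthogonalProjectionOnto H

theorem isCompact_cylinderOver {n : ℕ} {H : Submodule ℝ (Euc n)} {Y : Finset (Euc n)}
    (hY : Y.Nonempty) {r₁ r₂ : ℝ} : IsCompact (cylinderOver H Y r₁ r₂) := by
  refine Metric.isCompact_of_isClosed_isBounded isClosed_cylinderOver ?_
  refine Metric.isBounded_iff.2
    ⟨2 * r₁ + 2 * r₂ + Metric.diam (Y : Set (Euc n)), fun x hx z hz => ?_⟩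
  rw [dist_eq_norm]
  exact norm_sub_le_of_mem_cylinderOver hY hx hz

/-- The diameter is at most `4 / j ^ 2`, and a ball of this radius has volume of order `j ^ (-2 * (m
+ 2))`, which is below `1 / j` for large `j`. -/
theorem volume_cylinderOver_le (hY : Y.Nonempty) (hj : 0 < j)
    (hvol : 4 ^ (m + 2) * unitBallVolume (m + 2) ≤ j) {r₁ r₂ : ℝ}
    (hr : 2 * r₁ + 2 * r₂ + Metric.diam (Y : Set (Euc (m + 1))) ≤ 4 * ((j : ℝ) ^ 2)⁻¹) :
    volume (cylinderOver H Y r₁ r₂) ≤ ENNReal.ofReal (1 / j) := by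
  have hj1 : (1 : ℝ) ≤ j := by exact_mod_cast hj
  rcases (cylinderOver H Y r₁ r₂).eq_empty_or_nonempty with h0 | ⟨z, hz⟩
  · rw [h0, measure_empty]; exact zero_le
  have hsub : cylinderOver H Y r₁ r₂ ⊆ Metric.closedBall z (4 * ((j : ℝ) ^ 2)⁻¹) := fun x hx => by
    rw [mem_closedBall_iff_norm]
    exact (norm_sub_le_of_mem_cylinderOver hY hx hz).trans hr
  have hfr : finrank ℝ (Euc (m + 1)) = m + 2 := by simp
  have hω := unitBallVolume_pos (m + 2)
  refine (measure_mono hsub).trans ?_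
  rw [Measure.addHaar_closedBall _ _ (by positivity), volume_ball_eq_unitBallVolume hfr, hfr,
    ← ENNReal.ofReal_mul (by positivity)]
  refine ENNReal.ofReal_le_ofReal ?_
  rw [mul_pow, inv_pow, ← pow_mul]
  have h1 : (j : ℝ) ^ 2 ≤ (j : ℝ) ^ (2 * (m + 2)) := pow_le_pow_right₀ hj1 (by omega)
  calc (4 : ℝ) ^ (m + 2) * ((j : ℝ) ^ (2 * (m + 2)))⁻¹ * unitBallVolume (m + 2)
      = (4 ^ (m + 2) * unitBallVolume (m + 2)) * ((j : ℝ) ^ (2 * (m + 2)))⁻¹ := by ring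
    _ ≤ j * ((j : ℝ) ^ 2)⁻¹ := by gcongr
    _ = 1 / j := by field_simp

set_option maxHeartbeats 1000000 in
/-- If the mass ratio drops at the scale `r`, a sheet can be removed there. -/
theorem massReduction_lt (hΩ : IsWeightFunction Ω) (hE : IsOpenPartition Ω E)
    (hmass : bdryMass E = μHE[m + 1].restrict (bdry E)) (hH : finrank ℝ H = m + 1)
    (hτ : ∀ x, τ x = ‖(approxTangent (bdry E) x).1.starProjection - H.starProjection‖)
    (hτm : AEMeasurable τ (μHE[m + 1].restrict (bdry E)))
    (hY : Y.card = k + 1) (hdiam : Metric.diam (Y : Set (Euc (m + 1))) < ((j : ℝ) ^ 2)⁻¹)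
    (hα : 0 < α) (hζ : ζ ∈ Ioo (0 : ℝ) 1) (hδ : δ ∈ Ioo (0 : ℝ) 1) (hδ' : δ' ∈ Ioc (0 : ℝ) 1)
    (hγ : γ ∈ Ioo (0 : ℝ) 1) (hν : (k : ℝ) + 1 ≤ ν) (hj : 0 < j)
    (hR : R ∈ Ioo (0 : ℝ) (1 / 2 * ((j : ℝ) ^ 2)⁻¹)) (hρ : ρ ∈ Ioo (0 : ℝ) (1 / 2 * ((j : ℝ) ^ 2)⁻¹))
    (hαR : α * R ≤ ρ) (hr : r ∈ Ioo 0 R)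
    (hδν : (m + 1) * δ * ν ≤ (1 - ζ) / 8) (hγν : γ * ν < 5 * ((1 - ζ) / 8))
    (hδ'ν : 2 * ((m + 1) * δ') * ν ≤ ζ)
    (hsmall : 2 ^ (m + 2) * (4 ^ (m + 1) * ((m + 1) * δ * ν) +
      tiltConst m δ' (α * δ)⁻¹ * (2 * γ * ν)) < (1 - ζ) / 8 * (ζ / (4 * ν)))
    (hexp : Real.exp (4 / j) ≤ 1 + 5 * ((1 - ζ) / 8) / ν)
    (hvol : 4 ^ (m + 2) * unitBallVolume (m + 2) ≤ j)
    (hlt : (μHE[m + 1].restrict (bdry E)).real (cylinderOver H Y r ((1 + R⁻¹ * r) * ρ)) <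
      (k + 1 - ζ) * (unitBallVolume (m + 1) * r ^ (m + 1)))
    (hge : (k + 1 - ζ) * (unitBallVolume (m + 1) * ((1 - δ) * r) ^ (m + 1)) ≤
      (μHE[m + 1].restrict (bdry E)).real
        (cylinderOver H Y ((1 - δ) * r) ((1 + R⁻¹ * ((1 - δ) * r)) * ρ)))
    (htilt : ∫⁻ x in cylinderOver H Y r ((1 + R⁻¹ * r) * ρ), ENNReal.ofReal (τ x)
        ∂(μHE[m + 1].restrict (bdry E)) ≤
      ENNReal.ofReal (γ * (μHE[m + 1].restrict (bdry E)).real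
        (cylinderOver H Y r ((1 + R⁻¹ * r) * ρ)))) :
    massReduction Ω E j (cylinderOver H Y r ((1 + R⁻¹ * r) * ρ)) <
      -γ * (bdryMass E).real (cylinderOver H Y r ((1 + R⁻¹ * r) * ρ)) := by
  obtain ⟨hζ0, hζ1⟩ := hζ
  obtain ⟨hδ0, hδ1⟩ := hδ
  obtain ⟨hδ'0, hδ'1⟩ := hδ'
  obtain ⟨hγ0, hγ1⟩ := hγ
  obtain ⟨hR0, hRj⟩ := hR
  obtain ⟨hρ0, hρj⟩ := hρ
  obtain ⟨hr0, hrR⟩ := hr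
  have hYne : Y.Nonempty := Finset.card_pos.1 (by omega)
  have hk0 : (0 : ℝ) ≤ k := Nat.cast_nonneg k
  have hν1 : 1 ≤ ν := by linarith
  have hlf := hE.isLocallyFiniteMeasure hΩ
  set Γ := bdry E with hΓdef
  have hΓm : MeasurableSet Γ := (isClosed_bdry E).measurableSet
  set μ := (μHE[m + 1] : Measure (Euc (m + 1))).restrict Γ with hμ
  set ω := unitBallVolume (m + 1) with hω
  have hω0 : 0 < ω := unitBallVolume_pos _
  -- The old area is at least `k + 8η - η` discs, the new one at most `k + 2η`; a surplus of `5η`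
  -- remains.
  set η := (1 - ζ) / 8 with hη
  have hη0 : 0 < η := by rw [hη]; linarith
  set x₀ := ω * r ^ (m + 1) with hx₀
  have hx₀0 : 0 < x₀ := by positivity
  set C := cylinderOver H Y r ((1 + R⁻¹ * r) * ρ) with hC
  -- The height of the inner cylinder; not the sine.
  set sin := (1 + R⁻¹ * ((1 - δ) * r)) * ρ with hsin
  set Cs := cylinderOver H Y ((1 - δ) * r) sin with hCs
  have hRr : R⁻¹ * r ≤ 1 := by rw [inv_mul_le_iff₀ hR0, mul_one]; exact hrR.le
  have hRi : 0 < R⁻¹ := inv_pos.2 hR0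
  have hCsC : Cs ⊆ C := by
    refine cylinderOver_mono (by nlinarith) ?_
    rw [hsin]
    gcongr
    nlinarith
  have hCcl : IsClosed C := isClosed_cylinderOver
  have hCm : MeasurableSet C := hCcl.measurableSet
  have hCsm : MeasurableSet Cs := isClosed_cylinderOver.measurableSet
  have hCcpt : IsCompact C := isCompact_cylinderOver hYne
  have hμC : μ C ≠ ∞ := hCcpt.measure_lt_top.ne
  set A := Γ ∩ C with hA
  have hAm : MeasurableSet A := hΓm.inter hCm
  have hμA : μHE[m + 1] A = μ C := by rw [hμ, Measure.restrict_apply hCm, inter_comm]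
  have hμAr : μHE[m + 1] A = ENNReal.ofReal (μ.real C) := by
    rw [hμA, measureReal_def, ENNReal.ofReal_toReal hμC]
  have hAfin : μHE[m + 1] A ≠ ∞ := by rw [hμA]; exact hμC
  have hold0 : 0 ≤ μ.real C := measureReal_nonneg
  have hold1 : μ.real C ≤ ν * x₀ := hlt.le.trans (by gcongr; linarith)
  have hbern : 1 - (m + 1) * δ ≤ (1 - δ) ^ (m + 1) := by
    have := one_add_mul_le_pow (a := -δ) (by linarith) (m + 1)
    rw [← sub_eq_add_neg] at this
    push_cast at this
    linarith
  have hge' : (k + 1 - ζ) * (1 - (m + 1) * δ) * x₀ ≤ μ.real Cs := by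
    refine le_trans ?_ hge
    rw [mul_pow, hx₀]
    have : 0 ≤ (k : ℝ) + 1 - ζ := by linarith
    calc _ ≤ (k + 1 - ζ) * (1 - δ) ^ (m + 1) * (ω * r ^ (m + 1)) := by gcongr
      _ = _ := by ring
  have hkδ : (k + 1 - ζ) * ((m + 1) * δ) ≤ (m + 1) * δ * ν := by
    rw [mul_comm]
    gcongr
    linarith
  -- the height function
  set d : Euc (m + 1) → ℝ := fun x =>
    Metric.infDist (x - (π x : Euc (m + 1))) (Y : Set (Euc (m + 1))) with hd
  -- The two cylinders differ in height by `R⁻¹ * (δ * r) * ρ`, which is at least `α * δ * r` by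
  -- `hαR`. So `s₀` can climb to one across the layer with this slope, and `r * ℓ` does not depend
  -- on the scale.
  set ℓ := (α * δ * r)⁻¹ with hℓ
  have hℓ0 : 0 < ℓ := by positivity
  set s₀ : Euc (m + 1) → ℝ := fun x => min 1 (ℓ * (d x - sin)) with hs₀
  have hs₀1 : ∀ x, s₀ x ≤ 1 := fun x => min_le_left _ _
  have hs₀lip : ∀ x y, |s₀ x - s₀ y| ≤
      ℓ * ‖(x - (π x : Euc (m + 1))) - (y - (π y : Euc (m + 1)))‖ := fun x y => by
    have h1 := abs_min_sub_min_le_max 1 (ℓ * (d x - sin)) 1 (ℓ * (d y - sin))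
    rw [sub_self, abs_zero, max_eq_right (abs_nonneg _)] at h1
    refine h1.trans ?_
    rw [← mul_sub, sub_sub_sub_cancel_right, abs_mul, abs_of_pos hℓ0]
    gcongr
    have h2 := (Metric.lipschitz_infDist_pt (Y : Set (Euc (m + 1)))).dist_le_mul
      (x - (π x : Euc (m + 1))) (y - (π y : Euc (m + 1)))
    rwa [NNReal.coe_one, one_mul, Real.dist_eq, dist_eq_norm] at h2
  have hs₀Cs : ∀ x ∈ Cs, s₀ x ≤ 0 := fun x hx =>
    min_le_iff.2 (Or.inr (mul_nonpos_of_nonneg_of_nonpos hℓ0.le (sub_nonpos.2 hx.2)))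
  have hs₀out : ∀ x, (1 + R⁻¹ * r) * ρ ≤ d x → s₀ x = 1 := fun x hx => by
    refine min_eq_left ?_
    rw [hℓ, ← div_eq_inv_mul, one_le_div (by positivity)]
    have h1 : α * δ * r ≤ R⁻¹ * (δ * r) * ρ := by
      calc α * δ * r = R⁻¹ * (δ * r) * (α * R) := by field_simp
        _ ≤ _ := by gcongr
    have h2 : (1 + R⁻¹ * r) * ρ - sin = R⁻¹ * (δ * r) * ρ := by rw [hsin]; ring
    linarith
  -- the expansion
  have hk1 : 0 < (k : ℝ) + 1 := by positivity
  have hζν : ζ / ν ≤ ζ / (k + 1) := by gcongr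
  have hδ'2 : 2 * ((m + 1) * δ') ≤ ζ / ν := by rwa [le_div_iff₀ (by linarith)]
  have hζν0 : 0 < ζ / ν := by positivity
  have hζν4 : ζ / (4 * ν) = ζ / ν / 4 := by rw [div_div, mul_comm]
  -- The flatness tolerance is taken to be `γ`, so that it adds no more than the tilt does: hence `2
  -- * γ * ν`. The layer has mass `(m + 1) * δ * ν` by comparing the two sides of the crossing.
  obtain ⟨a, σ, hσ0, hσ1, ha, harea⟩ := exists_expansion_measure_le (Γ := Γ) (A := A) (H := H)
    (τ := τ) (s₀ := s₀) (r := r) (ℓ := ℓ) (e := γ) (ω := ω) (δ := δ') (ζ := ζ) (η := η) (k := k)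
    (L := (α * δ)⁻¹) (lam₁ := (m + 1) * δ * ν) (lam₂ := 2 * γ * ν)
    hΓm hE.rectifiable hτ hτm hH hω0 (volume_ball_eq_unitBallVolume hH) hr0 hAm inter_subset_left
    hAfin (fun x hx => hx.2.1) hs₀1 hℓ0.le hs₀lip hδ'0 hδ'1 hζ1.le hγ0 hγ1.le hη0
    (by linarith) (by positivity) (by positivity)
    (by
      refine (measure_mono inter_subset_left).trans ?_
      rw [hμAr]
      exact ENNReal.ofReal_le_ofReal hlt.le)
    (by
      have hsub : A ∩ {x | 0 < s₀ x} ⊆ (C \ Cs) ∩ Γ := fun x hx =>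
        ⟨⟨hx.1.2, fun h => absurd (hs₀Cs x h) (not_le.2 hx.2)⟩, hx.1.1⟩
      refine (measure_mono hsub).trans ?_
      rw [← Measure.restrict_apply (hCm.diff hCsm), ← hμ, ← ENNReal.ofReal_toReal
        (measure_ne_top_of_subset sdiff_subset hμC)]
      refine ENNReal.ofReal_le_ofReal ?_
      rw [← measureReal_def, measureReal_sdiff hCsC hCsm hμC]
      have := mul_le_mul_of_nonneg_right hkδ hx₀0.le
      linarith)
    (by
      have h1 : ∀ x, ENNReal.ofReal (τ x + γ) ≤ ENNReal.ofReal (τ x) + ENNReal.ofReal γ := fun x =>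
        ENNReal.ofReal_add_le
      refine (lintegral_mono h1).trans ?_
      rw [lintegral_add_right _ measurable_const, setLIntegral_const, hμAr,
        ← ENNReal.ofReal_mul hγ0.le]
      rw [hμ, Measure.restrict_restrict hCm, inter_comm, ← hA] at htilt
      refine (add_le_add htilt le_rfl).trans ?_
      rw [← ENNReal.ofReal_add (by positivity) (by positivity)]
      refine ENNReal.ofReal_le_ofReal ?_
      have := mul_le_mul_of_nonneg_left hold1 hγ0.le
      linarith)
    (by rw [hℓ]; apply le_of_eq; field_simp)
    (hsmall.trans_le (by
      rw [hζν4]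
      refine mul_le_mul_of_nonneg_left ?_ hη0.le
      linarith))
  set s : Euc (m + 1) → ℝ := fun x => max σ (s₀ x) with hs
  set f := expansion H a r s with hf
  have hsσ : ∀ x, σ ≤ s x := fun x => le_max_left _ _
  have hs1 : ∀ x, s x ≤ 1 := fun x => max_le hσ1.le (hs₀1 x)
  have hslip : ∀ x y, |s x - s y| ≤
      ℓ * ‖(x - (π x : Euc (m + 1))) - (y - (π y : Euc (m + 1)))‖ := fun x y => by
    refine (abs_max_sub_max_le_max σ (s₀ x) σ (s₀ y)).trans ?_
    rw [sub_self, abs_zero, max_eq_right (abs_nonneg _)]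
    exact hs₀lip x y
  have hc : 0 < δ' * r := by positivity
  obtain ⟨K, hlip⟩ := exists_lipschitzWith_expansion hc ha hσ0 hsσ hs1 hℓ0.le hslip
  have hid : ∀ x ∉ C, f x = x := by
    intro x hx
    by_cases h1 : ‖π x‖ ≤ r
    · have h2 : (1 + R⁻¹ * r) * ρ < d x := by
        by_contra hcon
        exact hx ⟨h1, not_lt.1 hcon⟩
      refine expansion_eq_self_of_one_le x (le_max_of_le_left ?_)
      change 1 ≤ max σ (s₀ x)
      rw [hs₀out x h2.le]
      exact le_max_right _ _
    · exact expansion_eq_self_of_norm hc ha (not_le.1 h1)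
  have hmaps : ∀ x ∈ C, f x ∈ C := by
    intro x hx
    refine ⟨norm_proj_expansion_le hc ha hσ0 hsσ hs1 hx.1, ?_⟩
    rw [hf, expansion_sub_proj]
    exact hx.2
  have hdist : ∀ x, ‖f x - x‖ ≤ 1 / (j : ℝ) ^ 2 := by
    intro x
    by_cases hx : x ∈ C
    · have h1 := expansion_sub_proj (H := H) (a := a) (r := r) (s := s) x
      have h2 : f x - x = ((π (f x) - π x : H) : Euc (m + 1)) := by
        rw [Submodule.coe_sub]
        rw [sub_eq_sub_iff_add_eq_add] at h1 ⊢
        exact h1.trans (add_comm _ _)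
      rw [h2, ← Submodule.coe_norm]
      refine (norm_sub_le _ _).trans ?_
      have h3 := (hmaps x hx).1
      have h4 := hx.1
      rw [one_div]
      linarith
    · rw [hid x hx, sub_self, norm_zero]; positivity
  have hr₂ : (1 + R⁻¹ * r) * ρ ≤ ((j : ℝ) ^ 2)⁻¹ := by nlinarith
  have hDle : 2 * r + 2 * ((1 + R⁻¹ * r) * ρ) + Metric.diam (Y : Set (Euc (m + 1))) ≤
      4 * ((j : ℝ) ^ 2)⁻¹ := by linarith
  have hj0 : (0 : ℝ) < j := by exact_mod_cast hj
  have hold : (k + 7 * η) * x₀ ≤ μ.real C := by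
    refine le_trans ?_ (hge'.trans (measureReal_mono hCsC hμC))
    gcongr
    have : (k + 1 - ζ) * (1 - (m + 1) * δ) = k + 1 - ζ - (k + 1 - ζ) * ((m + 1) * δ) := by ring
    rw [this, hη]
    linarith
  have hη8 : η ≤ 1 / 8 := by rw [hη]; linarith
  -- With diameter `4 / j ^ 2` the exponent is `4 / j`; since `k + 2 * η ≤ ν`, the surplus `5 * η`
  -- absorbs the factor `exp (4 / j)`.
  have hareaexp : ENNReal.ofReal (Real.exp (j * (4 * ((j : ℝ) ^ 2)⁻¹))) *
      μHE[m + 1] (f '' (Γ ∩ C)) ≤ μHE[m + 1] (Γ ∩ C) := by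
    have h1 : (j : ℝ) * (4 * ((j : ℝ) ^ 2)⁻¹) = 4 / j := by field_simp
    rw [h1, hμAr]
    refine (mul_le_mul_right harea _).trans ?_
    rw [← ENNReal.ofReal_mul (Real.exp_pos _).le]
    refine ENNReal.ofReal_le_ofReal (le_trans ?_ hold)
    rw [← mul_assoc]
    gcongr
    have h2 : 5 * η / ν * (k + 2 * η) ≤ 5 * η := by
      rw [div_mul_eq_mul_div, div_le_iff₀ (by linarith)]
      gcongr
      linarith
    calc Real.exp (4 / j) * (k + 2 * η) ≤ (1 + 5 * η / ν) * (k + 2 * η) := by gcongr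
      _ ≤ _ := by linarith
  have hdef : f ∈ localDeformations Ω E C j :=
    mem_localDeformations hΩ hE hmass hCcpt hlip
      (isConnected_fiber_expansion hσ0 hsσ hs1 hslip) hid hmaps hdist
      (volume_cylinderOver_le hYne hj hvol hDle)
      (fun x hx y hy => (norm_sub_le_of_mem_cylinderOver hYne hx hy).trans hDle) hareaexp
  refine (massReduction_le hdef).trans_lt ?_
  have hnew : (bdryMass (pushforward f E)).real C ≤ (k + 2 * η) * x₀ :=
    ENNReal.toReal_le_of_le_ofReal (by positivity)
      ((bdryMass_pushforward_le hdef.1.admissible hCm hid).trans harea)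
  rw [hmass]
  have h1 : γ * μ.real C < 5 * η * x₀ := by
    calc γ * μ.real C ≤ γ * (ν * x₀) := by gcongr
      _ = γ * ν * x₀ := by ring
      _ < _ := by gcongr
  change _ - μ.real C < -γ * μ.real C
  linarith

end Reduction

/-! ### Descent through the scales and choice of the constants. -/

/-- The lower mass bound follows if the mass ratio cannot drop at any scale. -/
theorem le_measureReal_cylinderOver {n : ℕ} {H : Submodule ℝ (Euc n)} {Y : Finset (Euc n)}
    {μ : Measure (Euc n)} [IsLocallyFiniteMeasure μ]
    (hYH : (Y : Set (Euc n)) ⊆ (Hᗮ : Submodule ℝ (Euc n))) (hY : Y.Nonempty)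
    (hdens : ∀ y ∈ Y, HasDensity μ y 1) {ζ R ρ δ : ℝ} (hζ : 0 < ζ) (hR : 0 < R) (hρ : 0 < ρ)
    (hδ : 0 < δ) (hδ1 : δ < 1)
    (hdrop : ∀ r ∈ Ioo 0 R, n ≠ 0 →
      μ.real (cylinderOver H Y r ((1 + R⁻¹ * r) * ρ)) < (Y.card - ζ) * unitBallVolume n * r ^ n →
      (Y.card - ζ) * unitBallVolume n * ((1 - δ) * r) ^ n ≤
        μ.real (cylinderOver H Y ((1 - δ) * r) ((1 + R⁻¹ * ((1 - δ) * r)) * ρ)) → False) :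
    (Y.card - ζ) * unitBallVolume n * R ^ n ≤ μ.real (cylinderOver H Y R (2 * ρ)) := by
  have hfin : ∀ r₁ r₂, μ (cylinderOver H Y r₁ r₂) ≠ ∞ := fun r₁ r₂ =>
    (isCompact_cylinderOver hY).measure_lt_top.ne
  have hev := eventually_le_measureReal_cylinderOver hYH hY hdens hζ hR hρ (unitBallVolume_pos n)
    hfin
  have hmono : ∀ r ∈ Ioo 0 R, μ.real (cylinderOver H Y r ((1 + R⁻¹ * r) * ρ)) ≤
      μ.real (cylinderOver H Y R (2 * ρ)) := fun r hr => by
    refine measureReal_mono (cylinderOver_mono hr.2.le ?_) (hfin _ _)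
    gcongr
    have : R⁻¹ * r ≤ 1 := by rw [inv_mul_le_iff₀ hR, mul_one]; exact hr.2.le
    linarith
  by_contra hcon
  rw [not_le] at hcon
  -- The hypotheses concern only `r < R`, so the strict inequality at `R` is moved slightly to the
  -- left by continuity.
  have hleft : ∀ᶠ r in 𝓝[<] R, μ.real (cylinderOver H Y R (2 * ρ)) <
      (Y.card - ζ) * unitBallVolume n * r ^ n := by
    have : Tendsto (fun r : ℝ => (Y.card - ζ) * unitBallVolume n * r ^ n) (𝓝 R)
      (𝓝 ((Y.card - ζ) * unitBallVolume n * R ^ n)) := Continuous.tendsto (by fun_prop) R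
    exact (this.eventually_const_lt hcon).filter_mono nhdsWithin_le_nhds
  obtain ⟨r₀, hr₀, hr₀R⟩ := (hleft.and (Ioo_mem_nhdsLT hR)).exists
  -- In dimension zero the power of the radius is constant, and monotonicity of the mass in the
  -- cylinder suffices; no deformation is needed.
  by_cases hn : n = 0
  · subst hn
    obtain ⟨r, hr, hrR⟩ := (hev.and (Ioo_mem_nhdsGT hR)).exists
    have := hmono r hrR
    simp only [pow_zero] at hr hcon
    linarith
  · obtain ⟨r, hr, h1, h2⟩ := exists_scale_crossing hδ hδ1 hr₀R ((hmono r₀ hr₀R).trans_lt hr₀) hev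
    exact hdrop r hr hn h1 h2

/-- The order of choice matters: `δ` makes the layer light and `δ'` keeps the centre off the wall at
little cost. Only then is `γ` chosen, because `tiltConst` blows up as `δ` or `δ'` tends to zero. -/
theorem exists_removal_constants (m : ℕ) {α ζ ν : ℝ} (hα : 0 < α) (hζ : ζ ∈ Ioo (0 : ℝ) 1)
    (hν : 1 ≤ ν) :
    ∃ δ ∈ Ioo (0 : ℝ) 1, ∃ δ' ∈ Ioc (0 : ℝ) 1, ∃ γ ∈ Ioo (0 : ℝ) 1,
      (m + 1) * δ * ν ≤ (1 - ζ) / 8 ∧ γ * ν < 5 * ((1 - ζ) / 8) ∧ 2 * ((m + 1) * δ') * ν ≤ ζ ∧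
      2 ^ (m + 2) * (4 ^ (m + 1) * ((m + 1) * δ * ν) +
        tiltConst m δ' (α * δ)⁻¹ * (2 * γ * ν)) < (1 - ζ) / 8 * (ζ / (4 * ν)) := by
  obtain ⟨hζ0, hζ1⟩ := hζ
  have hν0 : 0 < ν := by linarith
  have hm : (0 : ℝ) ≤ m := Nat.cast_nonneg m
  set η := (1 - ζ) / 8 with hη
  have hη0 : 0 < η := by rw [hη]; linarith
  have hη1 : η < 1 := by rw [hη]; linarith
  set t := η * (ζ / (4 * ν)) with ht
  have ht0 : 0 < t := by positivity
  set q := min η (t / (4 * (2 ^ (m + 2) * 4 ^ (m + 1)))) with hq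
  have hq0 : 0 < q := by positivity
  set δ := q / ((m + 1) * ν) with hδ
  have hδ0 : 0 < δ := by positivity
  have hδq : (m + 1) * δ * ν = q := by rw [hδ]; field_simp
  have hδ1 : δ < 1 := by
    rw [hδ, div_lt_one (by positivity)]
    have h1 : q ≤ η := min_le_left _ _
    nlinarith
  set δ' := ζ / (2 * (m + 1) * ν) with hδ'
  have hδ'0 : 0 < δ' := by positivity
  have hδ'1 : δ' ≤ 1 := by
    rw [hδ', div_le_one (by positivity)]
    nlinarith
  set D := tiltConst m δ' (α * δ)⁻¹ with hD
  have hD0 : 0 < D := by rw [hD, tiltConst]; positivity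
  set γ := min (1 / 2) (min (η / ν) (t / (4 * (2 ^ (m + 2) * D * (2 * ν))))) with hγ
  have hγ0 : 0 < γ := by positivity
  refine ⟨δ, ⟨hδ0, hδ1⟩, δ', ⟨hδ'0, hδ'1⟩, γ, ⟨hγ0, ?_⟩, ?_, ?_, ?_, ?_⟩
  · exact (min_le_left _ _).trans_lt (by norm_num)
  · rw [hδq]; exact min_le_left _ _
  · have : γ ≤ η / ν := (min_le_right _ _).trans (min_le_left _ _)
    rw [le_div_iff₀ hν0] at this
    linarith
  · apply le_of_eq
    rw [hδ']; field_simp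
  · have h1 : 4 * (2 ^ (m + 2) * 4 ^ (m + 1)) * q ≤ t := by
      have : q ≤ t / (4 * (2 ^ (m + 2) * 4 ^ (m + 1))) := min_le_right _ _
      rwa [le_div_iff₀ (by positivity), mul_comm] at this
    have h2 : 4 * (2 ^ (m + 2) * D * (2 * ν)) * γ ≤ t := by
      have : γ ≤ t / (4 * (2 ^ (m + 2) * D * (2 * ν))) :=
        (min_le_right _ _).trans (min_le_right _ _)
      rwa [le_div_iff₀ (by positivity), mul_comm] at this
    rw [hδq]
    calc 2 ^ (m + 2) * (4 ^ (m + 1) * q + D * (2 * γ * ν)) =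
          (4 * (2 ^ (m + 2) * 4 ^ (m + 1)) * q + 4 * (2 ^ (m + 2) * D * (2 * ν)) * γ) / 4 := by ring
      _ ≤ (t + t) / 4 := by gcongr
      _ < t := by linarith

theorem exists_index_bound (m : ℕ) {b : ℝ} (hb : 0 < b) :
    ∃ j₀ : ℕ, 0 < j₀ ∧ ∀ j : ℕ, j₀ ≤ j → Real.exp (4 / j) ≤ 1 + b ∧
      4 ^ (m + 2) * unitBallVolume (m + 2) ≤ j := by
  have h1 : ∀ᶠ j : ℕ in atTop, Real.exp (4 / j) < 1 + b := by
    have : Tendsto (fun j : ℕ => Real.exp (4 / (j : ℝ))) atTop (𝓝 1) := by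
      have := (Real.continuous_exp.tendsto 0).comp (tendsto_const_div_atTop_nhds_zero_nat (4 : ℝ))
      rwa [Real.exp_zero] at this
    exact this.eventually_lt_const (by linarith)
  have h2 := tendsto_natCast_atTop_atTop.eventually_ge_atTop
    ((4 : ℝ) ^ (m + 2) * unitBallVolume (m + 2))
  obtain ⟨j₀, hj₀⟩ := eventually_atTop.1 (h1.and h2)
  exact ⟨j₀ + 1, Nat.succ_pos _, fun j hj =>
    ⟨(hj₀ j (by omega)).1.le, (hj₀ j (by omega)).2⟩⟩

end OpenPartition

/-! ### The lemma. -/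

open OpenPartition in
theorem lemma8p1 (n ν : ℕ) (α ζ : ℝ) (hα : α ∈ Set.Ioo (0 : ℝ) 1) (hζ : ζ ∈ Set.Ioo (0 : ℝ) 1) :
    ∃ γ ∈ Set.Ioo (0 : ℝ) 1, ∃ j₀ : ℕ, 0 < j₀ ∧
      ∀ (Ω : Euc n → ℝ), IsWeightFunction Ω →
      ∀ (N : ℕ) (E : Fin N → Set (Euc n)), IsOpenPartition Ω E →
      ∀ (j : ℕ), j₀ ≤ j →
      ∀ R ∈ Set.Ioo (0 : ℝ) (1 / 2 * ((j : ℝ) ^ 2)⁻¹),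
      ∀ ρ ∈ Set.Ioo (0 : ℝ) (1 / 2 * ((j : ℝ) ^ 2)⁻¹),
      α * R ≤ ρ →
      ∀ (Y : Finset (Euc n)), (Y : Set (Euc n)) ⊆ ((horizontal n).1ᗮ : Submodule ℝ (Euc n)) →
      Y.card ≤ ν →
      Metric.diam (Y : Set (Euc n)) < ((j : ℝ) ^ 2)⁻¹ →
      (∀ y ∈ Y, HasDensity (bdryMass E) y 1) →
      (∀ r ∈ Set.Ioo 0 R,
        ∫ p in cylinder (Y : Set (Euc n)) r ((1 + R⁻¹ * r) * ρ) ×ˢ (Set.univ : Set (Grass n)),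
            ‖p.2.proj - (horizontal n).proj‖ ∂(bdryVarifold E) ≤
          γ * (bdryMass E).real (cylinder (Y : Set (Euc n)) r ((1 + R⁻¹ * r) * ρ))) →
      (∀ r ∈ Set.Ioo 0 R,
        -γ * (bdryMass E).real (cylinder (Y : Set (Euc n)) r ((1 + R⁻¹ * r) * ρ)) ≤
          massReduction Ω E j (cylinder (Y : Set (Euc n)) r ((1 + R⁻¹ * r) * ρ))) →
      ((Y.card : ℝ) - ζ) * unitBallVolume n * R ^ n ≤
        (bdryMass E).real (cylinder (Y : Set (Euc n)) R (2 * ρ)) := by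
  -- The constants are built with `ν + 1` in place of `ν`, which covers `ν = 0` as well.
  have hνR : (1 : ℝ) ≤ (ν : ℝ) + 1 := by
    have : (0 : ℝ) ≤ ν := Nat.cast_nonneg ν
    linarith
  -- For empty `Y` the left-hand side is negative.
  have hempty : ∀ (N : ℕ) (E : Fin N → Set (Euc n)) (R ρ : ℝ), 0 < R →
      (((∅ : Finset (Euc n)).card : ℝ) - ζ) * unitBallVolume n * R ^ n ≤
        (bdryMass E).real (cylinder ((∅ : Finset (Euc n)) : Set (Euc n)) R (2 * ρ)) := by
    intro N E R ρ hR
    refine le_trans ?_ measureReal_nonneg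
    have h1 := mul_pos (mul_pos hζ.1 (unitBallVolume_pos n)) (pow_pos hR n)
    rw [Finset.card_empty, Nat.cast_zero, zero_sub]
    linarith
  cases n with
  | zero =>
    refine ⟨1 / 2, ⟨by norm_num, by norm_num⟩, 1, one_pos, ?_⟩
    intro Ω hΩ N E hE j hj R hR ρ hρ hαR Y hYT hYν hdiam hdens _ _
    rcases Y.eq_empty_or_nonempty with rfl | hY
    · exact hempty N E R ρ hR.1
    obtain ⟨y₀, hy₀⟩ := hY
    have hmass := bdryMass_eq_of_aemeasurable (hdens y₀ hy₀).aemeasurable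
    have := hE.isLocallyFiniteMeasure hΩ
    rw [cylinder_eq_cylinderOver ⟨y₀, hy₀⟩ (by linarith [hρ.1]), hmass]
    rw [hmass] at hdens
    exact le_measureReal_cylinderOver hYT ⟨y₀, hy₀⟩ hdens hζ.1 hR.1 hρ.1 one_half_pos
      one_half_lt_one fun r hr h0 => absurd rfl h0
  | succ m =>
    obtain ⟨δ, hδ, δ', hδ', γ, hγ, hδν, hγν, hδ'ν, hsmall⟩ :=
      exists_removal_constants m hα.1 hζ hνR
    obtain ⟨j₀, hj₀, hj₀'⟩ := exists_index_bound m
      (b := 5 * ((1 - ζ) / 8) / ((ν : ℝ) + 1)) (by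
        have : 0 < 1 - ζ := sub_pos.2 hζ.2
        positivity)
    refine ⟨γ, hγ, j₀, hj₀, ?_⟩
    intro Ω hΩ N E hE j hj R hR ρ hρ hαR Y hYT hYν hdiam hdens htilt hred
    rcases Y.eq_empty_or_nonempty with rfl | hY
    · exact hempty N E R ρ hR.1
    obtain ⟨y₀, hy₀⟩ := hY
    have haem := (hdens y₀ hy₀).aemeasurable
    have hmass := bdryMass_eq_of_aemeasurable haem
    have := hE.isLocallyFiniteMeasure hΩ
    have hcyl : ∀ r ∈ Set.Ioo 0 R, cylinder (Y : Set (Euc (m + 1))) r ((1 + R⁻¹ * r) * ρ) =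
        cylinderOver (horizontal (m + 1)).1 Y r ((1 + R⁻¹ * r) * ρ) := fun r hr =>
      cylinder_eq_cylinderOver ⟨y₀, hy₀⟩ (by
        have h1 := hr.1; have h2 := hR.1; have h3 := hρ.1
        positivity)
    obtain ⟨k, hk⟩ := Nat.exists_eq_succ_of_ne_zero (Finset.card_pos.2 ⟨y₀, hy₀⟩).ne'
    have hkR : (Y.card : ℝ) = k + 1 := by rw [hk]; push_cast; rfl
    rw [cylinder_eq_cylinderOver ⟨y₀, hy₀⟩ (by linarith [hρ.1]), hmass]
    rw [hmass] at hdens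
    refine le_measureReal_cylinderOver hYT ⟨y₀, hy₀⟩ hdens hζ.1 hR.1 hρ.1 hδ.1 hδ.2 ?_
    intro r hr _ hlt hge
    have ht := htilt r hr
    have hre := hred r hr
    rw [hcyl r hr] at ht hre
    rw [hkR, mul_assoc] at hlt hge
    refine absurd hre (not_le.2 (massReduction_lt hΩ hE hmass (horizontal (m + 1)).2 (fun x => rfl)
      (aemeasurable_tilt haem) hk hdiam hα.1 hζ hδ hδ' hγ (ν := (ν : ℝ) + 1) ?_ (hj₀.trans_le hj)
      hR hρ hαR hr hδν hγν hδ'ν hsmall (hj₀' j hj).1 (hj₀' j hj).2 hlt hge ?_))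
    · have : (Y.card : ℝ) ≤ ν := by exact_mod_cast hYν
      linarith
    · have hfin : μHE[m + 1].restrict (bdry E)
          (cylinderOver (horizontal (m + 1)).1 Y r ((1 + R⁻¹ * r) * ρ)) ≠ ⊤ :=
        (isCompact_cylinderOver ⟨y₀, hy₀⟩).measure_lt_top.ne
      rw [hmass] at ht
      exact lintegral_tilt_le haem isClosed_cylinderOver.measurableSet hfin ht
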